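/- Let $\mathbb F\in\{\mathbb R,\mathbb C\}$, let $M$ be a smooth finite-dimensional Hausdorff manifold (not necessarily second countable), and write $R=C_c^\infty(M)$ for the commutative $\mathbb F$-algebra of smooth $\mathbb F$-valued functions on $M$ with compact support. For $f\in R$ and $x\in M$, $f_x$ denotes the germ of $f$ at $x$, and for open $W\subset M$ we write $C_c^\infty(W)=\{f\in R : \operatorname{supp} f\subset W\}$. **Functions and push-forward.** For a manifold $X$ which need not be Hausdorff, $C_c^\infty(X)$ is the linear span, in the space of not necessarily continuous sections of the sheaf of germs of functions on $X$, of the extensions by zero of smooth functions with compact support on Hausdorff open subsets of $X$; for $X=M$ this is $R$. A local diffeomorphism $\phi:X\to Y$ induces $\phi_+:C_c^\infty(X)\to C_c^\infty(Y)$, $\phi_+(u)_z=\sum_{\phi(y)=z}\phi_{*y}(u_y)$, where $\phi_{*y}$ is the induced isomorphism of germs. A local diffeomorphism $\pi:X\to M$ makes $C_c^\infty(X)$ an $R$-module by $(pu)_x=(p\circ\pi)_x\,u_x$. For local diffeomorphisms $\pi:X\to M$, $\xi:Y\to M$ let $\Omega_{\pi,\xi}:C_c^\infty(X)\otimes_R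 C_c^\infty(Y)\to C_c^\infty(X\times_M Y)$ be the linear isomorphism $\Omega(u\otimes v)_{(x,y)}=\mathrm{pr}_1^*(u_x)\,\mathrm{pr}_2^*(v_y)$. **The Hopf algebroid $C_c^\infty(G)$.** Let $G$ be an étale Lie groupoid over $M$: a groupoid with object manifold $M$ and a manifold $G$ of arrows, not necessarily Hausdorff, all of whose structure maps $s$, $t$, $\mathrm{uni}$, $\mathrm{inv}$, $\mathrm{mlt}$ are local diffeomorphisms. On $A=C_c^\infty(G)$ put: the (left) $R$-action along $t$; the comultiplication $\Delta=\Omega_{t,t}^{-1}\circ\mathrm{diag}_+:A\to A\otimes_R A$; the counit $\epsilon=t_+:A\to R$; the product $uv=\mathrm{mlt}_+(\Omega_{s,t}(u\otimes v))$; the inclusion $\mathrm{uni}_+:R\to A$; and the antipode $S=\mathrm{inv}_+$. **Spectral sheaf and spectral groupoid.** For $x\in M$ let $N_x(A)=\{a : fa=0\text{ for some } f\in R\text{ with }f_x=1\}$, $A_x=A/N_x(A)$, and let $a_x\in A_x$ be the class of $a$. An element $a\in A$ is *normalized* at $x$ if $\epsilon(a)_x=1$, and on $W$ if it is so at all points of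 $W$; it is *weakly grouplike* if $\Delta(a)=a\otimes a'$ for some $a'\in A$, and *$S$-invariant weakly grouplike* if some $a'\in A$ satisfies both $\Delta(a)=a\otimes a'$ and $\Delta(S(a))=S(a')\otimes S(a)$. The *spectral sheaf* $\mathcal E_{sp}(A)\to M$ has the stalk $\{\zeta\in A_x : \Delta_x(\zeta)=\zeta\otimes\zeta,\ \epsilon_x(\zeta)=1\}$ at $x$, where $\Delta_x$, $\epsilon_x$ are induced by $\Delta$, $\epsilon$, and the topology with basis the sets $c_W=\{c_x : x\in W\}$, for $W\subset M$ open and $c$ weakly grouplike and normalized on $W$. Let $\mathcal G_{sp}(A)\subset\mathcal E_{sp}(A)$ be the open subsheaf of those elements over $y$ that are of the form $a_y$ with $a$ an $S$-invariant weakly grouplike element normalized at $y$; its smooth structure is the one for which the sheaf projection to $M$ is a local diffeomorphism. It is a groupoid over $M$: if $a$ is $S$-invariant weakly grouplike and normalized on an open set $W$, there is a unique diffeomorphism $\tau_{W,a}:V\to W$ between open subsets of $M$ such that $f\mapsto\epsilon(S(fa))$ maps $C_c^\infty(W)$ onto $C_c^\infty(V)$ and equals $f\mapsto f\circ\tau_{W,a}$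 there; one puts $t(a_y)=y$, $s(a_y)=\tau_{W,a}^{-1}(y)$, $1_y=f_y$ for any $f\in R$ equal to $1$ near $y$, $(a_y)^{-1}=(S(a))_{s(a_y)}$, and $b_z a_y=(ba)_z$ if $s(b_z)=y$. **Theorem.** For every étale Lie groupoid $G$ over $M$ the above formulas determine a unique, well-defined groupoid structure on $\mathcal G_{sp}(C_c^\infty(G))$, which is then an étale Lie groupoid over $M$, and there is an isomorphism of étale Lie groupoids over $M$ (a diffeomorphism which is a functor and the identity on $M$) $$\Phi_G:G\longrightarrow\mathcal G_{sp}(C_c^\infty(G)),\qquad \Phi_G(g)=(f\circ t|_U)_{t(g)},$$ where $U$ is any open subset of $G$ with $g\in U$ on which $t$ is injective (in particular any bisection through $g$), $f\in C_c^\infty(t(U))$ is any function with $f_{t(g)}=1$, and $f\circ t|_U$ is extended by zero. It is natural in $G$: for every morphism $\phi:G\to H$ of étale Lie groupoids over $M$ (a smooth functor which is the identity on $M$), $\Phi_H\circ\phi=\mathcal G_{sp}(\phi_+)\circ\Phi_G$, where $\mathcal G_{sp}(\phi_+)$ maps $a_y$ to $(\phi_+(a))_y$. Moreover $\mathcal G_{sp}(C_c^\infty(G))=\mathcal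 E_{sp}(C_c^\infty(G))$. -/

import Mathlib

open scoped Manifold ContDiff Topology TensorProduct
open Filter Set

universe u v w x

namespace SpectralGroupoid

section Manifolds

variable {B : Type*} [NormedAddCommGroup B] [NormedSpace ℝ B]
variable {X : Type*} [TopologicalSpace X]
variable {Y : Type*} [TopologicalSpace Y] [ChartedSpace B Y]

/-- The smooth structure on `X` pulled back along a local homeomorphism `f : X → Y` into a
manifold: the charts of `X` are the composites of local restrictions of `f` with charts of `Y`. -/
@[reducible] noncomputable def pullbackCharts {f : X → Y} (hf : IsLocalHomeomorph f) :
    ChartedSpace B X where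
  atlas := {e | ∃ x : X, e = (hf.localInverseAt x).symm.trans (chartAt B (f x))}
  chartAt x := (hf.localInverseAt x).symm.trans (chartAt B (f x))
  mem_chart_source x := by
    simp
  chart_mem_atlas x := ⟨x, rfl⟩

theorem pullbackCharts_isManifold [IsManifold 𝓘(ℝ, B) ∞ Y] {f : X → Y}
    (hf : IsLocalHomeomorph f) :
    @IsManifold ℝ _ B _ _ B _ 𝓘(ℝ, B) ∞ X _ (pullbackCharts hf) := by
  let _ := pullbackCharts (B := B) hf
  have : HasGroupoid X (contDiffGroupoid ∞ 𝓘(ℝ, B)) := by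
    constructor
    rintro _ _ ⟨x, rfl⟩ ⟨x', rfl⟩
    have h := (contDiffGroupoid ∞ 𝓘(ℝ, B)).compatible (chart_mem_atlas B (f x))
      (chart_mem_atlas B (f x'))
    set c := chartAt B (f x)
    set c' := chartAt B (f x')
    set φ := (hf.localInverseAt x) with hφ
    set φ' := (hf.localInverseAt x') with hφ'
    have key : ∀ y ∈ φ.source, φ'.symm (φ y) = y := by
      intro y hy
      rw [show (φ'.symm : X → Y) = f from hf.localInverseAt_symm x']
      exact hf.apply_localInverseAt_of_mem hy
    refine (contDiffGroupoid ∞ 𝓘(ℝ, B)).mem_of_eqOnSource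
      (closedUnderRestriction' h ((φ.symm.trans c).symm.trans (φ'.symm.trans c')).open_source) ?_
    have hopen : IsOpen ((φ.symm.trans c).symm.trans (φ'.symm.trans c')).source :=
      OpenPartialHomeomorph.open_source _
    constructor
    · rw [OpenPartialHomeomorph.restr_source' _ _ hopen]
      ext y
      simp only [OpenPartialHomeomorph.trans_source,
        OpenPartialHomeomorph.symm_source, mem_inter_iff, mem_preimage,
        OpenPartialHomeomorph.trans_target, OpenPartialHomeomorph.coe_trans_symm,
        Function.comp_apply,
        OpenPartialHomeomorph.symm_symm, OpenPartialHomeomorph.symm_target]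
      constructor
      · rintro ⟨⟨h1, h2⟩, h3, h4⟩
        refine ⟨⟨h1, ?_⟩, ⟨h1, h2⟩, h3, h4⟩
        rwa [key _ h2] at h4
      · rintro ⟨-, h⟩
        exact h
    · rintro y ⟨⟨h1, h2⟩, -⟩
      simp only [OpenPartialHomeomorph.coe_trans, OpenPartialHomeomorph.coe_trans_symm,
        Function.comp_apply, OpenPartialHomeomorph.restr_apply, OpenPartialHomeomorph.symm_symm]
      rw [key _ h2]
  exact ⟨⟩

theorem pullbackCharts_isLocalDiffeomorph {f : X → Y} (hf : IsLocalHomeomorph f) :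
    @IsLocalDiffeomorph ℝ _ B _ _ B _ _ B _ B _ 𝓘(ℝ, B) 𝓘(ℝ, B) X _ (pullbackCharts hf) Y _ _ ∞
      f := by
  let _ := pullbackCharts (B := B) hf
  have h1 : ContMDiff 𝓘(ℝ, B) 𝓘(ℝ, B) ∞ f := by
    intro x
    rw [contMDiffAt_iff]
    refine ⟨hf.continuous.continuousAt, ?_⟩
    refine ContDiffWithinAt.congr_of_eventuallyEq_of_mem (f := id) contDiffWithinAt_id ?_
      (by simp)
    apply Filter.Eventually.filter_mono nhdsWithin_le_nhds
    have hx : chartAt B x = (hf.localInverseAt x).symm.trans (chartAt B (f x)) := rfl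
    have h2 : ∀ᶠ y in 𝓝 (chartAt B x x), y ∈ (chartAt B x).target :=
      (chartAt B x).open_target.mem_nhds (mem_chart_target B x)
    simp only [extChartAt, mfld_simps]
    filter_upwards [h2] with y hy
    have := (chartAt B x).right_inv hy
    nth_rw 1 [hx] at this
    simpa using this
  have h2 : ∀ x, ContMDiffOn 𝓘(ℝ, B) 𝓘(ℝ, B) ∞ (hf.localInverseAt x)
      (hf.localInverseAt x).source := by
    intro x y hy
    apply ContMDiffAt.contMDiffWithinAt
    rw [contMDiffAt_iff]
    refine ⟨(hf.localInverseAt x).continuousAt hy, ?_⟩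
    have hfy : f (hf.localInverseAt x y) = y := hf.apply_localInverseAt_of_mem hy
    refine ContDiffWithinAt.congr_of_eventuallyEq_of_mem (f := id) contDiffWithinAt_id ?_
      (by simp)
    apply Filter.Eventually.filter_mono nhdsWithin_le_nhds
    have hx : ∀ z, chartAt B (hf.localInverseAt x y) z = chartAt B y (f z) := by
      intro z
      change ((hf.localInverseAt _).symm.trans (chartAt B (f (hf.localInverseAt x y)))) z = _
      rw [hfy]
      simp
    have h3 : ∀ᶠ z in 𝓝 (chartAt B y y), z ∈ (chartAt B y).target :=
      (chartAt B y).open_target.mem_nhds (mem_chart_target B y)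
    have h4 : ∀ᶠ z in 𝓝 (chartAt B y y), (chartAt B y).symm z ∈ (hf.localInverseAt x).source :=
      ((chartAt B y).continuousAt_symm (mem_chart_target B y)).preimage_mem_nhds
        (by simpa using (hf.localInverseAt x).open_source.mem_nhds hy)
    simp only [extChartAt, mfld_simps]
    filter_upwards [h3, h4] with z hz hz'
    rw [hx, hf.apply_localInverseAt_of_mem hz',
      (chartAt B y).right_inv hz]
  intro x
  exact ⟨{ toPartialEquiv := (hf.localInverseAt x).symm.toPartialEquiv
           open_source := (hf.localInverseAt x).open_target
           open_target := (hf.localInverseAt x).open_source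
           contMDiffOn_toFun := by
             refine h1.contMDiffOn.congr fun y _ => ?_
             change (hf.localInverseAt x).symm y = f y
             rw [hf.localInverseAt_symm x]
           contMDiffOn_invFun := h2 x }, hf.self_mem_localInverseAt_target,
    fun y _ => by
      change f y = (hf.localInverseAt x).symm y
      rw [hf.localInverseAt_symm x]⟩

/-- If `g` and `g ∘ φ` are local diffeomorphisms and `φ` is continuous, then `φ` is a local
diffeomorphism. -/
theorem isLocalDiffeomorph_of_comp [ChartedSpace B X] {Z : Type*} [TopologicalSpace Z]
    [ChartedSpace B Z] {φ : X → Y} {g : Y → Z}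
    (hg : IsLocalDiffeomorph 𝓘(ℝ, B) 𝓘(ℝ, B) ∞ g)
    (hgφ : IsLocalDiffeomorph 𝓘(ℝ, B) 𝓘(ℝ, B) ∞ (g ∘ φ)) (hφ : Continuous φ) :
    IsLocalDiffeomorph 𝓘(ℝ, B) 𝓘(ℝ, B) ∞ φ := by
  intro x
  obtain ⟨P, hP, hPe⟩ := hgφ x
  obtain ⟨Q, hQ, hQe⟩ := hg (φ x)
  let e := (P.trans Q.symm).toOpenPartialHomeomorph.restrOpen (φ ⁻¹' Q.source)
    (Q.open_source.preimage hφ)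
  have hesub : e.source ⊆ (P.trans Q.symm).source := fun y hy => hy.1
  have hetsub : e.target ⊆ (P.trans Q.symm).target := fun y hy => hy.1
  have key : EqOn φ e e.source := by
    intro y hy
    have h1 : y ∈ P.source := hy.1.1
    have h2 : φ y ∈ Q.source := hy.2
    change φ y = Q.invFun (P.toFun y)
    have h3 : P.toFun y = Q.toFun (φ y) := by
      rw [← hQe h2]; exact (hPe h1).symm
    rw [h3]
    exact (Q.left_inv' h2).symm
  refine ⟨{ toPartialEquiv := e.toPartialEquiv
            open_source := e.open_source
            open_target := e.open_target
            contMDiffOn_toFun := (P.trans Q.symm).contMDiffOn_toFun.mono hesub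
            contMDiffOn_invFun := (P.trans Q.symm).contMDiffOn_invFun.mono hetsub }, ?_, key⟩
  refine ⟨⟨hP, ?_⟩, hQ⟩
  change P.toFun x ∈ Q.target
  have h3 : P.toFun x = Q.toFun (φ x) := by
    rw [← hQe hQ]; exact (hPe hP).symm
  rw [h3]
  exact Q.map_source' hQ

end Manifolds

section Functions

variable (𝕜 : Type*) [RCLike 𝕜]
variable (B : Type*) [NormedAddCommGroup B] [NormedSpace ℝ B]

instance : ContMDiffMul 𝓘(ℝ, 𝕜) ∞ 𝕜 :=
  { instNormedSpaceLieAddGroup with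
    contMDiff_mul := by
      rw [contMDiff_iff]
      refine ⟨continuous_mul, fun x y => ?_⟩
      simp only [mfld_simps, chartAt_self_eq]
      rw [contDiffOn_univ]
      exact contDiff_mul }

/-- The algebra `C_c^∞(M)` of smooth functions with compact support on a Hausdorff manifold `M`. -/
noncomputable def BaseAlg (M : Type*) [TopologicalSpace M] [ChartedSpace B M] :
    NonUnitalSubalgebra 𝕜 (M → 𝕜) where
  carrier := {f | ContMDiff 𝓘(ℝ, B) 𝓘(ℝ, 𝕜) ∞ f ∧ HasCompactSupport f}
  add_mem' hf hg := ⟨hf.1.add hg.1, hf.2.add hg.2⟩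
  zero_mem' := ⟨contMDiff_const, HasCompactSupport.zero⟩
  mul_mem' hf hg := ⟨hf.1.mul hg.1, hf.2.mul_right⟩
  smul_mem' c _ hf := ⟨contMDiff_const.mul hf.1, hf.2.smul_left (f := fun _ => c)⟩

variable {X : Type*} [TopologicalSpace X] [ChartedSpace B X]

/-- `f` restricts to a smooth function with compact support on `U` (for `U` open and Hausdorff).
The values of `f` outside `U` are irrelevant. -/
def IsCcOn (U : Set X) (f : X → 𝕜) : Prop :=
  ContMDiffOn 𝓘(ℝ, B) 𝓘(ℝ, 𝕜) ∞ f U ∧ ∃ K ⊆ U, IsCompact K ∧ ∀ x ∈ U, x ∉ K → f x = 0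

variable {𝕜} in
open Classical in
/-- The extension by zero of `f|_U` to a (not necessarily continuous) section of the sheaf of
germs of functions on `X`. -/
noncomputable def extZero (U : Set X) (f : X → 𝕜) : ∀ y : X, Germ (𝓝 y) 𝕜 :=
  fun y => if y ∈ U then (f : Germ (𝓝 y) 𝕜) else 0

variable (X) in
/-- The space `C_c^∞(X)` of smooth functions with compact support on a manifold `X` which need not
be Hausdorff: the linear span, among the not necessarily continuous sections of the sheaf of
germs, of the extensions by zero of smooth functions with compact support on Hausdorff open
subsets. -/
noncomputable def Cc : Submodule 𝕜 (∀ y : X, Germ (𝓝 y) 𝕜) :=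
  Submodule.span 𝕜 {s | ∃ (U : Set X) (f : X → 𝕜), IsOpen U ∧ T2Space U ∧ IsCcOn 𝕜 B U f ∧
    s = extZero U f}

variable {𝕜 B}

theorem extZero_mem {U : Set X} {f : X → 𝕜} (hU : IsOpen U) (hT : T2Space U)
    (hf : IsCcOn 𝕜 B U f) : extZero U f ∈ Cc 𝕜 B X :=
  Submodule.subset_span ⟨U, f, hU, hT, hf, rfl⟩

theorem extZero_congr {U : Set X} {f g : X → 𝕜} (hU : IsOpen U) (h : EqOn f g U) :
    extZero U f = extZero U g := by
  funext y
  by_cases hy : y ∈ U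
  · simp only [extZero, hy, if_true]
    exact Germ.coe_eq.2 (h.eventuallyEq_of_mem (hU.mem_nhds hy))
  · simp only [extZero, hy, if_false]

theorem extZero_add (U : Set X) (f g : X → 𝕜) :
    extZero U (f + g) = extZero U f + extZero U g := by
  funext y
  by_cases hy : y ∈ U <;> simp [extZero, hy]

/-- Shrinking the Hausdorff open subset on which a function with compact support is considered. -/
theorem extZero_shrink {U V : Set X} {f : X → 𝕜} (hU : IsOpen U) (hT : T2Space U) (hVU : V ⊆ U)
    {K : Set X} (hK : IsCompact K) (hKV : K ⊆ V) (hf : ∀ x ∈ U, x ∉ K → f x = 0) :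
    extZero U f = extZero V f := by
  funext y
  by_cases hyV : y ∈ V
  · simp [extZero, hyV, hVU hyV]
  by_cases hyU : y ∈ U
  · simp only [extZero, hyV, hyU, if_true, if_false]
    have hcl : IsClosed (((↑) : U → X) ⁻¹' K) := by
      refine IsCompact.isClosed ?_
      exact (Topology.IsEmbedding.subtypeVal.isCompact_preimage_iff
        (by rw [Subtype.range_coe]; exact hKV.trans hVU)).2 hK
    have hop : IsOpen (U \ K) := by
      have := hU.isOpenMap_subtype_val _ hcl.isOpen_compl
      rwa [← preimage_compl, Subtype.image_preimage_coe] at this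
    refine Germ.coe_eq.2 ?_
    filter_upwards [hop.mem_nhds ⟨hyU, fun h => hyV (hKV h)⟩] with x hx
    exact hf x hx.1 hx.2
  · simp [extZero, hyV, hyU]

theorem exists_bump [FiniteDimensional ℝ B] [IsManifold 𝓘(ℝ, B) ∞ X] {U : Set X} (hU : IsOpen U)
    (hT : T2Space U) {x : X} (hx : x ∈ U) {N : Set X} (hN : N ∈ 𝓝 x) :
    ∃ θ : X → 𝕜, ContMDiffOn 𝓘(ℝ, B) 𝓘(ℝ, 𝕜) ∞ θ U ∧ (∀ᶠ y in 𝓝 x, θ y = 1) ∧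
      ∃ K ⊆ N ∩ U, IsCompact K ∧ ∀ y ∈ U, y ∉ K → θ y = 0 := by
  let V : TopologicalSpace.Opens X := ⟨U, hU⟩
  have : T2Space V := hT
  let x' : V := ⟨x, hx⟩
  have hN' : ((↑) : V → X) ⁻¹' N ∈ 𝓝 x' := continuous_subtype_val.continuousAt.preimage_mem_nhds hN
  obtain ⟨b, -, hb⟩ := (SmoothBumpFunction.nhds_basis_tsupport (I := 𝓘(ℝ, B)) x').mem_iff.1 hN'
  classical
  let θ : X → 𝕜 := fun y => if h : y ∈ U then ((b ⟨y, h⟩ : ℝ) : 𝕜) else 0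
  have hθ : ∀ y : V, θ y = ((b y : ℝ) : 𝕜) := fun y => by
    have : (y : X) ∈ U := y.2
    simp [θ, this]
  refine ⟨θ, ?_, ?_, ((↑) : V → X) '' tsupport b, ?_, ?_, ?_⟩
  · intro y hy
    apply ContMDiffAt.contMDiffWithinAt
    have : ContMDiffAt 𝓘(ℝ, B) 𝓘(ℝ, 𝕜) ∞ (fun z : V => θ z) (⟨y, hy⟩ : V) := by
      simp_rw [hθ]
      exact (RCLike.ofRealCLM (K := 𝕜)).contDiff.contMDiff.contMDiffAt.comp _ b.contMDiffAt
    exact contMDiffAt_subtype_iff.1 this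
  · have h1 : ∀ᶠ y in 𝓝 x', b y = 1 := b.eventuallyEq_one
    have h2 : map ((↑) : V → X) (𝓝 x') = 𝓝 x := hU.isOpenEmbedding_subtypeVal.map_nhds_eq x'
    rw [← h2, eventually_map]
    filter_upwards [h1] with y hy
    simp [hθ, hy]
  · rintro _ ⟨y, hy, rfl⟩
    exact ⟨hb hy, y.2⟩
  · exact IsCompact.image b.hasCompactSupport continuous_subtype_val
  · intro y hy hyK
    have : θ y = ((b ⟨y, hy⟩ : ℝ) : 𝕜) := hθ ⟨y, hy⟩
    have h0 : b ⟨y, hy⟩ = 0 := image_eq_zero_of_notMem_tsupport fun h => hyK ⟨_, h, rfl⟩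
    rw [this, h0, RCLike.ofReal_zero]

/-- A partition of unity argument: `C_c^∞(X)` is spanned by functions with compact support in
arbitrarily small open subsets. -/
theorem Cc_le [FiniteDimensional ℝ B] [IsManifold 𝓘(ℝ, B) ∞ X] (P : Set X → Prop)
    (hP : ∀ x : X, ∃ V, IsOpen V ∧ x ∈ V ∧ ∀ V' ⊆ V, P V')
    (S : Submodule 𝕜 (∀ y : X, Germ (𝓝 y) 𝕜))
    (hS : ∀ (V : Set X) (f : X → 𝕜), IsOpen V → T2Space V → P V → IsCcOn 𝕜 B V f →
      extZero V f ∈ S) : Cc 𝕜 B X ≤ S := by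
  refine Submodule.span_le.2 ?_
  rintro _ ⟨U, f, hU, hT, ⟨hf, K, hKU, hK, hfK⟩, rfl⟩
  have key : ∃ θ : X → 𝕜, ContMDiffOn 𝓘(ℝ, B) 𝓘(ℝ, 𝕜) ∞ θ U ∧ (∀ y ∈ K, θ y = 1) ∧
      ∀ g : X → 𝕜, IsCcOn 𝕜 B U g → extZero U (θ * g) ∈ S := by
    refine hK.induction_on
      (p := fun T => ∃ θ : X → 𝕜, ContMDiffOn 𝓘(ℝ, B) 𝓘(ℝ, 𝕜) ∞ θ U ∧ (∀ y ∈ T, θ y = 1) ∧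
        ∀ g : X → 𝕜, IsCcOn 𝕜 B U g → extZero U (θ * g) ∈ S) ?_ ?_ ?_ ?_
    · refine ⟨0, contMDiffOn_const, by simp, fun g _ => ?_⟩
      have : extZero U ((0 : X → 𝕜) * g) = 0 := by
        funext y; by_cases hy : y ∈ U <;> simp [extZero, hy]
      rw [this]; exact S.zero_mem
    · rintro s t hst ⟨θ, h1, h2, h3⟩
      exact ⟨θ, h1, fun y hy => h2 y (hst hy), h3⟩
    · rintro s t ⟨θ, h1, h2, h3⟩ ⟨η, k1, k2, k3⟩
      refine ⟨θ + (η - η * θ), h1.add (k1.sub (k1.mul h1)), ?_, ?_⟩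
      · rintro y (hy | hy)
        · simp [h2 y hy]
        · simp [k2 y hy]
      · intro g hg
        have : (θ + (η - η * θ)) * g = θ * g + η * (g - θ * g) := by ring
        rw [this, extZero_add]
        refine S.add_mem (h3 g hg) (k3 _ ?_)
        obtain ⟨hg1, L, hL, hL', hgL⟩ := hg
        refine ⟨hg1.sub (h1.mul hg1), L, hL, hL', fun x hx hxL => ?_⟩
        simp [hgL x hx hxL]
    · intro x hx
      obtain ⟨V, hV, hxV, hPV⟩ := hP x
      obtain ⟨θ, h1, h2, L, hL, hL', hθL⟩ :=
        exists_bump (𝕜 := 𝕜) (B := B) hU hT (hKU hx) (hV.mem_nhds hxV)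
      refine ⟨{y | θ y = 1}, mem_nhdsWithin_of_mem_nhds h2, θ, h1, fun y hy => hy, ?_⟩
      intro g hg
      have hz : ∀ y ∈ U, y ∉ L → (θ * g) y = 0 := fun y hy hyL => by simp [hθL y hy hyL]
      rw [extZero_shrink (V := V ∩ U) hU hT inter_subset_right hL' hL hz]
      refine hS _ _ (hV.inter hU) ?_ (hPV _ inter_subset_left) ⟨?_, L, hL, hL', ?_⟩
      · exact (Topology.IsEmbedding.inclusion (inter_subset_right : V ∩ U ⊆ U)).t2Space
      · exact (h1.mul hg.1).mono inter_subset_right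
      · exact fun y hy => hz y hy.2
  obtain ⟨θ, h1, h2, h3⟩ := key
  have : extZero U f = extZero U (θ * f) := by
    refine extZero_congr hU fun y hy => ?_
    by_cases hyK : y ∈ K
    · simp [h2 y hyK]
    · simp [hfK y hy hyK]
  rw [this]
  exact h3 f ⟨hf, K, hKU, hK, hfK⟩

end Functions

section Push

variable {𝕜 : Type*} [RCLike 𝕜]
variable {B : Type*} [NormedAddCommGroup B] [NormedSpace ℝ B]
variable {X : Type*} [TopologicalSpace X] {Y : Type*} [TopologicalSpace Y]

theorem tendsto_localInverseAt {φ : X → Y} (hφ : IsLocalHomeomorph φ) {y : X} {z : Y}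
    (h : φ y = z) : Tendsto (hφ.localInverseAt y) (𝓝 z) (𝓝 y) := by
  subst h
  have := (hφ.localInverseAt y).continuousAt hφ.apply_self_mem_localInverseAt_source
  rwa [ContinuousAt, hφ.localInverseAt_apply_self] at this

/-- The pull-back `φ_y^*` of germs along a map continuous at `y`. -/
def germPull (φ : X → Y) {y : X} (hφ : ContinuousAt φ y) (γ : Germ (𝓝 (φ y)) 𝕜) :
    Germ (𝓝 y) 𝕜 :=
  γ.compTendsto φ hφ

/-- The push-forward `φ_{*y}` of germs along a local homeomorphism `φ` with `φ y = z`, that is,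
composition with a local inverse of `φ`; it is the inverse of `φ_y^*`. -/
noncomputable def germPush {φ : X → Y} (hφ : IsLocalHomeomorph φ) {y : X} {z : Y} (h : φ y = z)
    (γ : Germ (𝓝 y) 𝕜) : Germ (𝓝 z) 𝕜 :=
  γ.compTendsto (hφ.localInverseAt y) (tendsto_localInverseAt hφ h)

section
variable {φ : X → Y} (hφ : IsLocalHomeomorph φ) {y : X} {z : Y} (h : φ y = z)

theorem germPush_coe (f : X → 𝕜) :
    germPush hφ h (f : Germ (𝓝 y) 𝕜) = ((f ∘ hφ.localInverseAt y : Y → 𝕜) : Germ (𝓝 z) 𝕜) := rfl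

theorem germPush_zero : germPush hφ h (0 : Germ (𝓝 y) 𝕜) = 0 := rfl

theorem germPush_add (γ δ : Germ (𝓝 y) 𝕜) :
    germPush hφ h (γ + δ) = germPush hφ h γ + germPush hφ h δ := by
  induction γ using Germ.inductionOn with | _ f
  induction δ using Germ.inductionOn with | _ g
  rfl

theorem germPush_mul (γ δ : Germ (𝓝 y) 𝕜) :
    germPush hφ h (γ * δ) = germPush hφ h γ * germPush hφ h δ := by
  induction γ using Germ.inductionOn with | _ f
  induction δ using Germ.inductionOn with | _ g
  rfl

theorem germPush_smul (c : 𝕜) (γ : Germ (𝓝 y) 𝕜) :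
    germPush hφ h (c • γ) = c • germPush hφ h γ := by
  induction γ using Germ.inductionOn with | _ f
  rfl

theorem germPush_comp (g : Y → 𝕜) :
    germPush hφ h ((g ∘ φ : X → 𝕜) : Germ (𝓝 y) 𝕜) = (g : Germ (𝓝 z) 𝕜) := by
  subst h
  rw [germPush_coe]
  refine Germ.coe_eq.2 ?_
  filter_upwards [(hφ.localInverseAt y).open_source.mem_nhds
    hφ.apply_self_mem_localInverseAt_source] with w hw
  simp [hφ.apply_localInverseAt_of_mem hw]

theorem germPush_germPull (γ : Germ (𝓝 (φ y)) 𝕜) :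
    germPush hφ rfl (germPull φ hφ.continuous.continuousAt γ) = γ := by
  induction γ using Germ.inductionOn with | _ f
  exact germPush_comp hφ rfl f

end

theorem germPull_add {φ : X → Y} {y : X} (hφ : ContinuousAt φ y) (γ δ : Germ (𝓝 (φ y)) 𝕜) :
    germPull φ hφ (γ + δ) = germPull φ hφ γ + germPull φ hφ δ := by
  induction γ using Germ.inductionOn with | _ f
  induction δ using Germ.inductionOn with | _ g
  rfl

theorem germPull_smul {φ : X → Y} {y : X} (hφ : ContinuousAt φ y) (c : 𝕜)
    (γ : Germ (𝓝 (φ y)) 𝕜) : germPull φ hφ (c • γ) = c • germPull φ hφ γ := by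
  induction γ using Germ.inductionOn with | _ f
  rfl

theorem germPull_mul {φ : X → Y} {y : X} (hφ : ContinuousAt φ y) (γ δ : Germ (𝓝 (φ y)) 𝕜) :
    germPull φ hφ (γ * δ) = germPull φ hφ γ * germPull φ hφ δ := by
  induction γ using Germ.inductionOn with | _ f
  induction δ using Germ.inductionOn with | _ g
  rfl

/-- The section `φ_+(u)` of germs, `φ_+(u)_z = ∑_{y ∈ φ⁻¹(z)} φ_{*y}(u_y)`. -/
noncomputable def pushSection {φ : X → Y} (hφ : IsLocalHomeomorph φ)
    (u : ∀ y : X, Germ (𝓝 y) 𝕜) : ∀ z : Y, Germ (𝓝 z) 𝕜 :=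
  fun z => ∑ᶠ y : {y : X // φ y = z}, germPush hφ y.2 (u y)

variable [ChartedSpace B X] [ChartedSpace B Y]

theorem exists_injOn {φ : X → Y} (hφ : IsLocalHomeomorph φ) (x : X) :
    ∃ V, IsOpen V ∧ x ∈ V ∧ ∀ V' ⊆ V, InjOn φ V' :=
  ⟨_, (hφ.localInverseAt x).open_target, hφ.self_mem_localInverseAt_target,
    fun _ h => hφ.injOn_localInverseAt_target.mono h⟩

theorem finite_support [FiniteDimensional ℝ B] [IsManifold 𝓘(ℝ, B) ∞ X] {φ : X → Y}
    (hφ : IsLocalHomeomorph φ) {u : ∀ y : X, Germ (𝓝 y) 𝕜} (hu : u ∈ Cc 𝕜 B X) (z : Y) :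
    {y : X | φ y = z ∧ u y ≠ 0}.Finite := by
  let S : Submodule 𝕜 (∀ y : X, Germ (𝓝 y) 𝕜) :=
    { carrier := {u | {y : X | φ y = z ∧ u y ≠ 0}.Finite}
      add_mem' := by
        intro a b ha hb
        refine (ha.union hb).subset ?_
        rintro y ⟨h1, h2⟩
        by_contra h
        simp only [mem_union, mem_ofPred_eq, not_or, not_and, not_not] at h
        exact h2 (by rw [Pi.add_apply, h.1 h1, h.2 h1, add_zero])
      zero_mem' := by simp
      smul_mem' := by
        intro c a ha
        refine ha.subset ?_
        rintro y ⟨h1, h2⟩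
        exact ⟨h1, fun h => h2 (by rw [Pi.smul_apply, h, smul_zero])⟩ }
  refine Cc_le (fun V => InjOn φ V) (exists_injOn hφ) S ?_ hu
  intro V f _ _ hV _
  refine Set.Subsingleton.finite ?_
  rintro a ⟨ha, ha'⟩ b ⟨hb, hb'⟩
  have hh : ∀ y, extZero V f y ≠ 0 → y ∈ V := fun y hy => by
    by_contra h
    exact hy (by simp [extZero, h])
  exact hV (hh a ha') (hh b hb') (ha.trans hb.symm)

theorem hasFiniteSupport [FiniteDimensional ℝ B] [IsManifold 𝓘(ℝ, B) ∞ X] {φ : X → Y}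
    (hφ : IsLocalHomeomorph φ) {u : ∀ y : X, Germ (𝓝 y) 𝕜} (hu : u ∈ Cc 𝕜 B X) (z : Y) :
    Function.HasFiniteSupport
      (fun y : {y : X // φ y = z} => germPush hφ y.2 (u y)) := by
  have h : ((↑) ⁻¹' {y : X | φ y = z ∧ u y ≠ 0} : Set {y : X // φ y = z}).Finite :=
    (finite_support hφ hu z).preimage Subtype.val_injective.injOn
  refine h.subset ?_
  intro y hy
  refine ⟨y.2, fun h0 => hy ?_⟩
  simp only [h0, germPush_zero]

theorem pushSection_extZero {φ : X → Y} (hφ : IsLocalHomeomorph φ) {V : Set X} (hV : IsOpen V)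
    (hinj : InjOn φ V) (f : X → 𝕜) (σ : Y → X) (hσ : ∀ y ∈ V, σ (φ y) = y) :
    pushSection hφ (extZero V f) = extZero (φ '' V) (f ∘ σ) := by
  funext z
  by_cases hz : z ∈ φ '' V
  · obtain ⟨y, hy, rfl⟩ := hz
    rw [pushSection, finsum_eq_single _ (⟨y, rfl⟩ : {y' : X // φ y' = φ y})]
    · have : φ y ∈ φ '' V := ⟨y, hy, rfl⟩
      simp only [extZero, hy, this, if_true]
      rw [germPush_coe]
      refine Germ.coe_eq.2 ?_
      have h1 : ∀ᶠ w in 𝓝 (φ y), hφ.localInverseAt y w ∈ V :=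
        (tendsto_localInverseAt hφ rfl).eventually (hV.mem_nhds hy)
      filter_upwards [h1, (hφ.localInverseAt y).open_source.mem_nhds
        hφ.apply_self_mem_localInverseAt_source] with w hw hw'
      have h2 := hσ _ hw
      rw [hφ.apply_localInverseAt_of_mem hw'] at h2
      simp [h2]
    · rintro ⟨y', hy'⟩ hne
      have : y' ∉ V := fun h => hne (Subtype.ext (hinj h hy hy'))
      simp only [extZero, this, if_false, germPush_zero]
  · have : ∀ y : {y : X // φ y = z}, germPush hφ y.2 (extZero V f y) = 0 := by
      rintro ⟨y, hy⟩
      have : y ∉ V := fun h => hz ⟨y, h, hy⟩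
      simp only [extZero, this, if_false, germPush_zero]
    simp only [pushSection, this, finsum_zero]
    simp only [extZero, hz, if_false]

theorem contMDiffAt_leftInv {φ : X → Y} (hφ : IsLocalDiffeomorph 𝓘(ℝ, B) 𝓘(ℝ, B) ∞ φ)
    {V : Set X} (hV : IsOpen V) {σ : Y → X} (hσ : ∀ y ∈ V, σ (φ y) = y) {y : X} (hy : y ∈ V) :
    ContMDiffAt 𝓘(ℝ, B) 𝓘(ℝ, B) ∞ σ (φ y) := by
  obtain ⟨P, hP, hPe⟩ := hφ y
  have hyt : φ y ∈ P.target := by rw [hPe hP]; exact P.map_source' hP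
  have h1 : ContMDiffAt 𝓘(ℝ, B) 𝓘(ℝ, B) ∞ P.invFun (φ y) :=
    P.contMDiffOn_invFun.contMDiffAt (P.open_target.mem_nhds hyt)
  refine h1.congr_of_eventuallyEq ?_
  have hy' : P.invFun (φ y) = y := by rw [hPe hP]; exact P.left_inv' hP
  have h2 : ∀ᶠ w in 𝓝 (φ y), P.invFun w ∈ V :=
    h1.continuousAt.preimage_mem_nhds (by rw [hy']; exact hV.mem_nhds hy)
  filter_upwards [h2, P.open_target.mem_nhds hyt] with w hw hw'
  have h3 := hσ _ hw
  rw [hPe (P.map_target' hw')] at h3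
  have h4 : P.toFun (P.invFun w) = w := P.right_inv' hw'
  rw [← h3]
  change σ w = σ (P.toFun (P.invFun w))
  rw [h4]

theorem pushSection_mem [FiniteDimensional ℝ B] [IsManifold 𝓘(ℝ, B) ∞ X] {φ : X → Y}
    (hφ : IsLocalDiffeomorph 𝓘(ℝ, B) 𝓘(ℝ, B) ∞ φ) {u : ∀ y : X, Germ (𝓝 y) 𝕜}
    (hu : u ∈ Cc 𝕜 B X) : pushSection hφ.isLocalHomeomorph u ∈ Cc 𝕜 B Y := by
  have hl := hφ.isLocalHomeomorph
  let S : Submodule 𝕜 (∀ y : X, Germ (𝓝 y) 𝕜) :=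
    { carrier := {u | u ∈ Cc 𝕜 B X ∧ pushSection hl u ∈ Cc 𝕜 B Y}
      add_mem' := by
        rintro a b ⟨ha, ha'⟩ ⟨hb, hb'⟩
        refine ⟨add_mem ha hb, ?_⟩
        convert add_mem ha' hb' using 1
        funext z
        simp only [pushSection, Pi.add_apply, germPush_add]
        exact finsum_add_distrib (hasFiniteSupport hl ha z) (hasFiniteSupport hl hb z)
      zero_mem' := by
        refine ⟨zero_mem _, ?_⟩
        convert zero_mem (Cc 𝕜 B Y) using 1
        funext z
        simp [pushSection, germPush_zero]
      smul_mem' := by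
        rintro c a ⟨ha, ha'⟩
        refine ⟨Submodule.smul_mem _ c ha, ?_⟩
        convert Submodule.smul_mem _ c ha' using 1
        funext z
        simp only [pushSection, Pi.smul_apply, germPush_smul]
        exact (smul_finsum' c (hasFiniteSupport hl ha z)).symm }
  refine (Cc_le (fun V => InjOn φ V) (exists_injOn hl) S ?_ hu).2
  intro V f hV hT hinj hf
  refine ⟨extZero_mem hV hT hf, ?_⟩
  change pushSection hl (extZero V f) ∈ Cc 𝕜 B Y
  obtain hE | ⟨⟨x0⟩⟩ := isEmpty_or_nonempty X
  · convert zero_mem (Cc 𝕜 B Y) using 1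
    funext z
    have : IsEmpty {y : X // φ y = z} := ⟨fun y => hE.elim y.1⟩
    rw [pushSection, finsum_of_isEmpty]
    rfl
  have : Nonempty X := ⟨x0⟩
  have hσ : ∀ y ∈ V, Function.invFunOn φ V (φ y) = y := fun y hy => hinj.leftInvOn_invFunOn hy
  rw [pushSection_extZero hl hV hinj f _ hσ]
  obtain ⟨hf1, K, hK, hK', hfK⟩ := hf
  have hc : ∀ y ∈ V, ContMDiffAt 𝓘(ℝ, B) 𝓘(ℝ, B) ∞ (Function.invFunOn φ V) (φ y) :=
    fun y hy => contMDiffAt_leftInv hφ hV hσ hy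
  refine extZero_mem (hl.isOpenMap _ hV) ?_ ⟨?_, φ '' K, image_mono hK,
    hK'.image hl.continuous, ?_⟩
  · have hm : MapsTo (Function.invFunOn φ V) (φ '' V) V := by
      rintro _ ⟨y, hy, rfl⟩; rw [hσ y hy]; exact hy
    refine T2Space.of_injective_continuous (f := hm.restrict) ?_ ?_
    · rintro ⟨_, y, hy, rfl⟩ ⟨_, y', hy', rfl⟩ h
      have : Function.invFunOn φ V (φ y) = Function.invFunOn φ V (φ y') := congrArg Subtype.val h
      rw [hσ y hy, hσ y' hy'] at this
      subst this; rfl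
    · refine ContinuousOn.mapsToRestrict ?_ hm
      rintro _ ⟨y, hy, rfl⟩
      exact (hc y hy).continuousAt.continuousWithinAt
  · rintro _ ⟨y, hy, rfl⟩
    apply ContMDiffAt.contMDiffWithinAt
    refine ContMDiffAt.comp (φ y) ?_ (hc y hy)
    rw [hσ y hy]
    exact hf1.contMDiffAt (hV.mem_nhds hy)
  · rintro _ ⟨y, hy, rfl⟩ hyK
    rw [Function.comp_apply, hσ y hy]
    exact hfK y hy fun h => hyK ⟨y, h, rfl⟩

/-- The linear map `φ_+ : C_c^∞(X) → C_c^∞(Y)` induced by a local diffeomorphism `φ : X → Y`. -/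
noncomputable def pushforward [FiniteDimensional ℝ B] [IsManifold 𝓘(ℝ, B) ∞ X] {φ : X → Y}
    (hφ : IsLocalDiffeomorph 𝓘(ℝ, B) 𝓘(ℝ, B) ∞ φ) : Cc 𝕜 B X →ₗ[𝕜] Cc 𝕜 B Y where
  toFun u := ⟨pushSection hφ.isLocalHomeomorph u.1, pushSection_mem hφ u.2⟩
  map_add' u v := by
    refine Subtype.ext (funext fun z => ?_)
    simp only [pushSection, Submodule.coe_add, Pi.add_apply, germPush_add]
    exact finsum_add_distrib (hasFiniteSupport _ u.2 z) (hasFiniteSupport _ v.2 z)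
  map_smul' c u := by
    refine Subtype.ext (funext fun z => ?_)
    simp only [pushSection, Submodule.coe_smul, Pi.smul_apply, germPush_smul, RingHom.id_apply]
    exact (smul_finsum' c (hasFiniteSupport _ u.2 z)).symm

end Push

section Fibre

variable {𝕜 : Type*} [RCLike 𝕜]
variable {B : Type*} [NormedAddCommGroup B] [NormedSpace ℝ B]
variable {X Y M : Type*} [TopologicalSpace X] [TopologicalSpace Y] [TopologicalSpace M]
  [ChartedSpace B X] [ChartedSpace B Y] [ChartedSpace B M]

/-- The fibred product `X ×_M Y` of two local diffeomorphisms `f : X → M` and `g : Y → M`. -/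
@[ext] structure FibreProd {f : X → M} {g : Y → M}
    (hf : IsLocalDiffeomorph 𝓘(ℝ, B) 𝓘(ℝ, B) ∞ f)
    (hg : IsLocalDiffeomorph 𝓘(ℝ, B) 𝓘(ℝ, B) ∞ g) where
  /-- The first projection. -/
  fst : X
  /-- The second projection. -/
  snd : Y
  comm : f fst = g snd

theorem germ_smul_mul {α : Type*} {l : Filter α} (c : 𝕜) (γ δ : Germ l 𝕜) :
    (c • γ) * δ = c • (γ * δ) := by
  induction γ using Germ.inductionOn with | _ a
  induction δ using Germ.inductionOn with | _ b
  change (((c • a) * b : α → 𝕜) : Germ l 𝕜) = ((c • (a * b) : α → 𝕜) : Germ l 𝕜)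
  rw [smul_mul_assoc]

theorem germ_mul_smul {α : Type*} {l : Filter α} (c : 𝕜) (γ δ : Germ l 𝕜) :
    γ * (c • δ) = c • (γ * δ) := by
  rw [mul_comm, germ_smul_mul, mul_comm]

namespace FibreProd

variable {f : X → M} {g : Y → M} {hf : IsLocalDiffeomorph 𝓘(ℝ, B) 𝓘(ℝ, B) ∞ f}
  {hg : IsLocalDiffeomorph 𝓘(ℝ, B) 𝓘(ℝ, B) ∞ g}

/-- The underlying pair. -/
def toProd (p : FibreProd hf hg) : X × Y := (p.fst, p.snd)

/-- The topology of a subspace of `X × Y`. -/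
instance : TopologicalSpace (FibreProd hf hg) := TopologicalSpace.induced toProd inferInstance

theorem isInducing_toProd : Topology.IsInducing (toProd : FibreProd hf hg → X × Y) := ⟨rfl⟩

theorem injective_toProd : Function.Injective (toProd : FibreProd hf hg → X × Y) :=
  fun _ _ h => FibreProd.ext (congrArg Prod.fst h) (congrArg Prod.snd h)

theorem continuous_fst : Continuous (fst : FibreProd hf hg → X) :=
  _root_.continuous_fst.comp isInducing_toProd.continuous

theorem continuous_snd : Continuous (snd : FibreProd hf hg → Y) :=
  _root_.continuous_snd.comp isInducing_toProd.continuous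

theorem range_toProd :
    range (toProd : FibreProd hf hg → X × Y) = {q : X × Y | f q.1 = g q.2} := by
  ext q
  exact ⟨fun ⟨p, hp⟩ => hp ▸ p.comm, fun h => ⟨⟨q.1, q.2, h⟩, rfl⟩⟩

theorem isLocalHomeomorph_fst : IsLocalHomeomorph (fst : FibreProd hf hg → X) := by
  refine IsLocalHomeomorph.mk _ fun p => ?_
  have hl := hg.isLocalHomeomorph
  let e := hl.localInverseAt p.snd
  let W : Set X := f ⁻¹' e.source
  have hfc : Continuous f := hf.isLocalHomeomorph.continuous
  have hW : IsOpen W := e.open_source.preimage hfc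
  have hse : ∀ y, e.symm y = g y := fun y => congrFun (hl.localInverseAt_symm p.snd) y
  have hcomm : ∀ x ∈ W, f x = g (e (f x)) := fun x hx => (hl.apply_localInverseAt_of_mem hx).symm
  classical
  refine ⟨{ toFun := fst
            invFun := fun x => if hx : x ∈ W then ⟨x, e (f x), hcomm x hx⟩ else p
            source := snd ⁻¹' e.target
            target := W
            map_source' := ?_
            map_target' := ?_
            left_inv' := ?_
            right_inv' := ?_
            open_source := e.open_target.preimage continuous_snd
            open_target := hW
            continuousOn_toFun := continuous_fst.continuousOn
            continuousOn_invFun := ?_ }, ?_, fun _ _ => rfl⟩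
  · intro q hq
    change f q.fst ∈ e.source
    rw [q.comm, ← hse]
    exact e.map_target hq
  · intro x hx
    simp only [hx, dif_pos]
    exact e.map_source hx
  · intro q hq
    have hq' : fst q ∈ W := by
      change f q.fst ∈ e.source
      rw [q.comm, ← hse]
      exact e.map_target hq
    simp only [hq', dif_pos]
    refine FibreProd.ext rfl ?_
    change e (f q.fst) = q.snd
    rw [q.comm, ← hse]
    exact e.right_inv hq
  · intro x hx
    simp only [hx, dif_pos]
  · rw [isInducing_toProd.continuousOn_iff]
    have : ContinuousOn (fun x => (x, e (f x))) W :=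
      continuousOn_id.prodMk (e.continuousOn.comp hfc.continuousOn fun x hx => hx)
    refine this.congr fun x hx => ?_
    simp only [Function.comp_apply, hx, dif_pos]
    rfl
  · exact hl.self_mem_localInverseAt_target

/-- The smooth structure of the fibred product, for which the projections are local
diffeomorphisms. -/
noncomputable instance : ChartedSpace B (FibreProd hf hg) := pullbackCharts isLocalHomeomorph_fst

instance [IsManifold 𝓘(ℝ, B) ∞ X] : IsManifold 𝓘(ℝ, B) ∞ (FibreProd hf hg) :=
  pullbackCharts_isManifold _

theorem isLocalDiffeomorph_fst :
    IsLocalDiffeomorph 𝓘(ℝ, B) 𝓘(ℝ, B) ∞ (fst : FibreProd hf hg → X) :=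
  pullbackCharts_isLocalDiffeomorph _

theorem isLocalDiffeomorph_snd :
    IsLocalDiffeomorph 𝓘(ℝ, B) 𝓘(ℝ, B) ∞ (snd : FibreProd hf hg → Y) := by
  refine isLocalDiffeomorph_of_comp hg ?_ continuous_snd
  have : g ∘ (snd : FibreProd hf hg → Y) = f ∘ fst := funext fun p => p.comm.symm
  rw [this]
  exact fun p => (isLocalDiffeomorph_fst p).comp 𝓘(ℝ, B) M (hf _)

/-- The diagonal map `X → X ×_M X`. -/
def diag (hf : IsLocalDiffeomorph 𝓘(ℝ, B) 𝓘(ℝ, B) ∞ f) (x : X) : FibreProd hf hf := ⟨x, x, rfl⟩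

theorem isLocalDiffeomorph_diag (hf : IsLocalDiffeomorph 𝓘(ℝ, B) 𝓘(ℝ, B) ∞ f) :
    IsLocalDiffeomorph 𝓘(ℝ, B) 𝓘(ℝ, B) ∞ (diag hf) := by
  refine isLocalDiffeomorph_of_comp (isLocalDiffeomorph_fst (hf := hf) (hg := hf)) ?_ ?_
  · exact (Diffeomorph.refl 𝓘(ℝ, B) X ∞).isLocalDiffeomorph
  · exact isInducing_toProd.continuous_iff.2 (continuous_id.prodMk continuous_id)

end FibreProd

variable {f : X → M} {g : Y → M} (hf : IsLocalDiffeomorph 𝓘(ℝ, B) 𝓘(ℝ, B) ∞ f)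
  (hg : IsLocalDiffeomorph 𝓘(ℝ, B) 𝓘(ℝ, B) ∞ g)

/-- The section `Ω(u ⊗ v)_{(x,y)} = (pr₁)^*(u_x) (pr₂)^*(v_y)` over `X ×_M Y`. -/
noncomputable def omegaSection (u : ∀ x : X, Germ (𝓝 x) 𝕜) (v : ∀ y : Y, Germ (𝓝 y) 𝕜) :
    ∀ p : FibreProd hf hg, Germ (𝓝 p) 𝕜 :=
  fun p => germPull FibreProd.fst FibreProd.continuous_fst.continuousAt (u p.fst) *
    germPull FibreProd.snd FibreProd.continuous_snd.continuousAt (v p.snd)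

theorem omegaSection_mem [T2Space M] {u : ∀ x : X, Germ (𝓝 x) 𝕜} (hu : u ∈ Cc 𝕜 B X)
    {v : ∀ y : Y, Germ (𝓝 y) 𝕜} (hv : v ∈ Cc 𝕜 B Y) :
    omegaSection hf hg u v ∈ Cc 𝕜 B (FibreProd hf hg) := by
  induction hu, hv using Submodule.span_induction₂ with
  | mem_mem u v hu hv =>
    obtain ⟨U, a, hU, hTU, ⟨ha, K, hK, hK', haK⟩, rfl⟩ := hu
    obtain ⟨V, b, hV, hTV, ⟨hb, L, hL, hL', hbL⟩, rfl⟩ := hv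
    have hW : IsOpen (FibreProd.fst ⁻¹' U ∩ FibreProd.snd ⁻¹' V : Set (FibreProd hf hg)) :=
      (hU.preimage FibreProd.continuous_fst).inter (hV.preimage FibreProd.continuous_snd)
    have : omegaSection hf hg (extZero U a) (extZero V b) =
        extZero (FibreProd.fst ⁻¹' U ∩ FibreProd.snd ⁻¹' V)
          ((a ∘ FibreProd.fst) * (b ∘ FibreProd.snd)) := by
      funext p
      by_cases h1 : p.fst ∈ U
      · by_cases h2 : p.snd ∈ V
        · simp only [omegaSection, extZero, mem_inter_iff, mem_preimage, h1, h2, and_self, if_true]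
          rfl
        · simp only [omegaSection, extZero, mem_inter_iff, mem_preimage, h1, h2, and_false,
            if_true, if_false]
          exact mul_zero _
      · simp only [omegaSection, extZero, mem_inter_iff, mem_preimage, h1, false_and, if_false]
        exact zero_mul _
    rw [this]
    refine extZero_mem hW ?_ ⟨?_, FibreProd.fst ⁻¹' K ∩ FibreProd.snd ⁻¹' L, ?_, ?_, ?_⟩
    · refine T2Space.of_injective_continuous (Y := U × V)
        (f := fun p => (⟨p.1.fst, p.2.1⟩, ⟨p.1.snd, p.2.2⟩)) ?_ ?_
      · intro p q h
        simp only [Prod.mk.injEq, Subtype.mk.injEq] at h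
        exact Subtype.ext (FibreProd.ext h.1 h.2)
      · exact ((FibreProd.continuous_fst.comp continuous_subtype_val).subtype_mk _).prodMk
          ((FibreProd.continuous_snd.comp continuous_subtype_val).subtype_mk _)
    · refine ContMDiffOn.mul ?_ ?_
      · exact ha.comp FibreProd.isLocalDiffeomorph_fst.contMDiff.contMDiffOn fun p hp => hp.1
      · exact hb.comp FibreProd.isLocalDiffeomorph_snd.contMDiff.contMDiffOn fun p hp => hp.2
    · exact fun p hp => ⟨hK hp.1, hL hp.2⟩
    · have hi : Topology.IsClosedEmbedding (FibreProd.toProd : FibreProd hf hg → X × Y) :=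
        ⟨⟨FibreProd.isInducing_toProd, FibreProd.injective_toProd⟩, by
          rw [FibreProd.range_toProd]
          exact isClosed_eq (hf.isLocalHomeomorph.continuous.comp _root_.continuous_fst)
            (hg.isLocalHomeomorph.continuous.comp _root_.continuous_snd)⟩
      exact hi.isCompact_preimage (hK'.prod hL')
    · rintro p ⟨h1, h2⟩ hp
      by_cases hpK : p.fst ∈ K
      · have : p.snd ∉ L := fun h => hp ⟨hpK, h⟩
        simp [hbL _ h2 this]
      · simp [haK _ h1 hpK]
  | zero_left v hv =>
    convert zero_mem (Cc 𝕜 B (FibreProd hf hg)) using 1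
    funext p
    exact zero_mul _
  | zero_right u hu =>
    convert zero_mem (Cc 𝕜 B (FibreProd hf hg)) using 1
    funext p
    exact mul_zero _
  | add_left a b c _ _ _ h1 h2 =>
    convert add_mem h1 h2 using 1
    funext p
    simp only [omegaSection, Pi.add_apply, germPull_add, add_mul]
  | add_right a b c _ _ _ h1 h2 =>
    convert add_mem h1 h2 using 1
    funext p
    simp only [omegaSection, Pi.add_apply, germPull_add, mul_add]
  | smul_left r a b _ _ h =>
    convert Submodule.smul_mem _ r h using 1
    funext p
    simp only [omegaSection, Pi.smul_apply, germPull_smul, germ_smul_mul]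
  | smul_right r a b _ _ h =>
    convert Submodule.smul_mem _ r h using 1
    funext p
    simp only [omegaSection, Pi.smul_apply, germPull_smul, germ_mul_smul]

/-- The bilinear map `(u, v) ↦ Ω(u ⊗ v)` from `C_c^∞(X) × C_c^∞(Y)` to `C_c^∞(X ×_M Y)`. -/
noncomputable def omega [T2Space M] : Cc 𝕜 B X →ₗ[𝕜] Cc 𝕜 B Y →ₗ[𝕜] Cc 𝕜 B (FibreProd hf hg) :=
  LinearMap.mk₂ 𝕜 (fun u v => ⟨omegaSection hf hg u.1 v.1, omegaSection_mem hf hg u.2 v.2⟩)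
    (fun a b c => Subtype.ext <| funext fun p => by
      simp only [omegaSection, Submodule.coe_add, Pi.add_apply, germPull_add, add_mul])
    (fun r a b => Subtype.ext <| funext fun p => by
      simp only [omegaSection, Submodule.coe_smul, Pi.smul_apply, germPull_smul, germ_smul_mul])
    (fun a b c => Subtype.ext <| funext fun p => by
      simp only [omegaSection, Submodule.coe_add, Pi.add_apply, germPull_add, mul_add])
    (fun r a b => Subtype.ext <| funext fun p => by
      simp only [omegaSection, Submodule.coe_smul, Pi.smul_apply, germPull_smul, germ_mul_smul])

/-- `C_c^∞(X)` is closed under multiplication by functions pulled back from `M`. -/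
theorem smul_section_mem (hf : IsLocalDiffeomorph 𝓘(ℝ, B) 𝓘(ℝ, B) ∞ f) {p : M → 𝕜} (hp : p ∈ BaseAlg 𝕜 B M) {u : ∀ x : X, Germ (𝓝 x) 𝕜}
    (hu : u ∈ Cc 𝕜 B X) :
    (fun x => ((p ∘ f : X → 𝕜) : Germ (𝓝 x) 𝕜) * u x) ∈ Cc 𝕜 B X := by
  induction hu using Submodule.span_induction with
  | mem u hu =>
    obtain ⟨U, a, hU, hTU, ⟨ha, K, hK, hK', haK⟩, rfl⟩ := hu
    have : (fun x => ((p ∘ f : X → 𝕜) : Germ (𝓝 x) 𝕜) * extZero U a x) =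
        extZero U ((p ∘ f) * a) := by
      funext x
      by_cases h : x ∈ U
      · simp [extZero, h]
      · simp [extZero, h]
    rw [this]
    exact extZero_mem hU hTU ⟨(hp.1.comp hf.contMDiff).contMDiffOn.mul ha, K, hK, hK',
      fun x hx hxK => by simp [haK x hx hxK]⟩
  | zero =>
    convert zero_mem (Cc 𝕜 B X) using 1
    funext x
    exact mul_zero _
  | add a b _ _ h1 h2 =>
    convert add_mem h1 h2 using 1
    funext x
    exact mul_add _ _ _
  | smul r a _ h =>
    convert Submodule.smul_mem _ r h using 1
    funext x
    exact germ_mul_smul _ _ _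

/-- The action of `C_c^∞(M)` on `C_c^∞(X)` for a sheaf `f : X → M`, `(pu)_x = f_x^*(p_{f x}) u_x`,
as a homomorphism of algebras from `C_c^∞(M)` to the linear endomorphisms of `C_c^∞(X)`. -/
noncomputable def sheafAct : BaseAlg 𝕜 B M →ₙₐ[𝕜] Module.End 𝕜 (Cc 𝕜 B X) where
  toFun p :=
    { toFun := fun u => ⟨fun x => ((p.1 ∘ f : X → 𝕜) : Germ (𝓝 x) 𝕜) * u.1 x,
        smul_section_mem hf p.2 u.2⟩
      map_add' := fun u v => Subtype.ext <| funext fun x => mul_add _ _ _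
      map_smul' := fun r u => Subtype.ext <| funext fun x => germ_mul_smul _ _ _ }
  map_smul' r p := LinearMap.ext fun u => Subtype.ext <| funext fun x => by
    change (((r • p.1) ∘ f : X → 𝕜) : Germ (𝓝 x) 𝕜) * u.1 x = r • (_ * u.1 x)
    rw [← germ_smul_mul]
    rfl
  map_zero' := LinearMap.ext fun u => Subtype.ext <| funext fun x => by
    change (0 : Germ (𝓝 x) 𝕜) * u.1 x = 0
    rw [zero_mul]
  map_add' p q := LinearMap.ext fun u => Subtype.ext <| funext fun x => by
    change (((p.1 ∘ f : X → 𝕜) : Germ (𝓝 x) 𝕜) + ((q.1 ∘ f : X → 𝕜) : Germ (𝓝 x) 𝕜)) * u.1 x = _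
    rw [add_mul]
    rfl
  map_mul' p q := LinearMap.ext fun u => Subtype.ext <| funext fun x => by
    change (((p.1 ∘ f : X → 𝕜) : Germ (𝓝 x) 𝕜) * ((q.1 ∘ f : X → 𝕜) : Germ (𝓝 x) 𝕜)) * u.1 x = _
    rw [mul_assoc]
    rfl

/-- On a Hausdorff manifold an element of `C_c^∞(M)` is the same thing as a smooth function with
compact support: the function is recovered from the values of the germs. -/
theorem value_mem [T2Space M] {u : ∀ x : M, Germ (𝓝 x) 𝕜} (hu : u ∈ Cc 𝕜 B M) :
    (fun x => (u x).value) ∈ BaseAlg 𝕜 B M := by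
  induction hu using Submodule.span_induction with
  | mem u hu =>
    obtain ⟨U, a, hU, hTU, ⟨ha, K, hK, hK', haK⟩, rfl⟩ := hu
    have h0 : ∀ x, x ∉ K → (extZero U a x).value = 0 := by
      intro x hx
      by_cases h : x ∈ U
      · simp only [extZero, h, if_true]; exact haK x h hx
      · simp only [extZero, h, if_false]; rfl
    refine ⟨fun x => ?_, HasCompactSupport.intro hK' h0⟩
    by_cases h : x ∈ U
    · refine (ha.contMDiffAt (hU.mem_nhds h)).congr_of_eventuallyEq ?_
      filter_upwards [hU.mem_nhds h] with y hy
      simp only [extZero, hy, if_true]; rfl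
    · refine (contMDiffAt_const (c := (0 : 𝕜))).congr_of_eventuallyEq ?_
      filter_upwards [hK'.isClosed.isOpen_compl.mem_nhds (fun hx => h (hK hx))] with y hy
      exact h0 y hy
  | zero => exact zero_mem (BaseAlg 𝕜 B M)
  | add a b _ _ h1 h2 =>
    convert add_mem h1 h2 using 1
    funext x
    exact Germ.valueAddHom.map_add _ _
  | smul r a _ h =>
    convert SMulMemClass.smul_mem r h using 1
    funext x
    exact (Germ.valueₗ (𝕜 := 𝕜)).map_smul r (a x)

/-- The identification of `C_c^∞(M)`, as a space of sections of germs, with the algebra of smooth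
functions with compact support on the Hausdorff manifold `M`. -/
noncomputable def toBase [T2Space M] : Cc 𝕜 B M →ₗ[𝕜] BaseAlg 𝕜 B M where
  toFun u := ⟨fun x => (u.1 x).value, value_mem u.2⟩
  map_add' u v := Subtype.ext <| funext fun x => Germ.valueAddHom.map_add _ _
  map_smul' r u := Subtype.ext <| funext fun x => (Germ.valueₗ (𝕜 := 𝕜)).map_smul r (u.1 x)

/-- The inverse identification: a function is sent to the section of its germs. -/
noncomputable def ofBase [T2Space M] : BaseAlg 𝕜 B M →ₗ[𝕜] Cc 𝕜 B M where
  toFun p := ⟨extZero univ p.1, extZero_mem isOpen_univ inferInstance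
    ⟨p.2.1.contMDiffOn, tsupport p.1, subset_univ _, p.2.2, fun _ _ h =>
      image_eq_zero_of_notMem_tsupport h⟩⟩
  map_add' p q := Subtype.ext (extZero_add univ p.1 q.1)
  map_smul' r p := Subtype.ext <| funext fun x => by simp [extZero]

theorem toBase_ofBase [T2Space M] (p : BaseAlg 𝕜 B M) : toBase (ofBase p) = p := by
  refine Subtype.ext (funext fun x => ?_)
  simp [toBase, ofBase, extZero]

/-- The element `p ∘ f|_U` of `C_c^∞(X)`, for an `f`-elementary open subset `U` of `X` and
`p ∈ C_c^∞(f(U))`. -/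
theorem lift_mem [T2Space M] (hf : IsLocalDiffeomorph 𝓘(ℝ, B) 𝓘(ℝ, B) ∞ f) {U : Set X} (hU : IsOpen U) (hinj : InjOn f U) (p : BaseAlg 𝕜 B M)
    (hp : tsupport p.1 ⊆ f '' U) : extZero U (p.1 ∘ f) ∈ Cc 𝕜 B X := by
  have hl := hf.isLocalHomeomorph
  refine extZero_mem hU ?_ ⟨(p.2.1.comp hf.contMDiff).contMDiffOn, U ∩ f ⁻¹' tsupport p.1,
    inter_subset_left, ?_, ?_⟩
  · exact T2Space.of_injective_continuous (f := fun x : U => f x) (injOn_iff_injective.1 hinj)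
      (hl.continuous.comp continuous_subtype_val)
  · have hoe : Topology.IsOpenEmbedding (fun x : U => f x) :=
      Topology.IsOpenEmbedding.of_continuous_injective_isOpenMap
        (hl.continuous.comp continuous_subtype_val) (injOn_iff_injective.1 hinj)
        (hl.isOpenMap.comp hU.isOpenMap_subtype_val)
    have hr : range (fun x : U => f x) = f '' U := by
      rw [image_eq_range]
    have h1 : IsCompact ((fun x : U => f x) ⁻¹' tsupport p.1) :=
      (hoe.isInducing.isCompact_preimage_iff (by rwa [hr])).2 p.2.2
    have h2 := h1.image continuous_subtype_val
    convert h2 using 1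
    ext x
    simp [and_comm]
  · intro x hx hxK
    have : f x ∉ tsupport p.1 := fun h => hxK ⟨hx, h⟩
    have h0 : p.1 (f x) = 0 := image_eq_zero_of_notMem_tsupport this
    exact h0

end Fibre

section Tensor

variable {𝕜 : Type*} [RCLike 𝕜] {R : Type*}
variable {C D : Type*} [AddCommGroup C] [Module 𝕜 C] [AddCommGroup D] [Module 𝕜 D]

/-- The subspace spanned by `r c ⊗ d - c ⊗ r d`, for actions `a`, `b` of `R` on `C`, `D`. -/
def tensorRel (a : R → Module.End 𝕜 C) (b : R → Module.End 𝕜 D) : Submodule 𝕜 (C ⊗[𝕜] D) :=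
  Submodule.span 𝕜 {w | ∃ r c d, w = a r c ⊗ₜ[𝕜] d - c ⊗ₜ[𝕜] b r d}

/-- The tensor product `C ⊗_R D` with respect to actions `a`, `b` of `R` on `C`, `D`, as a quotient
of `C ⊗ D`. -/
abbrev TensorOver (a : R → Module.End 𝕜 C) (b : R → Module.End 𝕜 D) :=
  (C ⊗[𝕜] D) ⧸ tensorRel a b

/-- The element `c ⊗ d` of `C ⊗_R D`. -/
def TensorOver.tmul (a : R → Module.End 𝕜 C) (b : R → Module.End 𝕜 D) (c : C) (d : D) :
    TensorOver a b :=
  (tensorRel a b).mkQ (c ⊗ₜ[𝕜] d)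

/-- The linear map on `C ⊗_R D` induced by a balanced bilinear map. -/
def TensorOver.lift {E : Type*} [AddCommGroup E] [Module 𝕜 E] (a : R → Module.End 𝕜 C)
    (b : R → Module.End 𝕜 D) (β : C →ₗ[𝕜] D →ₗ[𝕜] E)
    (hβ : ∀ r c d, β (a r c) d = β c (b r d)) : TensorOver a b →ₗ[𝕜] E :=
  (tensorRel a b).liftQ (TensorProduct.lift β) <| by
    refine Submodule.span_le.2 ?_
    rintro _ ⟨r, c, d, rfl⟩
    simp [hβ]

end Tensor

section Omega

variable {𝕜 : Type*} [RCLike 𝕜]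
variable {B : Type*} [NormedAddCommGroup B] [NormedSpace ℝ B]
variable {X Y M : Type*} [TopologicalSpace X] [TopologicalSpace Y] [TopologicalSpace M]
  [ChartedSpace B X] [ChartedSpace B Y] [ChartedSpace B M] [T2Space M]
variable {f : X → M} {g : Y → M} (hf : IsLocalDiffeomorph 𝓘(ℝ, B) 𝓘(ℝ, B) ∞ f)
  (hg : IsLocalDiffeomorph 𝓘(ℝ, B) 𝓘(ℝ, B) ∞ g)

theorem omega_balanced (p : BaseAlg 𝕜 B M) (u : Cc 𝕜 B X) (v : Cc 𝕜 B Y) :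
    omega hf hg (sheafAct hf p u) v = omega hf hg u (sheafAct hg p v) := by
  refine Subtype.ext (funext fun q => ?_)
  change germPull _ _ (((p.1 ∘ f : X → 𝕜) : Germ (𝓝 q.fst) 𝕜) * u.1 q.fst) *
    germPull _ _ (v.1 q.snd) = germPull _ _ (u.1 q.fst) *
      germPull _ _ (((p.1 ∘ g : Y → 𝕜) : Germ (𝓝 q.snd) 𝕜) * v.1 q.snd)
  rw [germPull_mul, germPull_mul]
  have h : germPull FibreProd.fst FibreProd.continuous_fst.continuousAt
      ((p.1 ∘ f : X → 𝕜) : Germ (𝓝 q.fst) 𝕜) =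
      germPull FibreProd.snd FibreProd.continuous_snd.continuousAt
        ((p.1 ∘ g : Y → 𝕜) : Germ (𝓝 q.snd) 𝕜) := by
    have h0 : (p.1 ∘ f) ∘ (FibreProd.fst : FibreProd hf hg → X) = (p.1 ∘ g) ∘ FibreProd.snd :=
      funext fun q => congrArg p.1 q.comm
    exact congrArg (fun k : FibreProd hf hg → 𝕜 => (k : Germ (𝓝 q) 𝕜)) h0
  rw [h]
  ring

/-- The linear map `Ω : C_c^∞(X) ⊗_{C_c^∞(M)} C_c^∞(Y) → C_c^∞(X ×_M Y)`; it is a bijection. -/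
noncomputable def omegaBar :
    TensorOver (sheafAct (𝕜 := 𝕜) hf) (sheafAct (𝕜 := 𝕜) hg) →ₗ[𝕜] Cc 𝕜 B (FibreProd hf hg) :=
  TensorOver.lift _ _ (omega hf hg) (omega_balanced hf hg)

/-- `φ_+` is a homomorphism of `C_c^∞(M)`-modules, for a map `φ` over `M`. -/
theorem pushforward_sheafAct [FiniteDimensional ℝ B] [IsManifold 𝓘(ℝ, B) ∞ X] {φ : X → Y}
    (hφ : IsLocalDiffeomorph 𝓘(ℝ, B) 𝓘(ℝ, B) ∞ φ) (h : ∀ x, g (φ x) = f x) (p : BaseAlg 𝕜 B M)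
    (u : Cc 𝕜 B X) :
    pushforward hφ (sheafAct hf p u) = sheafAct hg p (pushforward hφ u) := by
  refine Subtype.ext (funext fun z => ?_)
  change ∑ᶠ y : {y : X // φ y = z}, germPush hφ.isLocalHomeomorph y.2
      (((p.1 ∘ f : X → 𝕜) : Germ (𝓝 y.1) 𝕜) * u.1 y.1) =
    ((p.1 ∘ g : Y → 𝕜) : Germ (𝓝 z) 𝕜) *
      ∑ᶠ y : {y : X // φ y = z}, germPush hφ.isLocalHomeomorph y.2 (u.1 y.1)
  refine Eq.trans (finsum_congr fun y => ?_) (mul_finsum' _ _ (hasFiniteSupport _ u.2 z)).symm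
  have h0 : p.1 ∘ f = (p.1 ∘ g) ∘ φ := funext fun x => (congrArg p.1 (h x)).symm
  rw [germPush_mul, h0, germPush_comp]

end Omega

section Spectral

variable (𝕜 : Type*) [RCLike 𝕜]
variable (B : Type*) [NormedAddCommGroup B] [NormedSpace ℝ B]
variable (M : Type*) [TopologicalSpace M] [ChartedSpace B M]

/-- The operations of a coalgebra `C` over `R = C_c^∞(M)`: the action of `R`, the comultiplication
and the counit. -/
structure CoalgebraOps (C : Type*) [AddCommGroup C] [Module 𝕜 C] where
  act : BaseAlg 𝕜 B M →ₙₐ[𝕜] Module.End 𝕜 C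
  comul : C → TensorOver act act
  counit : C → BaseAlg 𝕜 B M

/-- The operations of a Hopf algebroid `A` over `R = C_c^∞(M)`: the coalgebra operations, with
respect to the left action of `R`, the inclusion of `R` into `A`, the product and the antipode. -/
structure HopfAlgebroidOps (A : Type*) [AddCommGroup A] [Module 𝕜 A] extends
    CoalgebraOps 𝕜 B M A where
  incl : BaseAlg 𝕜 B M → A
  mul : A → A → A
  antipode : A → A

variable {𝕜 B M}
variable [FiniteDimensional ℝ B] [IsManifold 𝓘(ℝ, B) ∞ M] [T2Space M]

theorem exists_baseAlg_eq_one (x : M) : ∃ f : BaseAlg 𝕜 B M, ∀ᶠ y in 𝓝 x, f.1 y = 1 := by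
  obtain ⟨θ, h1, h2, K, -, hK, hθ⟩ := exists_bump (𝕜 := 𝕜) (B := B) (isOpen_univ (X := M))
    inferInstance (mem_univ x) univ_mem
  exact ⟨⟨θ, contMDiffOn_univ.1 h1, HasCompactSupport.intro hK fun y hy => hθ y (mem_univ y) hy⟩,
    h2⟩

section Stalk

variable {C D : Type*} [AddCommGroup C] [Module 𝕜 C] [AddCommGroup D] [Module 𝕜 D]
variable (act : BaseAlg 𝕜 B M →ₙₐ[𝕜] Module.End 𝕜 C)
variable (act' : BaseAlg 𝕜 B M →ₙₐ[𝕜] Module.End 𝕜 D)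

theorem act_comm (p q : BaseAlg 𝕜 B M) (c : C) : act p (act q c) = act q (act p c) := by
  rw [← Module.End.mul_apply, ← Module.End.mul_apply, ← map_mul, ← map_mul,
    show p * q = q * p from Subtype.ext (mul_comm _ _)]

/-- `N_x(C)`: the elements `c` with `f c = 0` for some `f` with germ `1` at `x`. -/
noncomputable def stalkKer (x : M) : Submodule 𝕜 C where
  carrier := {c | ∃ f : BaseAlg 𝕜 B M, (∀ᶠ y in 𝓝 x, f.1 y = 1) ∧ act f c = 0}
  add_mem' := by
    rintro c d ⟨f, hf, hc⟩ ⟨g, hg, hd⟩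
    refine ⟨f * g, ?_, ?_⟩
    · filter_upwards [hf, hg] with y h1 h2
      change f.1 y * g.1 y = 1
      rw [h1, h2, one_mul]
    · rw [map_mul, Module.End.mul_apply, map_add, map_add, hd, map_zero, add_zero, act_comm, hc,
        map_zero]
  zero_mem' := by
    obtain ⟨f, hf⟩ := exists_baseAlg_eq_one (𝕜 := 𝕜) (B := B) x
    exact ⟨f, hf, map_zero _⟩
  smul_mem' := by
    rintro r c ⟨f, hf, hc⟩
    exact ⟨f, hf, by rw [map_smul, hc, smul_zero]⟩

/-- The localization `C_x = C / N_x(C)` of the module `C` at `x`. -/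
abbrev Stalk (x : M) := C ⧸ stalkKer act x

/-- The class `c_x` of `c` in `C_x`. -/
noncomputable def toStalk (x : M) : C →ₗ[𝕜] Stalk act x := (stalkKer act x).mkQ

variable {act act'} in
/-- The linear map `α_x : C_x → D_x` induced by a homomorphism `α : C → D` of modules. -/
noncomputable def stalkMap (α : C →ₗ[𝕜] D) (hα : ∀ p c, α (act p c) = act' p (α c)) (x : M) :
    Stalk act x →ₗ[𝕜] Stalk act' x :=
  (stalkKer act x).mapQ (stalkKer act' x) α <| by
    rintro c ⟨f, hf, hc⟩
    exact ⟨f, hf, by rw [← hα, hc, map_zero]⟩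

/-- The action of `R` on `C_x`. -/
noncomputable def stalkAct (x : M) (p : BaseAlg 𝕜 B M) : Module.End 𝕜 (Stalk act x) :=
  stalkMap (act p) (fun q c => act_comm act p q c) x

/-- The projection `C ⊗_R C → C_x ⊗_R C_x`. The latter is `C_x ⊗_{R_x} C_x`, because the action of
`R` on `C_x` factors through the quotient `R_x` of `R`. -/
noncomputable def tensorToStalk (x : M) :
    TensorOver act act →ₗ[𝕜] TensorOver (stalkAct act x) (stalkAct act x) :=
  (tensorRel act act).mapQ (tensorRel (stalkAct act x) (stalkAct act x))
    (TensorProduct.map (toStalk act x) (toStalk act x)) <| by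
      refine Submodule.span_le.2 ?_
      rintro _ ⟨p, c, d, rfl⟩
      exact Submodule.subset_span ⟨p, toStalk act x c, toStalk act x d, by simp; rfl⟩

end Stalk

section Coalgebra

variable {C : Type*} [AddCommGroup C] [Module 𝕜 C] (𝒞 : CoalgebraOps 𝕜 B M C)

/-- `c` is normalized at `x`: the germ of `ε(c)` at `x` is `1`. -/
def NormalizedAt (c : C) (x : M) : Prop := ∀ᶠ y in 𝓝 x, (𝒞.counit c).1 y = 1

/-- The weakly grouplike elements: `Δ(c) = c ⊗ c'` for some `c'`. -/
def weaklyGrouplike : Set C :=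
  {c | ∃ c' : C, 𝒞.comul c = TensorOver.tmul 𝒞.act 𝒞.act c c'}

/-- The set `G(C_x)` of the grouplike elements `ζ` of `C_x`, `Δ_x(ζ) = ζ ⊗ ζ` and `ε_x(ζ) = 1`.
The values of the induced maps `Δ_x` and `ε_x` are computed on a representative of `ζ`. -/
def grouplike (x : M) : Set (Stalk 𝒞.act x) :=
  {ζ | ∃ c : C, toStalk 𝒞.act x c = ζ ∧
    tensorToStalk 𝒞.act x (𝒞.comul c) = TensorOver.tmul _ _ ζ ζ ∧ NormalizedAt 𝒞 c x}

/-- The class `c_x` as a point of the disjoint union of all `C_x`. -/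
noncomputable def classAt (c : C) (x : M) : Σ x : M, Stalk 𝒞.act x := ⟨x, toStalk 𝒞.act x c⟩

/-- The spectral sheaf `E_sp(C)`, with stalks `G(C_x)`. -/
def Esp := {p : Σ x : M, Stalk 𝒞.act x // p.2 ∈ grouplike 𝒞 p.1}

/-- The set `c_W` of all `c_x` with `x ∈ W`. -/
def basicSet (c : C) (W : Set M) : Set (Esp 𝒞) := {p | ∃ x ∈ W, p.1 = classAt 𝒞 c x}

/-- The topology of the spectral sheaf, with basis the sets `c_W` where `W` is open and `c` is
weakly grouplike and normalized on `W`. -/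
instance : TopologicalSpace (Esp 𝒞) :=
  TopologicalSpace.generateFrom {s | ∃ (c : C) (W : Set M), c ∈ weaklyGrouplike 𝒞 ∧ IsOpen W ∧
    (∀ x ∈ W, NormalizedAt 𝒞 c x) ∧ s = basicSet 𝒞 c W}

/-- The projection `π_sp(C) : E_sp(C) → M`. -/
def Esp.proj (p : Esp 𝒞) : M := p.1.1

end Coalgebra

/-- The structure maps of a groupoid over `M`, with set of arrows `X`. The product `g h` of arrows
is defined if the source of `g` is the target of `h`. -/
structure GroupoidOps (M X : Type*) where
  src : X → M
  tgt : X → M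
  unit : M → X
  inv : X → X
  mul : ∀ g h : X, src g = tgt h → X

section Hopf

variable {A : Type*} [AddCommGroup A] [Module 𝕜 A] (𝒜 : HopfAlgebroidOps 𝕜 B M A)

/-- The `S`-invariant weakly grouplike elements: there is `a'` with `Δ(a) = a ⊗ a'` and
`Δ(S(a)) = S(a') ⊗ S(a)`. -/
def invariantWeaklyGrouplike : Set A :=
  {a | ∃ a' : A, 𝒜.comul a = TensorOver.tmul 𝒜.act 𝒜.act a a' ∧
    𝒜.comul (𝒜.antipode a) = TensorOver.tmul 𝒜.act 𝒜.act (𝒜.antipode a') (𝒜.antipode a)}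

/-- The set of arrows of `A`, as a subset of the spectral sheaf `E_sp(A)`. -/
def arrows : Set (Esp 𝒜.toCoalgebraOps) :=
  {p | ∃ a ∈ invariantWeaklyGrouplike 𝒜, NormalizedAt 𝒜.toCoalgebraOps a p.1.1 ∧
    p.1 = classAt 𝒜.toCoalgebraOps a p.1.1}

/-- The spectral étale groupoid `G_sp(A)` with the topology of a subspace of `E_sp(A)`. -/
abbrev Gsp : Type _ := ↥(arrows 𝒜)

/-- The projection `G_sp(A) → M`. -/
def Gsp.proj (ζ : Gsp 𝒜) : M := ζ.1.proj

/-- The map `T_a : R → R`, `T_a(f) = ε(S(f a))`. -/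
noncomputable def opT (a : A) (f : BaseAlg 𝕜 B M) : BaseAlg 𝕜 B M := 𝒜.counit (𝒜.antipode (𝒜.act f a))

/-- `τ` is the diffeomorphism `τ_{W,a} : V → W` between open subsets of `M` determined by
`T_a(C_c^∞(W)) = C_c^∞(V)` and `T_a(f) = f ∘ τ` for `f ∈ C_c^∞(W)`. -/
structure IsTau (a : A) (W : Set M) (τ : OpenPartialHomeomorph M M) : Prop where
  target_eq : τ.target = W
  smooth : ContMDiffOn 𝓘(ℝ, B) 𝓘(ℝ, B) ∞ τ τ.source
  smooth_symm : ContMDiffOn 𝓘(ℝ, B) 𝓘(ℝ, B) ∞ τ.symm τ.target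
  image_eq : opT 𝒜 a '' {f | tsupport f.1 ⊆ W} = {f | tsupport f.1 ⊆ τ.source}
  apply_eq : ∀ f : BaseAlg 𝕜 B M, tsupport f.1 ⊆ W → ∀ x ∈ τ.source, (opT 𝒜 a f).1 x = f.1 (τ x)

/-- `Γ` is the groupoid structure of the spectral étale groupoid `G_sp(A)` of `A`. The formulas
hold for all representatives of the arrows involved. -/
structure IsSpectralGroupoid (Γ : GroupoidOps M (Gsp 𝒜)) : Prop where
  /-- `t(a_y) = y` -/
  tgt_eq : ∀ ζ, Γ.tgt ζ = ζ.proj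
  /-- `s(a_y) = τ_{W,a}⁻¹(y)` for `a` normalized on the open subset `W` and `y ∈ W` -/
  src_eq : ∀ a ∈ invariantWeaklyGrouplike 𝒜, ∀ W : Set M, IsOpen W →
    (∀ y ∈ W, NormalizedAt 𝒜.toCoalgebraOps a y) →
    (∃ τ, IsTau 𝒜 a W τ) ∧ ∀ τ, IsTau 𝒜 a W τ → ∀ (ζ : Gsp 𝒜), ∀ y ∈ W,
      ζ.1.1 = classAt 𝒜.toCoalgebraOps a y → Γ.src ζ = τ.symm y
  /-- `1_y = f_y` for `f` equal to `1` on a neighbourhood of `y` -/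
  unit_eq : ∀ (y : M) (f : BaseAlg 𝕜 B M), (∀ᶠ z in 𝓝 y, f.1 z = 1) →
    (Γ.unit y).1.1 = classAt 𝒜.toCoalgebraOps (𝒜.incl f) y
  /-- `(a_y)⁻¹ = (S(a))_x` where `x` is the source of `a_y` -/
  inv_eq : ∀ (ζ : Gsp 𝒜), ∀ a ∈ invariantWeaklyGrouplike 𝒜, ∀ y : M,
    NormalizedAt 𝒜.toCoalgebraOps a y → ζ.1.1 = classAt 𝒜.toCoalgebraOps a y →
    (Γ.inv ζ).1.1 = classAt 𝒜.toCoalgebraOps (𝒜.antipode a) (Γ.src ζ)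
  /-- `b_z a_y = (b a)_z` if `y` is the source of `b_z` -/
  mul_eq : ∀ (ζ ξ : Gsp 𝒜) (h : Γ.src ζ = Γ.tgt ξ), ∀ b ∈ invariantWeaklyGrouplike 𝒜, ∀ z : M,
    NormalizedAt 𝒜.toCoalgebraOps b z → ζ.1.1 = classAt 𝒜.toCoalgebraOps b z →
    ∀ a ∈ invariantWeaklyGrouplike 𝒜, ∀ y : M,
    NormalizedAt 𝒜.toCoalgebraOps a y → ξ.1.1 = classAt 𝒜.toCoalgebraOps a y →
    (Γ.mul ζ ξ h).1.1 = classAt 𝒜.toCoalgebraOps (𝒜.mul b a) z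

end Hopf

end Spectral

section Groupoids

variable (B : Type*) [NormedAddCommGroup B] [NormedSpace ℝ B]
variable {M : Type*} [TopologicalSpace M] [ChartedSpace B M]
variable {X : Type*} [TopologicalSpace X] [ChartedSpace B X]
variable {Y : Type*} [TopologicalSpace Y] [ChartedSpace B Y]

/-- `X`, a manifold which need not be Hausdorff, is an étale Lie groupoid over `M`: the groupoid
axioms hold and all structure maps are local diffeomorphisms. -/
structure IsEtaleLieGroupoid (Γ : GroupoidOps M X) : Prop where
  isManifold : IsManifold 𝓘(ℝ, B) ∞ X
  src_loc : IsLocalDiffeomorph 𝓘(ℝ, B) 𝓘(ℝ, B) ∞ Γ.src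
  tgt_loc : IsLocalDiffeomorph 𝓘(ℝ, B) 𝓘(ℝ, B) ∞ Γ.tgt
  unit_loc : IsLocalDiffeomorph 𝓘(ℝ, B) 𝓘(ℝ, B) ∞ Γ.unit
  inv_loc : IsLocalDiffeomorph 𝓘(ℝ, B) 𝓘(ℝ, B) ∞ Γ.inv
  mul_loc : IsLocalDiffeomorph 𝓘(ℝ, B) 𝓘(ℝ, B) ∞
    (fun p : FibreProd src_loc tgt_loc => Γ.mul p.fst p.snd p.comm)
  src_unit : ∀ x, Γ.src (Γ.unit x) = x
  tgt_unit : ∀ x, Γ.tgt (Γ.unit x) = x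
  src_inv : ∀ g, Γ.src (Γ.inv g) = Γ.tgt g
  tgt_inv : ∀ g, Γ.tgt (Γ.inv g) = Γ.src g
  src_mul : ∀ g h (e : Γ.src g = Γ.tgt h), Γ.src (Γ.mul g h e) = Γ.src h
  tgt_mul : ∀ g h (e : Γ.src g = Γ.tgt h), Γ.tgt (Γ.mul g h e) = Γ.tgt g
  mul_assoc : ∀ g h k (e : Γ.src g = Γ.tgt h) (e' : Γ.src h = Γ.tgt k),
    Γ.mul (Γ.mul g h e) k ((src_mul g h e).trans e') =
      Γ.mul g (Γ.mul h k e') (e.trans (tgt_mul h k e').symm)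
  unit_mul : ∀ g, Γ.mul (Γ.unit (Γ.tgt g)) g (src_unit _) = g
  mul_unit : ∀ g, Γ.mul g (Γ.unit (Γ.src g)) (tgt_unit _).symm = g
  inv_mul : ∀ g, Γ.mul (Γ.inv g) g (src_inv g) = Γ.unit (Γ.src g)
  mul_inv : ∀ g, Γ.mul g (Γ.inv g) (tgt_inv g).symm = Γ.unit (Γ.tgt g)

/-- Morphisms of étale Lie groupoids over `M`: smooth functors which are the identity on `M`. -/
structure IsGroupoidMorphism (Γ : GroupoidOps M X) (Γ' : GroupoidOps M Y) (φ : X → Y) :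
    Prop where
  smooth : ContMDiff 𝓘(ℝ, B) 𝓘(ℝ, B) ∞ φ
  src_eq : ∀ g, Γ'.src (φ g) = Γ.src g
  tgt_eq : ∀ g, Γ'.tgt (φ g) = Γ.tgt g
  unit_eq : ∀ x, φ (Γ.unit x) = Γ'.unit x
  mul_eq : ∀ g h (e : Γ.src g = Γ.tgt h),
    φ (Γ.mul g h e) = Γ'.mul (φ g) (φ h) ((src_eq g).trans (e.trans (tgt_eq h).symm))

/-- An étale Lie groupoid over `M`. -/
structure EtaleLieGroupoid (B : Type v) [NormedAddCommGroup B] [NormedSpace ℝ B] (M : Type w)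
    [TopologicalSpace M] [ChartedSpace B M] where
  Arr : Type x
  [top : TopologicalSpace Arr]
  [charted : ChartedSpace B Arr]
  ops : GroupoidOps M Arr
  isEtale : IsEtaleLieGroupoid B ops

attribute [instance] EtaleLieGroupoid.top EtaleLieGroupoid.charted

variable {B}

instance (G : EtaleLieGroupoid B M) : IsManifold 𝓘(ℝ, B) ∞ G.Arr := G.isEtale.isManifold

/-- Morphisms of étale Lie groupoids over `M` are local diffeomorphisms. -/
theorem IsGroupoidMorphism.isLocalDiffeomorph {G H : EtaleLieGroupoid B M} {φ : G.Arr → H.Arr}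
    (hφ : IsGroupoidMorphism B G.ops H.ops φ) : IsLocalDiffeomorph 𝓘(ℝ, B) 𝓘(ℝ, B) ∞ φ := by
  refine isLocalDiffeomorph_of_comp H.isEtale.tgt_loc ?_ hφ.smooth.continuous
  have : H.ops.tgt ∘ φ = G.ops.tgt := funext hφ.tgt_eq
  rw [this]
  exact G.isEtale.tgt_loc

variable (𝕜 : Type*) [RCLike 𝕜]
variable [FiniteDimensional ℝ B] [IsManifold 𝓘(ℝ, B) ∞ M] [T2Space M]

/-- The Hopf algebroid `C_c^∞(G)` over `C_c^∞(M)` of an étale Lie groupoid `G`: the coalgebra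
structure is that of the sheaf `t : G → M`, with `Δ = Ω⁻¹ ∘ diag_+` and `ε = t_+`, the product is
the convolution `u v = mlt_+(Ω_{s,t}(u ⊗ v))`, the algebra `C_c^∞(M)` is included by `uni_+` and
the antipode is `inv_+`. -/
noncomputable def hopf (G : EtaleLieGroupoid B M) : HopfAlgebroidOps 𝕜 B M (Cc 𝕜 B G.Arr) where
  act := sheafAct G.isEtale.tgt_loc
  comul u := Function.invFun (omegaBar G.isEtale.tgt_loc G.isEtale.tgt_loc)
    (pushforward (FibreProd.isLocalDiffeomorph_diag G.isEtale.tgt_loc) u)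
  counit u := toBase (pushforward G.isEtale.tgt_loc u)
  incl p := pushforward G.isEtale.unit_loc (ofBase p)
  mul u v := pushforward G.isEtale.mul_loc (omega G.isEtale.src_loc G.isEtale.tgt_loc u v)
  antipode := pushforward G.isEtale.inv_loc

variable {𝕜}

/-- The element `f ∘ t|_U` of `C_c^∞(G)`, extended by zero outside `U`, for a `t`-elementary open
subset `U` of `G` (that is, `t` is injective on `U`) and `f ∈ C_c^∞(t(U))`. -/
noncomputable def liftElt (G : EtaleLieGroupoid B M) {U : Set G.Arr} (hU : IsOpen U)
    (hinj : InjOn G.ops.tgt U) (f : BaseAlg 𝕜 B M) (hf : tsupport f.1 ⊆ G.ops.tgt '' U) :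
    Cc 𝕜 B G.Arr :=
  ⟨extZero U (f.1 ∘ G.ops.tgt), lift_mem G.isEtale.tgt_loc hU hinj f hf⟩

variable (𝕜) in
/-- The map `c_x ↦ (φ_+(c))_x` induced by a morphism `φ : G → H` on the disjoint unions of the
localizations. The maps `E_sp(φ_+)` and `G_sp(φ_+)` are its restrictions. -/
noncomputable def spectralMap {G H : EtaleLieGroupoid B M} {φ : G.Arr → H.Arr}
    (hφ : IsGroupoidMorphism B G.ops H.ops φ) (p : Σ x : M, Stalk (hopf 𝕜 G).act x) :
    Σ x : M, Stalk (hopf 𝕜 H).act x :=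
  ⟨p.1, stalkMap (act := (hopf 𝕜 G).act) (act' := (hopf 𝕜 H).act)
    (pushforward hφ.isLocalDiffeomorph)
    (pushforward_sheafAct G.isEtale.tgt_loc H.isEtale.tgt_loc hφ.isLocalDiffeomorph hφ.tgt_eq)
    p.1 p.2⟩

end Groupoids

end SpectralGroupoid

open SpectralGroupoid

set_option linter.unusedSectionVars false

/-! Everything is computed fibrewise, with germs. Let `f : X → M` be a local diffeomorphism; for a
groupoid, `f = t`. For a section `c` and a point `x` over `y`, let `e_x` be the germ `c_x`
transported to the base point `y`. The localization of `C_c^∞(X)` at `y` remembers exactly the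
family `(e_x)` over the fibre of `y` (`mem_stalkKer_iff`), and `Δ(c) = c ⊗ c'` means that `e_x e'_x
= e_x` and `e_x e'_z = 0` for `x ≠ z` (`comul_eq_tmul_iff`).

If moreover `c` is normalized at `y`, then `∑ e_x = 1`. Multiplying this sum by `e'_x` gives `e'_x =
e_x`, so the `e_x` are orthogonal idempotents with sum one. An idempotent germ of a continuous
function is `0` or `1`, hence exactly one `e_x` is `1` and the others vanish: `c` is the indicator
of one point of the fibre (`exists_isIndicatorAt`). The same argument applies to grouplike elements
of the localization. Since the functions `χ ∘ f|_U` realize every point of `X`, the spectral sheaf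
is `X` itself, also as a topological space (`espHomeomorph`).

To turn equations in `C_c^∞(X) ⊗_R C_c^∞(X)` into equations of germs and back, `Ω` has to be
injective (`omegaBar_injective`) and its range has to contain the image of `diag_+`
(`pushforward_diag_mem_range`). Injectivity is local on `M`: near `y` the tensor product is
generated by the products of local units at points of the fibres, and `Ω` reads off their
coefficients. A compactness argument makes this global.

For a groupoid, unit, antipode and convolution send indicators of arrows to indicators of the unit,
inverse and product arrows, and the diffeomorphism `τ` of an invariant element `a` is `t ∘ s⁻¹` on
the open set of arrows where `a` is an indicator. Functions on small bisections are `S`-invariant,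
so every arrow of `G` defines an element of `G_sp`. The groupoid structure of `G` is then
transported to the spectrum; it satisfies the required formulas, and these leave no freedom. -/

namespace SpectralGroupoid

/-! ### Transport of germs along local homeomorphisms. -/

section Germs

variable {𝕜 : Type*} [RCLike 𝕜]
variable {X : Type*} [TopologicalSpace X] {Y : Type*} [TopologicalSpace Y]
variable {φ : X → Y} (hφ : IsLocalHomeomorph φ) {x : X} {y : Y} (h : φ x = y)

include hφ in
-- A local inverse provides `k`. Germs at different points of a fibre become comparable once each is
-- written as a pull-back from the base.
theorem exists_germ_eq_comp (γ : Germ (𝓝 x) 𝕜) :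
    ∃ k : Y → 𝕜, γ = ((k ∘ φ : X → 𝕜) : Germ (𝓝 x) 𝕜) := by
  induction γ using Germ.inductionOn with | _ a
  refine ⟨a ∘ hφ.localInverseAt x, Germ.coe_eq.2 ?_⟩
  filter_upwards [(hφ.localInverseAt x).open_target.mem_nhds hφ.self_mem_localInverseAt_target]
    with z hz
  have := (hφ.localInverseAt x).right_inv hz
  rw [hφ.localInverseAt_symm] at this
  simp [this]

theorem germ_comp_congr {k l : Y → 𝕜} (hc : ContinuousAt φ x)
    (h : (k : Germ (𝓝 (φ x)) 𝕜) = (l : Germ (𝓝 (φ x)) 𝕜)) :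
    ((k ∘ φ : X → 𝕜) : Germ (𝓝 x) 𝕜) = ((l ∘ φ : X → 𝕜) : Germ (𝓝 x) 𝕜) :=
  congrArg (germPull φ hc) h

theorem germPush_injective :
    Function.Injective (germPush hφ h : Germ (𝓝 x) 𝕜 → Germ (𝓝 y) 𝕜) := by
  intro γ δ e
  subst h
  obtain ⟨k, rfl⟩ := exists_germ_eq_comp hφ γ
  obtain ⟨l, rfl⟩ := exists_germ_eq_comp hφ δ
  rw [germPush_comp, germPush_comp] at e
  exact germ_comp_congr hφ.continuous.continuousAt e

theorem germPush_eq_zero {γ : Germ (𝓝 x) 𝕜} : germPush hφ h γ = 0 ↔ γ = 0 :=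
  ⟨fun e => germPush_injective hφ h (e.trans (germPush_zero hφ h).symm),
    fun e => by rw [e, germPush_zero]⟩

theorem germPush_one : germPush hφ h (1 : Germ (𝓝 x) 𝕜) = 1 := rfl

theorem germPush_value (γ : Germ (𝓝 x) 𝕜) : (germPush hφ h γ).value = γ.value := by
  subst h
  obtain ⟨k, rfl⟩ := exists_germ_eq_comp hφ γ
  rw [germPush_comp]
  rfl

theorem germ_zero_ne_one (x : X) : (0 : Germ (𝓝 x) 𝕜) ≠ 1 := by
  intro h
  exact zero_ne_one (α := 𝕜) (congrArg Germ.value h)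

end Germs

/-! ### Cut-off functions on the base. -/

section Base

variable {𝕜 : Type*} [RCLike 𝕜]
variable {B : Type*} [NormedAddCommGroup B] [NormedSpace ℝ B] [FiniteDimensional ℝ B]
variable {M : Type*} [TopologicalSpace M] [ChartedSpace B M]
  [IsManifold 𝓘(ℝ, B) ∞ M] [T2Space M]

theorem toStalk_eq_iff_sub_mem {C : Type*} [AddCommGroup C] [Module 𝕜 C]
    (act : BaseAlg 𝕜 B M →ₙₐ[𝕜] Module.End 𝕜 C) (x : M) (c d : C) :
    toStalk act x c = toStalk act x d ↔ c - d ∈ stalkKer act x :=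
  Submodule.Quotient.eq _

theorem exists_baseAlg_bump {y : M} {N : Set M} (hN : N ∈ 𝓝 y) :
    ∃ p : BaseAlg 𝕜 B M, (∀ᶠ z in 𝓝 y, p.1 z = 1) ∧ tsupport p.1 ⊆ N := by
  obtain ⟨θ, h1, h2, K, hKN, hK, hθ⟩ := exists_bump (𝕜 := 𝕜) (B := B) (isOpen_univ (X := M))
    inferInstance (mem_univ y) hN
  refine ⟨⟨θ, contMDiffOn_univ.1 h1, HasCompactSupport.intro hK fun z hz => hθ z (mem_univ z) hz⟩,
    h2, ?_⟩
  refine (closure_minimal ?_ hK.isClosed).trans fun z hz => (hKN hz).1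
  intro z hz
  by_contra h
  exact hz (hθ z (mem_univ z) h)

omit [FiniteDimensional ℝ B] [IsManifold 𝓘(ℝ, B) ∞ M] [T2Space M] in
/-- An ideal of `C_c^∞(M)` that contains, at each point of a compact set `K`, a function equal to
one near that point, contains a function equal to one near `K`. -/
theorem exists_mem_eq_one_of_isCompact (I : Submodule 𝕜 (BaseAlg 𝕜 B M))
    (hI : ∀ p ∈ I, ∀ q : BaseAlg 𝕜 B M, q * p ∈ I)
    {K : Set M} (hK : IsCompact K) (hloc : ∀ y ∈ K, ∃ p ∈ I, ∀ᶠ z in 𝓝 y, p.1 z = 1) :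
    ∃ p ∈ I, ∀ y ∈ K, ∀ᶠ z in 𝓝 y, p.1 z = 1 := by
  refine hK.induction_on (p := fun K => ∃ p ∈ I, ∀ y ∈ K, ∀ᶠ z in 𝓝 y, p.1 z = 1)
    ⟨0, I.zero_mem, by simp⟩ (fun s t hst ⟨p, h, h'⟩ => ⟨p, h, fun y hy => h' y (hst hy)⟩) ?_ ?_
  · rintro s t ⟨p, hp, hp'⟩ ⟨q, hq, hq'⟩
    -- This is `1 - (1 - p)(1 - q)`, which equals one wherever `p` or `q` does and lies in the ideal
    -- although `R` may have no unit.
    refine ⟨p + (q - p * q), I.add_mem hp (I.sub_mem hq (hI q hq p)), ?_⟩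
    rintro y (hy | hy)
    · filter_upwards [hp' y hy] with z hz
      change p.1 z + (q.1 z - p.1 z * q.1 z) = 1
      rw [hz]; ring
    · filter_upwards [hq' y hy] with z hz
      change p.1 z + (q.1 z - p.1 z * q.1 z) = 1
      rw [hz]; ring
  · intro y hy
    obtain ⟨p, hp, h⟩ := hloc y hy
    exact ⟨_, mem_nhdsWithin_of_mem_nhds (eventually_eventually_nhds.2 h), p, hp, fun z hz => hz⟩

/-- `M` need not be paracompact, so the cut-off is assembled from finitely many bump functions,
inside the ideal of functions supported in `V`. -/
theorem exists_baseAlg_eq_one_on_subset {K V : Set M} (hK : IsCompact K) (hV : IsOpen V)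
    (hKV : K ⊆ V) :
    ∃ p : BaseAlg 𝕜 B M, (∀ y ∈ K, ∀ᶠ z in 𝓝 y, p.1 z = 1) ∧ tsupport p.1 ⊆ V := by
  let I : Submodule 𝕜 (BaseAlg 𝕜 B M) :=
    { carrier := {p | tsupport p.1 ⊆ V}
      add_mem' := fun {p q} hp hq => (tsupport_add p.1 q.1).trans (union_subset hp hq)
      zero_mem' := by
        change tsupport (0 : M → 𝕜) ⊆ V
        simp [tsupport]
      smul_mem' := fun c p hp =>
        (tsupport_smul_subset_right (fun _ => c) p.1).trans hp }
  obtain ⟨p, hp, h⟩ := exists_mem_eq_one_of_isCompact I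
    (fun p hp q => (tsupport_mul_subset_right (f := q.1) (g := p.1)).trans hp) hK fun y hy =>
      (exists_baseAlg_bump (𝕜 := 𝕜) (B := B) (hV.mem_nhds (hKV hy))).imp fun _ h => ⟨h.2, h.1⟩
  exact ⟨p, h, hp⟩

end Base

/-! ### Sections over a sheaf: local generators and localization at a point. -/

section Sheaf

variable {𝕜 : Type*} [RCLike 𝕜]
variable {B : Type*} [NormedAddCommGroup B] [NormedSpace ℝ B] [FiniteDimensional ℝ B]
variable {X M : Type*} [TopologicalSpace X] [TopologicalSpace M]
  [ChartedSpace B X] [ChartedSpace B M] [IsManifold 𝓘(ℝ, B) ∞ X]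
  [IsManifold 𝓘(ℝ, B) ∞ M] [T2Space M]
variable {f : X → M} (hf : IsLocalDiffeomorph 𝓘(ℝ, B) 𝓘(ℝ, B) ∞ f)

omit [FiniteDimensional ℝ B] [IsManifold 𝓘(ℝ, B) ∞ X] [IsManifold 𝓘(ℝ, B) ∞ M] [T2Space M] in
theorem germ_comp_eq_one {p : M → 𝕜} {x : X} (hc : Continuous f)
    (h : ∀ᶠ z in 𝓝 (f x), p z = 1) : ((p ∘ f : X → 𝕜) : Germ (𝓝 x) 𝕜) = 1 :=
  Germ.coe_eq.2 (hc.continuousAt.eventually h)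

omit [FiniteDimensional ℝ B] [IsManifold 𝓘(ℝ, B) ∞ X] [IsManifold 𝓘(ℝ, B) ∞ M] [T2Space M] in
theorem germ_comp_eq_zero {p : M → 𝕜} {x : X} (hc : Continuous f)
    (h : ∀ᶠ z in 𝓝 (f x), p z = 0) : ((p ∘ f : X → 𝕜) : Germ (𝓝 x) 𝕜) = 0 :=
  Germ.coe_eq.2 (hc.continuousAt.eventually h)

theorem extZero_of_mem {U : Set X} (a : X → 𝕜) {x : X} (hx : x ∈ U) :
    extZero U a x = (a : Germ (𝓝 x) 𝕜) := by simp [extZero, hx]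

theorem extZero_of_notMem {U : Set X} (a : X → 𝕜) {x : X} (hx : x ∉ U) :
    extZero U a x = 0 := by simp [extZero, hx]

include hf in
/-- A function with compact support on an open set `V` on which `f` is injective is the pull-back
of a function on `M`. -/
theorem exists_baseAlg_comp_eqOn {V : Set X} {a : X → 𝕜} (hV : IsOpen V) (hT : T2Space V)
    (hinj : InjOn f V) (ha : IsCcOn 𝕜 B V a) :
    ∃ p : BaseAlg 𝕜 B M, EqOn (p.1 ∘ f) a V := by
  obtain hE | ⟨⟨x0⟩⟩ := isEmpty_or_nonempty X
  · exact ⟨0, fun x => (hE.false x).elim⟩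
  have : Nonempty X := ⟨x0⟩
  have hσ : ∀ y ∈ V, Function.invFunOn f V (f y) = y := fun y hy => hinj.leftInvOn_invFunOn hy
  let u : Cc 𝕜 B X := ⟨_, extZero_mem hV hT ha⟩
  -- The push-forward sums over a fibre; as `f` is injective on `V`, only the term at `x`
  -- contributes over `f x`.
  refine ⟨toBase (pushforward hf u), fun x hx => ?_⟩
  change (pushSection hf.isLocalHomeomorph (extZero V a) (f x)).value = a x
  rw [pushSection_extZero hf.isLocalHomeomorph hV hinj a _ hσ, extZero_of_mem _ (mem_image_of_mem f hx)]
  change a (Function.invFunOn f V (f x)) = a x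
  rw [hσ x hx]

include hf in
-- An element of `C_c^∞(X)` is a priori only a family of germs. This ensures that each germ comes
-- from a smooth, in particular continuous, function; idempotent germs are trivial for that reason.
theorem exists_baseAlg_germ (u : Cc 𝕜 B X) (x : X) :
    ∃ p : BaseAlg 𝕜 B M, u.1 x = ((p.1 ∘ f : X → 𝕜) : Germ (𝓝 x) 𝕜) := by
  let S : Submodule 𝕜 (∀ y : X, Germ (𝓝 y) 𝕜) :=
    { carrier := {u | ∃ p : BaseAlg 𝕜 B M, u x = ((p.1 ∘ f : X → 𝕜) : Germ (𝓝 x) 𝕜)}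
      add_mem' := by
        rintro a b ⟨p, hp⟩ ⟨q, hq⟩
        exact ⟨p + q, by rw [Pi.add_apply, hp, hq]; rfl⟩
      zero_mem' := ⟨0, rfl⟩
      smul_mem' := by
        rintro c a ⟨p, hp⟩
        exact ⟨c • p, by rw [Pi.smul_apply, hp]; rfl⟩ }
  refine Cc_le (B := B) (fun V => InjOn f V) (exists_injOn hf.isLocalHomeomorph) S ?_ u.2
  intro V a hV hT hinj ha
  by_cases hx : x ∈ V
  · obtain ⟨p, hp⟩ := exists_baseAlg_comp_eqOn hf hV hT hinj ha
    refine ⟨p, ?_⟩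
    rw [extZero_of_mem _ hx]
    exact Germ.coe_eq.2 (hp.symm.eventuallyEq_of_mem (hV.mem_nhds hx))
  · exact ⟨0, by rw [extZero_of_notMem _ hx]; rfl⟩

/-- `u` is the germ of the constant function `1` at `x` and vanishes at all other points of the
fibre of `f` through `x`. -/
def IsIndicatorAt (f : X → M) (u : ∀ x : X, Germ (𝓝 x) 𝕜) (x : X) : Prop :=
  u x = 1 ∧ ∀ x', f x' = f x → x' ≠ x → u x' = 0

theorem isIndicatorAt_extZero {U : Set X} (hinj : InjOn f U)
    {χ : M → 𝕜} (hc : Continuous f) {x : X} (hx : x ∈ U) (hχ : ∀ᶠ z in 𝓝 (f x), χ z = 1) :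
    IsIndicatorAt f (extZero U (χ ∘ f)) x := by
  refine ⟨?_, fun x' hx' hne => extZero_of_notMem _ fun h => hne (hinj h hx hx')⟩
  rw [extZero_of_mem _ hx]
  exact Germ.coe_eq.2 (hc.continuousAt.eventually hχ)

/-- The sections which vanish over a neighbourhood of `y`. -/
def vanishNear (𝕜 : Type*) [RCLike 𝕜] (f : X → M) (y : M) :
    Submodule 𝕜 (∀ x : X, Germ (𝓝 x) 𝕜) where
  carrier := {u | ∀ᶠ z in 𝓝 y, ∀ x, f x = z → u x = 0}
  add_mem' := by
    intro a b ha hb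
    filter_upwards [ha, hb] with z h1 h2 x hx
    rw [Pi.add_apply, h1 x hx, h2 x hx, add_zero]
  zero_mem' := Eventually.of_forall fun _ _ _ => rfl
  smul_mem' := by
    intro c a ha
    filter_upwards [ha] with z h1 x hx
    rw [Pi.smul_apply, h1 x hx, smul_zero]

/-- A choice, for each `x`, of an element of `C_c^∞(X)` of the form `χ ∘ f|_U`. -/
structure LocalUnits (𝕜 : Type*) [RCLike 𝕜]
    (hf : IsLocalDiffeomorph 𝓘(ℝ, B) 𝓘(ℝ, B) ∞ f) where
  nhd : X → Set X
  isOpen_nhd : ∀ x, IsOpen (nhd x)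
  mem_nhd : ∀ x, x ∈ nhd x
  injOn : ∀ x, InjOn f (nhd x)
  fn : X → BaseAlg 𝕜 B M
  fn_eq_one : ∀ x, ∀ᶠ z in 𝓝 (f x), (fn x).1 z = 1
  tsupport_fn : ∀ x, tsupport (fn x).1 ⊆ f '' nhd x

include hf in
theorem nonempty_localUnits : Nonempty (LocalUnits 𝕜 hf) := by
  choose V hV hxV hinj using exists_injOn hf.isLocalHomeomorph
  choose p hp hp' using fun x => exists_baseAlg_bump (𝕜 := 𝕜) (B := B)
    ((hf.isLocalHomeomorph.isOpenMap _ (hV x)).mem_nhds (mem_image_of_mem f (hxV x)))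
  exact ⟨⟨V, hV, hxV, fun x => hinj x _ subset_rfl, p, hp, hp'⟩⟩

namespace LocalUnits

variable {hf} (E : LocalUnits 𝕜 hf)

/-- The element `χ ∘ f|_U`, extended by zero. -/
noncomputable def elt (x : X) : Cc 𝕜 B X :=
  ⟨extZero (E.nhd x) ((E.fn x).1 ∘ f),
    lift_mem hf (E.isOpen_nhd x) (E.injOn x) (E.fn x) (E.tsupport_fn x)⟩

theorem isIndicatorAt_elt (x : X) : IsIndicatorAt f (E.elt x).1 x :=
  isIndicatorAt_extZero (E.injOn x) hf.isLocalHomeomorph.continuous (E.mem_nhd x)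
    (E.fn_eq_one x)

/-- The combinations of the elements `elt x` for `x` in the fibre over `y`. -/
noncomputable def comb (y : M) : ({x : X // f x = y} →₀ BaseAlg 𝕜 B M) →ₗ[𝕜] Cc 𝕜 B X :=
  Finsupp.lsum ℕ fun x =>
    { toFun := fun p => sheafAct hf p (E.elt x.1)
      map_add' := fun p q => by rw [map_add, LinearMap.add_apply]
      map_smul' := fun c p => by rw [map_smul, LinearMap.smul_apply, RingHom.id_apply] }

theorem comb_single (y : M) (x : {x : X // f x = y}) (p : BaseAlg 𝕜 B M) :
    E.comb y (Finsupp.single x p) = sheafAct hf p (E.elt x.1) := by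
  simp [comb]

/-- The elements `E.elt x`, for `x` over `y`, behave like a basis with evaluations as dual basis:
evaluation at `x` kills every other generator and returns the coefficient of `x`. -/
theorem comb_apply (y : M) (q : {x : X // f x = y} →₀ BaseAlg 𝕜 B M) (x : {x : X // f x = y}) :
    (E.comb y q).1 x.1 = (((q x).1 ∘ f : X → 𝕜) : Germ (𝓝 x.1) 𝕜) := by
  induction q using Finsupp.induction_linear with
  | zero => rw [map_zero]; rfl
  | add a b ha hb =>
    rw [map_add, Submodule.coe_add, Pi.add_apply, ha, hb, Finsupp.add_apply]; rfl
  | single x' p =>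
    rw [comb_single]
    change ((p.1 ∘ f : X → 𝕜) : Germ (𝓝 x.1) 𝕜) * (E.elt x'.1).1 x.1 = _
    by_cases h : x' = x
    · subst h
      rw [(E.isIndicatorAt_elt x'.1).1, mul_one, Finsupp.single_eq_same]
    · have hne : x.1 ≠ x'.1 := fun e => h (Subtype.ext e.symm)
      rw [(E.isIndicatorAt_elt x'.1).2 x.1 (x.2.trans x'.2.symm) hne, mul_zero,
        Finsupp.single_eq_of_ne (Ne.symm h)]
      rfl

/-- The local units at the points of the fibre generate the localization at `y`. By `Cc_le` it is
enough to treat a function on a set `V` where `f` is injective; such a `V` meets the fibre in at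
most one point `g`, and a multiple of `E.elt g` suffices. -/
theorem exists_sub_comb_mem (y : M) (u : Cc 𝕜 B X) :
    ∃ q, u.1 - (E.comb y q).1 ∈ vanishNear 𝕜 f y := by
  let S : Submodule 𝕜 (∀ x : X, Germ (𝓝 x) 𝕜) :=
    (LinearMap.range ((Cc 𝕜 B X).subtype.comp (E.comb y))) ⊔ vanishNear 𝕜 f y
  have hS : u.1 ∈ S := by
    refine Cc_le (B := B) (fun V => InjOn f V) (exists_injOn hf.isLocalHomeomorph) S ?_ u.2
    intro V a hV hT hinj ha
    by_cases hy : y ∈ f '' V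
    · obtain ⟨g, hg, rfl⟩ := hy
      obtain ⟨p, hp⟩ := exists_baseAlg_comp_eqOn hf hV hT hinj ha
      have hc := E.comb_single (f g) ⟨g, rfl⟩ p
      rw [← add_sub_cancel (E.comb (f g) (Finsupp.single ⟨g, rfl⟩ p)).1 (extZero V a)]
      refine Submodule.add_mem_sup ⟨_, rfl⟩ ?_
      rw [hc]
      -- Over this neighbourhood `V` and `E.nhd g` have the same unique point in each fibre, so at
      -- every other point both sections vanish.
      have hopen : f '' (V ∩ E.nhd g) ∈ 𝓝 (f g) :=
        (hf.isLocalHomeomorph.isOpenMap _ (hV.inter (E.isOpen_nhd g))).mem_nhds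
          ⟨g, ⟨hg, E.mem_nhd g⟩, rfl⟩
      change ∀ᶠ z in 𝓝 (f g), _
      filter_upwards [hopen, eventually_eventually_nhds.2 (E.fn_eq_one g)] with z hz hz1 x hx
      obtain ⟨x', ⟨hx'V, hx'E⟩, hx'⟩ := hz
      have hfx : f x' = f x := hx'.trans hx.symm
      change extZero V a x - ((p.1 ∘ f : X → 𝕜) : Germ (𝓝 x) 𝕜) *
        extZero (E.nhd g) ((E.fn g).1 ∘ f) x = 0
      by_cases hxx : x' = x
      · subst hxx
        rw [extZero_of_mem _ hx'V, extZero_of_mem _ hx'E]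
        have h1 : (((E.fn g).1 ∘ f : X → 𝕜) : Germ (𝓝 x') 𝕜) = 1 :=
          germ_comp_eq_one hf.isLocalHomeomorph.continuous (hx ▸ hz1)
        rw [h1, mul_one, sub_eq_zero]
        exact Germ.coe_eq.2 (hp.symm.eventuallyEq_of_mem (hV.mem_nhds hx'V))
      · rw [extZero_of_notMem _ fun h => hxx (hinj hx'V h hfx),
          extZero_of_notMem _ fun h => hxx (E.injOn g hx'E h hfx), mul_zero, sub_zero]
    · refine Submodule.mem_sup_right ?_
      obtain ⟨-, K, hKV, hK, haK⟩ := ha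
      have hc := hf.isLocalHomeomorph.continuous
      -- `K` itself need not be closed in `X`; its image is closed because `M` is Hausdorff.
      have hK' : IsClosed (f '' K) := (hK.image hc).isClosed
      have hy' : y ∈ (f '' K)ᶜ := fun h => hy (image_mono hKV h)
      change ∀ᶠ z in 𝓝 y, _
      filter_upwards [hK'.isOpen_compl.mem_nhds hy'] with z hz x hx
      by_cases hxV : x ∈ V
      · rw [extZero_of_mem _ hxV]
        refine Germ.coe_eq.2 ?_
        filter_upwards [hV.mem_nhds hxV,
          (hK'.isOpen_compl.preimage hc).mem_nhds (show f x ∈ _ from hx ▸ hz)] with w h1 h2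
        exact haK w h1 fun h => h2 ⟨w, h, rfl⟩
      · exact extZero_of_notMem _ hxV
  obtain ⟨_, ⟨q, rfl⟩, v, hv, h⟩ := Submodule.mem_sup.1 hS
  refine ⟨q, ?_⟩
  rw [← h]
  simpa using hv

end LocalUnits

include hf in
/-- An element of `C_c^∞(X)` which vanishes on the fibre over `y` vanishes over a neighbourhood of
`y`. -/
theorem eventually_eq_zero_of_fibre (u : Cc 𝕜 B X) {y : M} (h : ∀ x, f x = y → u.1 x = 0) :
    ∀ᶠ z in 𝓝 y, ∀ x, f x = z → u.1 x = 0 := by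
  obtain ⟨E⟩ := nonempty_localUnits (𝕜 := 𝕜) hf
  obtain ⟨q, hq⟩ := E.exists_sub_comb_mem y u
  have hq' : ∀ᶠ z in 𝓝 y, ∀ x, f x = z → u.1 x - (E.comb y q).1 x = 0 := hq
  -- The coefficients of the approximating combination are read off on the fibre over `y`, where `u`
  -- vanishes.
  have h0 : ∀ x, ((q x).1 : Germ (𝓝 y) 𝕜) = 0 := by
    intro x
    have h1 := hq'.self_of_nhds x.1 x.2
    rw [h x.1 x.2, E.comb_apply, zero_sub, neg_eq_zero] at h1
    have h2 := germPush_comp hf.isLocalHomeomorph x.2 (q x).1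
    rw [← h2, h1, germPush_zero]
  -- Fibres may be infinite, but only finitely many coefficients are nonzero, so a common
  -- neighbourhood exists.
  have h3 : ∀ᶠ z in 𝓝 y, ∀ x ∈ q.support, ∀ᶠ z' in 𝓝 z, (q x).1 z' = 0 := by
    rw [Finset.eventually_all]
    exact fun x _ => eventually_eventually_nhds.2 (Germ.coe_eq.1 (h0 x))
  filter_upwards [hq', h3] with z h1 h2 x hx
  rw [sub_eq_zero.1 (h1 x hx)]
  have hsum : E.comb y q = ∑ i ∈ q.support, sheafAct hf (q i) (E.elt i.1) := by
    simp [LocalUnits.comb, Finsupp.sum]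
  rw [hsum, AddSubmonoidClass.coe_finsetSum, Finset.sum_apply]
  refine Finset.sum_eq_zero fun i hi => ?_
  change (((q i).1 ∘ f : X → 𝕜) : Germ (𝓝 x) 𝕜) * (E.elt i.1).1 x = 0
  have : (((q i).1 ∘ f : X → 𝕜) : Germ (𝓝 x) 𝕜) = 0 :=
    germ_comp_eq_zero hf.isLocalHomeomorph.continuous (hx ▸ h2 i hi)
  rw [this, zero_mul]

omit [IsManifold 𝓘(ℝ, B) ∞ X] in
theorem sheafAct_apply (p : BaseAlg 𝕜 B M) (u : Cc 𝕜 B X) (x : X) :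
    (sheafAct hf p u).1 x = ((p.1 ∘ f : X → 𝕜) : Germ (𝓝 x) 𝕜) * u.1 x := rfl

/-- The algebraic localization is thereby a family of germs along a fibre. The substantial direction
uses `eventually_eq_zero_of_fibre`: vanishing spreads to a neighbourhood of `y`, and a bump function
supported there annihilates `u`. -/
theorem mem_stalkKer_iff (u : Cc 𝕜 B X) (y : M) :
    u ∈ stalkKer (sheafAct hf) y ↔ ∀ x, f x = y → u.1 x = 0 := by
  have hc := hf.isLocalHomeomorph.continuous
  constructor
  · rintro ⟨p, hp, hu⟩ x rfl
    have h := congrFun (congrArg Subtype.val hu) x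
    rw [sheafAct_apply, germ_comp_eq_one hc hp, one_mul] at h
    exact h
  · intro h
    obtain ⟨p, hp, hp'⟩ := exists_baseAlg_bump (𝕜 := 𝕜) (B := B)
      (eventually_eq_zero_of_fibre hf u h)
    refine ⟨p, hp, Subtype.ext (funext fun x => ?_)⟩
    change ((p.1 ∘ f : X → 𝕜) : Germ (𝓝 x) 𝕜) * u.1 x = (0 : Germ (𝓝 x) 𝕜)
    by_cases hx : f x ∈ tsupport p.1
    · rw [hp' hx x rfl]; rw [mul_zero]
    · rw [germ_comp_eq_zero hc (notMem_tsupport_iff_eventuallyEq.1 hx), zero_mul]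

include hf in
/-- An idempotent germ of a continuous function is zero or one. -/
theorem germ_eq_zero_or_one (u : Cc 𝕜 B X) (x : X) (h : u.1 x * u.1 x = u.1 x) :
    u.1 x = 0 ∨ u.1 x = 1 := by
  obtain ⟨p, hp⟩ := exists_baseAlg_germ hf u x
  rw [hp] at h ⊢
  have hc : ContinuousAt (p.1 ∘ f) x :=
    (p.2.1.continuous.comp hf.isLocalHomeomorph.continuous).continuousAt
  have h' : ∀ᶠ z in 𝓝 x, (p.1 ∘ f) z * (p.1 ∘ f) z = (p.1 ∘ f) z := Germ.coe_eq.1 h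
  have h01 : ∀ᶠ z in 𝓝 x, (p.1 ∘ f) z = 0 ∨ (p.1 ∘ f) z = 1 := by
    filter_upwards [h'] with z hz
    rcases eq_or_ne ((p.1 ∘ f) z) 0 with h | h
    · exact Or.inl h
    · exact Or.inr (mul_left_cancel₀ h (hz.trans (mul_one _).symm))
  rcases h01.self_of_nhds with h0 | h0
  · left
    refine Germ.coe_eq.2 ?_
    filter_upwards [h01, hc.eventually_ne (show (p.1 ∘ f) x ≠ 1 by rw [h0]; exact zero_ne_one)]
      with z h1 h2
    exact h1.resolve_right h2
  · right
    refine Germ.coe_eq.2 ?_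
    filter_upwards [h01, hc.eventually_ne (show (p.1 ∘ f) x ≠ 0 by rw [h0]; exact one_ne_zero)]
      with z h1 h2
    exact h1.resolve_left h2

end Sheaf

/-! ### The image of the diagonal under push-forward, in terms of germs. -/

section SheafCoalgebra

variable {𝕜 : Type*} [RCLike 𝕜]
variable {B : Type*} [NormedAddCommGroup B] [NormedSpace ℝ B] [FiniteDimensional ℝ B]
variable {X Y M : Type*} [TopologicalSpace X] [TopologicalSpace Y] [TopologicalSpace M]
  [ChartedSpace B X] [ChartedSpace B Y] [ChartedSpace B M] [IsManifold 𝓘(ℝ, B) ∞ X]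
  [IsManifold 𝓘(ℝ, B) ∞ Y] [IsManifold 𝓘(ℝ, B) ∞ M] [T2Space M]
variable {f : X → M} (hf : IsLocalDiffeomorph 𝓘(ℝ, B) 𝓘(ℝ, B) ∞ f)
variable {g : Y → M} (hg : IsLocalDiffeomorph 𝓘(ℝ, B) 𝓘(ℝ, B) ∞ g)

theorem toStalk_eq_iff (u v : Cc 𝕜 B X) (y : M) :
    toStalk (C := Cc 𝕜 B X) (sheafAct hf) y u = toStalk (C := Cc 𝕜 B X) (sheafAct hf) y v ↔
      ∀ x, f x = y → u.1 x = v.1 x := by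
  rw [toStalk_eq_iff_sub_mem, mem_stalkKer_iff]
  refine forall₂_congr fun x _ => ?_
  rw [Submodule.coe_sub, Pi.sub_apply, sub_eq_zero]

theorem omegaBar_tmul (u : Cc 𝕜 B X) (v : Cc 𝕜 B Y) :
    omegaBar hf hg (TensorOver.tmul (C := Cc 𝕜 B X) (D := Cc 𝕜 B Y) (sheafAct (𝕜 := 𝕜) hf)
      (sheafAct (𝕜 := 𝕜) hg) u v) = omega hf hg u v := rfl

omit [FiniteDimensional ℝ B] [IsManifold 𝓘(ℝ, B) ∞ X] [IsManifold 𝓘(ℝ, B) ∞ M] [T2Space M]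
  [IsManifold 𝓘(ℝ, B) ∞ Y] in
theorem omegaSection_apply_comp {u : ∀ x : X, Germ (𝓝 x) 𝕜} {v : ∀ y : Y, Germ (𝓝 y) 𝕜}
    (q : FibreProd hf hg) {k l : M → 𝕜} (hk : u q.fst = ((k ∘ f : X → 𝕜) : Germ (𝓝 q.fst) 𝕜))
    (hl : v q.snd = ((l ∘ g : Y → 𝕜) : Germ (𝓝 q.snd) 𝕜)) :
    omegaSection hf hg u v q =
      (((k * l) ∘ (f ∘ FibreProd.fst) : FibreProd hf hg → 𝕜) : Germ (𝓝 q) 𝕜) := by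
  have h1 : (k ∘ f) ∘ (FibreProd.fst : FibreProd hf hg → X) = k ∘ (f ∘ FibreProd.fst) := rfl
  have h2 : (l ∘ g) ∘ (FibreProd.snd : FibreProd hf hg → Y) = l ∘ (f ∘ FibreProd.fst) :=
    funext fun q => congrArg l q.comm.symm
  have e1 : germPull FibreProd.fst FibreProd.continuous_fst.continuousAt (u q.fst) =
      ((k ∘ (f ∘ FibreProd.fst) : FibreProd hf hg → 𝕜) : Germ (𝓝 q) 𝕜) := by
    rw [hk, ← h1]; rfl
  have e2 : germPull FibreProd.snd FibreProd.continuous_snd.continuousAt (v q.snd) =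
      ((l ∘ (f ∘ FibreProd.fst) : FibreProd hf hg → 𝕜) : Germ (𝓝 q) 𝕜) := by
    rw [hl, ← h2]; rfl
  rw [omegaSection, e1, e2]
  rfl

theorem isLocalHomeomorph_comp_fst :
    IsLocalHomeomorph (f ∘ FibreProd.fst : FibreProd hf hg → M) :=
  hf.isLocalHomeomorph.comp FibreProd.isLocalHomeomorph_fst

/-- The section `Ω(u ⊗ v)` in terms of germs on the base. -/
theorem germPush_omegaSection {u : ∀ x : X, Germ (𝓝 x) 𝕜} {v : ∀ y : Y, Germ (𝓝 y) 𝕜}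
    (q : FibreProd hf hg) {y : M} (h1 : f q.fst = y) (h2 : g q.snd = y) :
    germPush (isLocalHomeomorph_comp_fst hf hg) h1 (omegaSection hf hg u v q) =
      germPush hf.isLocalHomeomorph h1 (u q.fst) * germPush hg.isLocalHomeomorph h2 (v q.snd) := by
  obtain ⟨k, hk⟩ := exists_germ_eq_comp hf.isLocalHomeomorph (u q.fst)
  obtain ⟨l, hl⟩ := exists_germ_eq_comp hg.isLocalHomeomorph (v q.snd)
  rw [omegaSection_apply_comp hf hg q hk hl, hk, hl, germPush_comp, germPush_comp, germPush_comp]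
  rfl

theorem germPush_pushforward_diag (w : Cc 𝕜 B X) (x : X) {y : M} (h : f x = y) :
    germPush (isLocalHomeomorph_comp_fst hf hf) (y := FibreProd.diag hf x) h
      ((pushforward (FibreProd.isLocalDiffeomorph_diag hf) w).1 (FibreProd.diag hf x)) =
      germPush hf.isLocalHomeomorph h (w.1 x) := by
  have h1 : (pushforward (FibreProd.isLocalDiffeomorph_diag hf) w).1 (FibreProd.diag hf x) =
      germPush (FibreProd.isLocalDiffeomorph_diag hf).isLocalHomeomorph rfl (w.1 x) := by
    refine finsum_eq_single _ (⟨x, rfl⟩ : {x' // FibreProd.diag hf x' = FibreProd.diag hf x}) ?_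
    rintro ⟨x', hx'⟩ hne
    exact (hne (Subtype.ext (congrArg FibreProd.fst hx'))).elim
  obtain ⟨k, hk⟩ := exists_germ_eq_comp hf.isLocalHomeomorph (w.1 x)
  rw [h1, hk, germPush_comp]
  have h2 : k ∘ f = (k ∘ (f ∘ FibreProd.fst)) ∘ FibreProd.diag hf := rfl
  rw [h2, germPush_comp]
  exact germPush_comp (isLocalHomeomorph_comp_fst hf hf) (y := FibreProd.diag hf x) h k

theorem pushforward_diag_of_ne (w : Cc 𝕜 B X) (q : FibreProd hf hf) (h : q.fst ≠ q.snd) :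
    (pushforward (FibreProd.isLocalDiffeomorph_diag hf) w).1 q = 0 := by
  have : IsEmpty {x // FibreProd.diag hf x = q} :=
    ⟨fun x => h ((congrArg FibreProd.fst x.2).symm.trans (congrArg FibreProd.snd x.2))⟩
  exact finsum_of_isEmpty _

/-- `diag_+(w) = Ω(u ⊗ v)`, in terms of germs on the base. -/
def DiagRel (w u v : Cc 𝕜 B X) : Prop :=
  (∀ x, w.1 x = u.1 x * v.1 x) ∧ ∀ (y : M) (x x' : X) (h : f x = y) (h' : f x' = y), x ≠ x' →
    germPush hf.isLocalHomeomorph h (u.1 x) * germPush hf.isLocalHomeomorph h' (v.1 x') = 0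

/-- `X ×_M X → M` is a local homeomorphism, so both sections may be compared after transport to the
base. Diagonal points give the product formula, and off the diagonal the push-forward vanishes,
which gives orthogonality. -/
theorem omega_eq_pushforward_diag_iff (w u v : Cc 𝕜 B X) :
    omega hf hf u v = pushforward (FibreProd.isLocalDiffeomorph_diag hf) w ↔
      DiagRel hf w u v := by
  constructor
  · intro e
    have e' : ∀ q, omegaSection hf hf u.1 v.1 q =
        (pushforward (FibreProd.isLocalDiffeomorph_diag hf) w).1 q :=
      fun q => congrFun (congrArg Subtype.val e) q
    constructor
    · intro x
      refine germPush_injective hf.isLocalHomeomorph (rfl : f x = f x) ?_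
      rw [← germPush_pushforward_diag, ← e', germPush_mul]
      exact germPush_omegaSection hf hf (FibreProd.diag hf x) rfl rfl
    · intro y x x' h h' hne
      have := germPush_omegaSection hf hf (u := u.1) (v := v.1) ⟨x, x', h.trans h'.symm⟩ h h'
      rw [← this, e', pushforward_diag_of_ne _ _ _ hne, germPush_zero]
  · rintro ⟨h1, h2⟩
    refine Subtype.ext (funext fun q => ?_)
    change omegaSection hf hf u.1 v.1 q = _
    refine germPush_injective (isLocalHomeomorph_comp_fst hf hf) (rfl : f q.fst = f q.fst) ?_
    rw [germPush_omegaSection hf hf q rfl q.comm.symm]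
    by_cases hq : q.fst = q.snd
    · obtain ⟨x, x', c⟩ := q
      obtain rfl : x = x' := hq
      have := germPush_pushforward_diag hf w x rfl
      rw [h1, germPush_mul] at this
      exact this.symm
    · rw [pushforward_diag_of_ne _ _ _ hq, germPush_zero]
      exact h2 _ _ _ _ _ hq

/-- The comultiplication is defined with `Function.invFun`, which is meaningful only on the range of
`Ω`. By linearity it is enough to take `a` supported in a set on which `f` is injective, where
`diag_+(a) = Ω(a ⊗ χ ∘ f)` for a cut-off `χ` equal to one on the image of the support. -/
theorem pushforward_diag_mem_range (w : Cc 𝕜 B X) :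
    ∃ z, omegaBar hf hf z = pushforward (FibreProd.isLocalDiffeomorph_diag hf) w := by
  let S' : Submodule 𝕜 (Cc 𝕜 B X) := (LinearMap.range (omegaBar (𝕜 := 𝕜) hf hf)).comap
    (pushforward (FibreProd.isLocalDiffeomorph_diag hf))
  -- `Cc_le` concerns submodules of the space of all sections, so `S'` is pushed there.
  have key : Cc 𝕜 B X ≤ S'.map (Cc 𝕜 B X).subtype := by
    refine Cc_le (B := B) (fun V => InjOn f V) (exists_injOn hf.isLocalHomeomorph) _ ?_
    intro V a hV hT hinj ha
    refine ⟨⟨_, extZero_mem hV hT ha⟩, ?_, rfl⟩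
    obtain ⟨K, hKV, hK, haK⟩ := ha.2
    obtain ⟨χ, hχ, hχ'⟩ := exists_baseAlg_eq_one_on_subset (𝕜 := 𝕜) (B := B)
      (hK.image hf.isLocalHomeomorph.continuous) (hf.isLocalHomeomorph.isOpenMap _ hV)
      (image_mono hKV)
    refine ⟨TensorOver.tmul (C := Cc 𝕜 B X) (D := Cc 𝕜 B X) (sheafAct (𝕜 := 𝕜) hf)
      (sheafAct (𝕜 := 𝕜) hf) ⟨_, extZero_mem hV hT ha⟩ ⟨_, lift_mem hf hV hinj χ hχ'⟩, ?_⟩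
    rw [omegaBar_tmul, omega_eq_pushforward_diag_iff]
    constructor
    · intro x
      change extZero V a x = extZero V a x * extZero V (χ.1 ∘ f) x
      by_cases hx : x ∈ V
      · rw [extZero_of_mem _ hx, extZero_of_mem _ hx]
        refine Germ.coe_eq.2 ?_
        filter_upwards [hV.mem_nhds hx] with z hz
        by_cases hzK : z ∈ K
        · have := (hχ _ (mem_image_of_mem f hzK)).self_of_nhds
          simp [this]
        · simp [haK z hz hzK]
      · rw [extZero_of_notMem _ hx, zero_mul]
    · intro y x x' h h' hne
      change germPush _ _ (extZero V a x) * germPush _ _ (extZero V (χ.1 ∘ f) x') = 0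
      by_cases hx : x ∈ V
      · rw [extZero_of_notMem _ fun hx' => hne (hinj hx hx' (h.trans h'.symm)), germPush_zero,
          mul_zero]
      · rw [extZero_of_notMem _ hx, germPush_zero, zero_mul]
  obtain ⟨w', hw', e⟩ := key w.2
  obtain rfl : w' = w := Subtype.ext e
  exact hw'

end SheafCoalgebra

/-! ### Injectivity of `Ω`. -/

section OmegaInjective

variable {𝕜 : Type*} [RCLike 𝕜]
variable {B : Type*} [NormedAddCommGroup B] [NormedSpace ℝ B] [FiniteDimensional ℝ B]
variable {M : Type*} [TopologicalSpace M] [ChartedSpace B M] [IsManifold 𝓘(ℝ, B) ∞ M] [T2Space M]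

section Algebra

variable {C D : Type*} [AddCommGroup C] [Module 𝕜 C] [AddCommGroup D] [Module 𝕜 D]
variable (a : BaseAlg 𝕜 B M →ₙₐ[𝕜] Module.End 𝕜 C) (b : BaseAlg 𝕜 B M →ₙₐ[𝕜] Module.End 𝕜 D)

/-- `C ⊗_R D` as an `R`-module. -/
noncomputable def tensorAct : BaseAlg 𝕜 B M →ₗ[𝕜] Module.End 𝕜 (TensorOver a b) where
  toFun p := (tensorRel a b).mapQ (tensorRel a b) (TensorProduct.map (a p) LinearMap.id) <| by
    refine Submodule.span_le.2 ?_
    rintro _ ⟨r, c, d, rfl⟩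
    refine Submodule.subset_span ⟨r, a p c, d, ?_⟩
    rw [map_sub, TensorProduct.map_tmul, TensorProduct.map_tmul, act_comm]
    rfl
  map_add' p q := by
    refine Submodule.linearMap_qext _ (TensorProduct.ext' fun c d => ?_)
    change TensorOver.tmul a b (a (p + q) c) d =
      TensorOver.tmul a b (a p c) d + TensorOver.tmul a b (a q c) d
    rw [map_add, LinearMap.add_apply, TensorOver.tmul, TensorProduct.add_tmul, map_add]
    rfl
  map_smul' r p := by
    refine Submodule.linearMap_qext _ (TensorProduct.ext' fun c d => ?_)
    change TensorOver.tmul a b (a (r • p) c) d = r • TensorOver.tmul a b (a p c) d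
    rw [map_smul, LinearMap.smul_apply, TensorOver.tmul, ← TensorProduct.smul_tmul', map_smul]
    rfl

theorem tensorAct_tmul (p : BaseAlg 𝕜 B M) (c : C) (d : D) :
    tensorAct a b p (TensorOver.tmul a b c d) = TensorOver.tmul a b (a p c) d := rfl

theorem tmul_act (p : BaseAlg 𝕜 B M) (c : C) (d : D) :
    TensorOver.tmul a b c (b p d) = TensorOver.tmul a b (a p c) d :=
  ((Submodule.Quotient.eq (tensorRel a b)).2 (Submodule.subset_span ⟨p, c, d, rfl⟩)).symm

theorem tmul_add_left (c c' : C) (d : D) :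
    TensorOver.tmul a b (c + c') d = TensorOver.tmul a b c d + TensorOver.tmul a b c' d := by
  rw [TensorOver.tmul, TensorProduct.add_tmul, map_add]; rfl

theorem tmul_add_right (c : C) (d d' : D) :
    TensorOver.tmul a b c (d + d') = TensorOver.tmul a b c d + TensorOver.tmul a b c d' := by
  rw [TensorOver.tmul, TensorProduct.tmul_add, map_add]; rfl

theorem zero_tmul (d : D) : TensorOver.tmul a b 0 d = 0 := by
  rw [TensorOver.tmul, TensorProduct.zero_tmul, map_zero]

theorem tmul_zero (c : C) : TensorOver.tmul a b c 0 = 0 := by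
  rw [TensorOver.tmul, TensorProduct.tmul_zero, map_zero]

theorem tensorOver_induction {P : TensorOver a b → Prop} (h0 : P 0)
    (hadd : ∀ w w', P w → P w' → P (w + w')) (htmul : ∀ c d, P (TensorOver.tmul a b c d))
    (w : TensorOver a b) : P w := by
  obtain ⟨w, rfl⟩ := (tensorRel a b).mkQ_surjective w
  induction w using TensorProduct.induction_on with
  | zero => rw [map_zero]; exact h0
  | tmul c d => exact htmul c d
  | add x y hx hy => rw [map_add]; exact hadd _ _ hx hy

theorem tensorAct_mul (p q : BaseAlg 𝕜 B M) (w : TensorOver a b) :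
    tensorAct a b (p * q) w = tensorAct a b p (tensorAct a b q w) := by
  induction w using tensorOver_induction with
  | h0 => simp
  | hadd w w' h h' => rw [map_add, map_add, map_add, h, h']
  | htmul c d => rw [tensorAct_tmul, tensorAct_tmul, tensorAct_tmul, map_mul]; rfl

theorem tensorAct_comm (p q : BaseAlg 𝕜 B M) (w : TensorOver a b) :
    tensorAct a b p (tensorAct a b q w) = tensorAct a b q (tensorAct a b p w) := by
  rw [← tensorAct_mul, ← tensorAct_mul, show p * q = q * p from Subtype.ext (mul_comm _ _)]

/-- The elements of `C ⊗_R D` which vanish near `y`. -/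
noncomputable def tensorKer (y : M) : Submodule 𝕜 (TensorOver a b) where
  carrier := {w | ∃ p : BaseAlg 𝕜 B M, (∀ᶠ z in 𝓝 y, p.1 z = 1) ∧ tensorAct a b p w = 0}
  add_mem' := by
    rintro c d ⟨f, hf, hc⟩ ⟨g, hg, hd⟩
    refine ⟨f * g, ?_, ?_⟩
    · filter_upwards [hf, hg] with y h1 h2
      change f.1 y * g.1 y = 1
      rw [h1, h2, one_mul]
    · rw [tensorAct_mul, map_add, map_add, hd, map_zero, add_zero, tensorAct_comm, hc, map_zero]
  zero_mem' := by
    obtain ⟨f, hf⟩ := exists_baseAlg_eq_one (𝕜 := 𝕜) (B := B) y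
    exact ⟨f, hf, map_zero _⟩
  smul_mem' := by
    rintro r c ⟨f, hf, hc⟩
    exact ⟨f, hf, by rw [map_smul, hc, smul_zero]⟩

theorem tmul_mem_tensorKer_left {y : M} {c : C} (hc : c ∈ stalkKer a y) (d : D) :
    TensorOver.tmul a b c d ∈ tensorKer a b y := by
  obtain ⟨p, hp, h⟩ := hc
  exact ⟨p, hp, by rw [tensorAct_tmul, h, zero_tmul]⟩

theorem tmul_mem_tensorKer_right {y : M} (c : C) {d : D} (hd : d ∈ stalkKer b y) :
    TensorOver.tmul a b c d ∈ tensorKer a b y := by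
  obtain ⟨p, hp, h⟩ := hd
  exact ⟨p, hp, by rw [tensorAct_tmul, ← tmul_act, h, tmul_zero]⟩

end Algebra

variable {X Y : Type*} [TopologicalSpace X] [TopologicalSpace Y]
  [ChartedSpace B X] [ChartedSpace B Y] [IsManifold 𝓘(ℝ, B) ∞ X] [IsManifold 𝓘(ℝ, B) ∞ Y]
variable {f : X → M} (hf : IsLocalDiffeomorph 𝓘(ℝ, B) 𝓘(ℝ, B) ∞ f)
variable {g : Y → M} (hg : IsLocalDiffeomorph 𝓘(ℝ, B) 𝓘(ℝ, B) ∞ g)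

/-- `R` may lack a unit; compactness of supports provides local units instead. For a generator, `K`
is the image in `M` of its support. -/
theorem exists_isCompact_act_eq_self (u : Cc 𝕜 B X) :
    ∃ K : Set M, IsCompact K ∧ ∀ p : BaseAlg 𝕜 B M, (∀ y ∈ K, p.1 y = 1) →
      sheafAct hf p u = u := by
  let S : Submodule 𝕜 (∀ x : X, Germ (𝓝 x) 𝕜) :=
    { carrier := {u | ∃ K : Set M, IsCompact K ∧ ∀ p : BaseAlg 𝕜 B M, (∀ y ∈ K, p.1 y = 1) →
        ∀ x, ((p.1 ∘ f : X → 𝕜) : Germ (𝓝 x) 𝕜) * u x = u x}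
      add_mem' := by
        rintro u v ⟨K, hK, hu⟩ ⟨L, hL, hv⟩
        refine ⟨K ∪ L, hK.union hL, fun p hp x => ?_⟩
        rw [Pi.add_apply, mul_add, hu p (fun y hy => hp y (Or.inl hy)),
          hv p (fun y hy => hp y (Or.inr hy))]
      zero_mem' := ⟨∅, isCompact_empty, fun p _ x => mul_zero _⟩
      smul_mem' := by
        rintro c u ⟨K, hK, hu⟩
        refine ⟨K, hK, fun p hp x => ?_⟩
        rw [Pi.smul_apply, germ_mul_smul, hu p hp] }
  have h : Cc 𝕜 B X ≤ S := by
    refine Submodule.span_le.2 ?_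
    rintro _ ⟨U, a, hU, -, ⟨-, K, hKU, hK, haK⟩, rfl⟩
    refine ⟨f '' K, hK.image hf.isLocalHomeomorph.continuous, fun p hp x => ?_⟩
    by_cases hx : x ∈ U
    · rw [extZero_of_mem _ hx]
      refine Germ.coe_eq.2 ?_
      filter_upwards [hU.mem_nhds hx] with z hz
      by_cases hzK : z ∈ K
      · simp [hp _ (mem_image_of_mem f hzK)]
      · simp [haK z hz hzK]
    · rw [extZero_of_notMem _ hx, mul_zero]
  obtain ⟨K, hK, hu⟩ := h u.2
  exact ⟨K, hK, fun p hp => Subtype.ext (funext fun x => hu p hp x)⟩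

theorem exists_isCompact_tensorAct_eq_self
    (w : TensorOver (C := Cc 𝕜 B X) (D := Cc 𝕜 B Y) (sheafAct (𝕜 := 𝕜) hf)
      (sheafAct (𝕜 := 𝕜) hg)) :
    ∃ K : Set M, IsCompact K ∧ ∀ p : BaseAlg 𝕜 B M, (∀ y ∈ K, p.1 y = 1) →
      tensorAct (C := Cc 𝕜 B X) (D := Cc 𝕜 B Y) (sheafAct hf) (sheafAct hg) p w = w := by
  induction w using tensorOver_induction with
  | h0 => exact ⟨∅, isCompact_empty, fun p _ => map_zero _⟩
  | hadd w w' h h' =>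
    obtain ⟨K, hK, hu⟩ := h
    obtain ⟨L, hL, hv⟩ := h'
    refine ⟨K ∪ L, hK.union hL, fun p hp => ?_⟩
    rw [map_add, hu p (fun y hy => hp y (Or.inl hy)), hv p (fun y hy => hp y (Or.inr hy))]
  | htmul u v =>
    obtain ⟨K, hK, hu⟩ := exists_isCompact_act_eq_self hf u
    exact ⟨K, hK, fun p hp => by rw [tensorAct_tmul, hu p hp]⟩

theorem omegaBar_tensorAct (p : BaseAlg 𝕜 B M)
    (w : TensorOver (C := Cc 𝕜 B X) (D := Cc 𝕜 B Y) (sheafAct (𝕜 := 𝕜) hf)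
      (sheafAct (𝕜 := 𝕜) hg)) (q : FibreProd hf hg) :
    (omegaBar hf hg (tensorAct (C := Cc 𝕜 B X) (D := Cc 𝕜 B Y) (sheafAct hf) (sheafAct hg) p w)).1
      q = ((p.1 ∘ (f ∘ FibreProd.fst) : FibreProd hf hg → 𝕜) : Germ (𝓝 q) 𝕜) *
        (omegaBar hf hg w).1 q := by
  induction w using tensorOver_induction with
  | h0 => rw [map_zero, map_zero]; exact (mul_zero _).symm
  | hadd w w' h h' =>
    have e := (omegaBar (𝕜 := 𝕜) hf hg).map_add w w'
    have e' := (tensorAct (C := Cc 𝕜 B X) (D := Cc 𝕜 B Y) (sheafAct hf) (sheafAct hg) p).map_add w w'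
    have e'' := (omegaBar (𝕜 := 𝕜) hf hg).map_add
      (tensorAct (C := Cc 𝕜 B X) (D := Cc 𝕜 B Y) (sheafAct hf) (sheafAct hg) p w)
      (tensorAct (C := Cc 𝕜 B X) (D := Cc 𝕜 B Y) (sheafAct hf) (sheafAct hg) p w')
    rw [e, e', e'']
    exact (congrArg₂ (· + ·) h h').trans (mul_add _ _ _).symm
  | htmul u v =>
    rw [tensorAct_tmul, omegaBar_tmul, omegaBar_tmul]
    change germPull _ _ (((p.1 ∘ f : X → 𝕜) : Germ (𝓝 q.fst) 𝕜) * u.1 q.fst) * _ =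
      _ * (germPull _ _ (u.1 q.fst) * _)
    rw [germPull_mul, mul_assoc]
    rfl

namespace LocalUnits

variable {hf hg} (E : LocalUnits 𝕜 hf) (F : LocalUnits 𝕜 hg)

/-- The combinations of the elements `elt x ⊗ elt x'` for `x`, `x'` in the fibres over `y`. -/
noncomputable def tensorComb (y : M) :
    ({x : X // f x = y} × {x : Y // g x = y} →₀ BaseAlg 𝕜 B M) →ₗ[𝕜]
      TensorOver (C := Cc 𝕜 B X) (D := Cc 𝕜 B Y) (sheafAct (𝕜 := 𝕜) hf) (sheafAct (𝕜 := 𝕜) hg) :=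
  Finsupp.lsum ℕ fun x =>
    (tensorAct (C := Cc 𝕜 B X) (D := Cc 𝕜 B Y) (sheafAct hf) (sheafAct hg)).flip
      (TensorOver.tmul (C := Cc 𝕜 B X) (D := Cc 𝕜 B Y) (sheafAct hf) (sheafAct hg)
        (E.elt x.1.1) (F.elt x.2.1))

theorem tensorComb_single (y : M) (x : {x : X // f x = y} × {x : Y // g x = y})
    (p : BaseAlg 𝕜 B M) :
    E.tensorComb F y (Finsupp.single x p) =
      tensorAct (C := Cc 𝕜 B X) (D := Cc 𝕜 B Y) (sheafAct hf) (sheafAct hg) p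
        (TensorOver.tmul (C := Cc 𝕜 B X) (D := Cc 𝕜 B Y) (sheafAct hf) (sheafAct hg)
        (E.elt x.1.1) (F.elt x.2.1)) := by
  simp [tensorComb]

/-- The analogue of `comb_apply` for pairs: `Ω` recovers each coefficient as a germ at the
corresponding point of the fibred product. -/
theorem omegaBar_tensorComb (y : M)
    (q : {x : X // f x = y} × {x : Y // g x = y} →₀ BaseAlg 𝕜 B M)
    (x : {x : X // f x = y}) (x' : {x : Y // g x = y}) :
    (omegaBar hf hg (E.tensorComb F y q)).1 ⟨x.1, x'.1, x.2.trans x'.2.symm⟩ =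
      (((q (x, x')).1 ∘ (f ∘ FibreProd.fst) : FibreProd hf hg → 𝕜) : Germ (𝓝 _) 𝕜) := by
  induction q using Finsupp.induction_linear with
  | zero => rw [map_zero, map_zero]; rfl
  | add a b ha hb =>
    rw [map_add, map_add, Submodule.coe_add, Pi.add_apply, ha, hb, Finsupp.add_apply]; rfl
  | single i p =>
    rw [tensorComb_single, omegaBar_tensorAct, omegaBar_tmul]
    change _ * omegaSection hf hg _ _ _ = _
    by_cases h : i = (x, x')
    · subst h
      rw [omegaSection_apply_comp hf hg _ (k := 1) (l := 1) (E.isIndicatorAt_elt x.1).1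
        (F.isIndicatorAt_elt x'.1).1, Finsupp.single_eq_same, mul_one]
      exact mul_one _
    · obtain ⟨l, hl⟩ := exists_germ_eq_comp hg.isLocalHomeomorph ((F.elt i.2.1).1 x'.1)
      obtain ⟨k, hk⟩ := exists_germ_eq_comp hf.isLocalHomeomorph ((E.elt i.1.1).1 x.1)
      rw [Finsupp.single_eq_of_ne (Ne.symm h)]
      by_cases h1 : x = i.1
      · have h2 : x'.1 ≠ i.2.1 := fun e => h (Prod.ext h1.symm (Subtype.ext e.symm))
        rw [omegaSection_apply_comp hf hg _ (l := 0) hk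
          ((F.isIndicatorAt_elt i.2.1).2 x'.1 (x'.2.trans i.2.2.symm) h2), mul_zero]
        exact mul_zero _
      · have h2 : x.1 ≠ i.1.1 := fun e => h1 (Subtype.ext e)
        rw [omegaSection_apply_comp hf hg _ (k := 0)
          ((E.isIndicatorAt_elt i.1.1).2 x.1 (x.2.trans i.1.2.symm) h2) hl, zero_mul]
        exact mul_zero _

theorem tmul_comb_mem_range (y : M) (q : {x : X // f x = y} →₀ BaseAlg 𝕜 B M)
    (q' : {x : Y // g x = y} →₀ BaseAlg 𝕜 B M) :
    TensorOver.tmul (C := Cc 𝕜 B X) (D := Cc 𝕜 B Y) (sheafAct (𝕜 := 𝕜) hf) (sheafAct (𝕜 := 𝕜) hg)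
      (E.comb y q) (F.comb y q') ∈ LinearMap.range (E.tensorComb F y) := by
  induction q using Finsupp.induction_linear with
  | zero => rw [map_zero, zero_tmul]; exact Submodule.zero_mem _
  | add a b ha hb => rw [map_add, tmul_add_left]; exact Submodule.add_mem _ ha hb
  | single x p =>
    induction q' using Finsupp.induction_linear with
    | zero => rw [map_zero, tmul_zero]; exact Submodule.zero_mem _
    | add a b ha hb => rw [map_add, tmul_add_right]; exact Submodule.add_mem _ ha hb
    | single x' p' =>
      -- Balancing moves the coefficient of the second factor to the first.
      refine ⟨Finsupp.single (x, x') (p' * p), ?_⟩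
      rw [tensorComb_single, comb_single, comb_single, tmul_act, tensorAct_mul, tensorAct_tmul,
        tensorAct_tmul]

/-- Both factors are split by `exists_sub_comb_mem`; a tensor with a factor vanishing near `y` lies
in `tensorKer`. -/
theorem mem_range_tensorComb_sup (y : M) (w : TensorOver (C := Cc 𝕜 B X) (D := Cc 𝕜 B Y)
      (sheafAct (𝕜 := 𝕜) hf) (sheafAct (𝕜 := 𝕜) hg)) :
    w ∈ LinearMap.range (E.tensorComb F y) ⊔
      tensorKer (C := Cc 𝕜 B X) (D := Cc 𝕜 B Y) (sheafAct hf) (sheafAct hg) y := by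
  induction w using tensorOver_induction with
  | h0 => exact Submodule.zero_mem _
  | hadd w w' h h' => exact Submodule.add_mem _ h h'
  | htmul u v =>
    obtain ⟨q, hq⟩ := E.exists_sub_comb_mem y u
    obtain ⟨q', hq'⟩ := F.exists_sub_comb_mem y v
    have h1 : u - E.comb y q ∈ stalkKer (C := Cc 𝕜 B X) (sheafAct hf) y :=
      (mem_stalkKer_iff hf (u - E.comb y q) y).2 hq.self_of_nhds
    have h2 : v - F.comb y q' ∈ stalkKer (C := Cc 𝕜 B Y) (sheafAct hg) y :=
      (mem_stalkKer_iff hg (v - F.comb y q') y).2 hq'.self_of_nhds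
    rw [← add_sub_cancel (E.comb y q) u, tmul_add_left, ← add_sub_cancel (F.comb y q') v,
      tmul_add_right, add_assoc]
    refine Submodule.add_mem_sup (E.tmul_comb_mem_range F y q q') (Submodule.add_mem _ ?_ ?_)
    · exact tmul_mem_tensorKer_right _ _ _ h2
    · exact tmul_mem_tensorKer_left _ _ h1 _

end LocalUnits

/-- The local form of injectivity. Up to a remainder vanishing near `y`, `w` is a combination of
products of local units; `Ω(w) = 0` makes the germs at `y` of all its coefficients vanish, so each
summand is annihilated by some function equal to one near `y`. -/
theorem mem_tensorKer_of_omegaBar_eq_zero (w : TensorOver (C := Cc 𝕜 B X) (D := Cc 𝕜 B Y)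
      (sheafAct (𝕜 := 𝕜) hf) (sheafAct (𝕜 := 𝕜) hg)) (hw : omegaBar hf hg w = 0) (y : M) :
    w ∈ tensorKer (C := Cc 𝕜 B X) (D := Cc 𝕜 B Y) (sheafAct hf) (sheafAct hg) y := by
  obtain ⟨E⟩ := nonempty_localUnits (𝕜 := 𝕜) hf
  obtain ⟨F⟩ := nonempty_localUnits (𝕜 := 𝕜) hg
  obtain ⟨_, ⟨q, rfl⟩, r, hr, rfl⟩ := Submodule.mem_sup.1 (E.mem_range_tensorComb_sup F y w)
  refine Submodule.add_mem _ ?_ hr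
  have hc := (isLocalHomeomorph_comp_fst hf hg)
  have h0 : ∀ x : {x : X // f x = y} × {x : Y // g x = y},
      ((q x).1 : Germ (𝓝 y) 𝕜) = 0 := by
    rintro ⟨x, x'⟩
    obtain ⟨p, hp, hpr⟩ := hr
    have h1 := omegaBar_tensorAct hf hg p r ⟨x.1, x'.1, x.2.trans x'.2.symm⟩
    have hp' : ∀ᶠ z in 𝓝 ((f ∘ FibreProd.fst)
        (⟨x.1, x'.1, x.2.trans x'.2.symm⟩ : FibreProd hf hg)), p.1 z = 1 := by
      change ∀ᶠ z in 𝓝 (f x.1), p.1 z = 1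
      rw [x.2]; exact hp
    rw [hpr, map_zero, germ_comp_eq_one hc.continuous hp', one_mul] at h1
    have h2 := E.omegaBar_tensorComb F y q x x'
    have h3 := congrFun (congrArg Subtype.val hw) ⟨x.1, x'.1, x.2.trans x'.2.symm⟩
    rw [map_add, Submodule.coe_add, Pi.add_apply, h2, ← h1] at h3
    have h4 := germPush_comp hc (y := ⟨x.1, x'.1, x.2.trans x'.2.symm⟩) x.2 (q (x, x')).1
    have h5 : (((q (x, x')).1 ∘ (f ∘ FibreProd.fst) : FibreProd hf hg → 𝕜) :
        Germ (𝓝 (⟨x.1, x'.1, x.2.trans x'.2.symm⟩ : FibreProd hf hg)) 𝕜) = 0 :=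
      (add_zero _).symm.trans h3
    rw [← h4, h5]
    exact germPush_zero hc (y := ⟨x.1, x'.1, x.2.trans x'.2.symm⟩) x.2
  have hsum : E.tensorComb F y q = ∑ i ∈ q.support, E.tensorComb F y (Finsupp.single i (q i)) := by
    simp_rw [LocalUnits.tensorComb_single]
    simp [LocalUnits.tensorComb, Finsupp.sum]
  rw [hsum]
  refine Submodule.sum_mem _ fun i _ => ?_
  rw [LocalUnits.tensorComb_single]
  obtain ⟨p, hp, hpN⟩ := exists_baseAlg_bump (𝕜 := 𝕜) (B := B)
    (eventually_eventually_nhds.2 (Germ.coe_eq.1 (h0 i)))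
  refine ⟨p, hp, ?_⟩
  -- The support of `p` was chosen inside the set where the germ of `q i` vanishes.
  have hpq : p * q i = 0 := by
    refine Subtype.ext (funext fun z => ?_)
    change p.1 z * (q i).1 z = 0
    by_cases hz : z ∈ tsupport p.1
    · rw [(hpN hz).self_of_nhds]; exact mul_zero _
    · rw [image_eq_zero_of_notMem_tsupport hz, zero_mul]
  rw [← tensorAct_mul, hpq, map_zero, LinearMap.zero_apply]

/-- The annihilator of `w` is an ideal of `R` containing, at each point, a function equal to one
nearby. By compactness it contains one equal to one near the compact set over which `w` lives; that
function also acts on `w` as the identity. -/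
theorem omegaBar_injective :
    Function.Injective (omegaBar (𝕜 := 𝕜) hf hg) := by
  rw [injective_iff_map_eq_zero]
  intro w hw
  let I : Submodule 𝕜 (BaseAlg 𝕜 B M) := LinearMap.ker
    ((tensorAct (C := Cc 𝕜 B X) (D := Cc 𝕜 B Y) (sheafAct hf) (sheafAct hg)).flip w)
  obtain ⟨K, hK, h⟩ := exists_isCompact_tensorAct_eq_self hf hg w
  obtain ⟨p, hp, hpK⟩ := exists_mem_eq_one_of_isCompact I
    (fun p hp q => by
      change tensorAct (C := Cc 𝕜 B X) (D := Cc 𝕜 B Y) (sheafAct hf) (sheafAct hg) (q * p) w = 0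
      rw [tensorAct_mul, show tensorAct (C := Cc 𝕜 B X) (D := Cc 𝕜 B Y) (sheafAct hf)
        (sheafAct hg) p w = 0 from hp, map_zero])
    hK (fun y _ => by
      obtain ⟨p, hp, h⟩ := mem_tensorKer_of_omegaBar_eq_zero hf hg w hw y
      exact ⟨p, h, hp⟩)
  rw [← h p fun y hy => (hpK y hy).self_of_nhds]
  exact hp

end OmegaInjective

/-! ### The spectral sheaf of `C_c^∞(X)` is `X`. -/

section SheafSpectrum

variable {𝕜 : Type*} [RCLike 𝕜]
variable {B : Type*} [NormedAddCommGroup B] [NormedSpace ℝ B] [FiniteDimensional ℝ B]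
variable {X M : Type*} [TopologicalSpace X] [TopologicalSpace M]
  [ChartedSpace B X] [ChartedSpace B M] [IsManifold 𝓘(ℝ, B) ∞ X]
  [IsManifold 𝓘(ℝ, B) ∞ M] [T2Space M]

/-- The coalgebra `C_c^∞(X)` of a sheaf `f : X → M`. -/
noncomputable def sheafCoalgebra (𝕜 : Type*) [RCLike 𝕜] {f : X → M}
    (hf : IsLocalDiffeomorph 𝓘(ℝ, B) 𝓘(ℝ, B) ∞ f) :
    CoalgebraOps 𝕜 B M (Cc 𝕜 B X) where
  act := sheafAct hf
  comul u := Function.invFun (omegaBar hf hf)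
    (pushforward (FibreProd.isLocalDiffeomorph_diag hf) u)
  counit u := toBase (pushforward hf u)

variable {f : X → M} (hf : IsLocalDiffeomorph 𝓘(ℝ, B) 𝓘(ℝ, B) ∞ f)

theorem omegaBar_comul (w : Cc 𝕜 B X) :
    omegaBar hf hf ((sheafCoalgebra 𝕜 hf).comul w) =
      pushforward (FibreProd.isLocalDiffeomorph_diag hf) w :=
  Function.invFun_eq (pushforward_diag_mem_range hf w)

/-- Injectivity of `Ω` enters here; from now on equations for the comultiplication are equations of
germs. -/
theorem comul_eq_tmul_iff (w u v : Cc 𝕜 B X) :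
    (sheafCoalgebra 𝕜 hf).comul w = TensorOver.tmul (C := Cc 𝕜 B X) (D := Cc 𝕜 B X)
      (sheafCoalgebra 𝕜 hf).act (sheafCoalgebra 𝕜 hf).act u v ↔ DiagRel hf w u v := by
  rw [← omega_eq_pushforward_diag_iff, ← omegaBar_comul]
  exact (omegaBar_injective hf hf).eq_iff.symm.trans eq_comm

/-- On the diagonal `χ χ' = χ`; off the diagonal, at most one of two distinct points of a fibre lies
in `U`. -/
theorem diagRel_lift {U : Set X} (hU : IsOpen U) (hinj : InjOn f U) {χ χ' : BaseAlg 𝕜 B M}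
    (hχ : tsupport χ.1 ⊆ f '' U) (hχ' : tsupport χ'.1 ⊆ f '' U)
    (h : ∀ y ∈ tsupport χ.1, χ'.1 y = 1) :
    DiagRel hf ⟨_, lift_mem hf hU hinj χ hχ⟩ ⟨_, lift_mem hf hU hinj χ hχ⟩
      ⟨_, lift_mem hf hU hinj χ' hχ'⟩ := by
  constructor
  · intro x
    change extZero U (χ.1 ∘ f) x = extZero U (χ.1 ∘ f) x * extZero U (χ'.1 ∘ f) x
    by_cases hx : x ∈ U
    · rw [extZero_of_mem _ hx, extZero_of_mem _ hx]
      refine Germ.coe_eq.2 (Eventually.of_forall fun z => ?_)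
      by_cases hz : f z ∈ tsupport χ.1
      · simp [h _ hz]
      · simp [image_eq_zero_of_notMem_tsupport hz]
    · rw [extZero_of_notMem _ hx, zero_mul]
  · intro y x x' hx hx' hne
    change germPush _ _ (extZero U (χ.1 ∘ f) x) * germPush _ _ (extZero U (χ'.1 ∘ f) x') = 0
    by_cases h1 : x ∈ U
    · rw [extZero_of_notMem _ fun h2 => hne (hinj h1 h2 (hx.trans hx'.symm)), germPush_zero,
        mul_zero]
    · rw [extZero_of_notMem _ h1, germPush_zero, zero_mul]

/-- An element of `C_c^∞(M)` is the section of germs of its values. -/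
theorem germ_eq_value (u : Cc 𝕜 B M) (y : M) :
    u.1 y = ((fun z => (u.1 z).value : M → 𝕜) : Germ (𝓝 y) 𝕜) := by
  -- For the identity of `M` the fibre over `y` is `{y}`, so agreement of `u` with a function `p` at
  -- `y` extends to a neighbourhood.
  have hid : IsLocalDiffeomorph 𝓘(ℝ, B) 𝓘(ℝ, B) ∞ (id : M → M) :=
    (Diffeomorph.refl 𝓘(ℝ, B) M ∞).isLocalDiffeomorph
  obtain ⟨p, hp⟩ := exists_baseAlg_germ hid u y
  have hof : ∀ z, (ofBase p).1 z = (p.1 : Germ (𝓝 z) 𝕜) := fun z => extZero_of_mem _ (mem_univ z)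
  have h := eventually_eq_zero_of_fibre hid (u - ofBase p) (y := y) (by
    rintro x rfl
    rw [Submodule.coe_sub, Pi.sub_apply, sub_eq_zero, hof]
    exact hp)
  rw [hp]
  refine Germ.coe_eq.2 ?_
  filter_upwards [h] with z hz
  have h1 := hz z rfl
  rw [Submodule.coe_sub, Pi.sub_apply, sub_eq_zero, hof] at h1
  rw [h1]; rfl

theorem normalizedAt_iff (c : Cc 𝕜 B X) (y : M) :
    NormalizedAt (sheafCoalgebra 𝕜 hf) c y ↔ (pushforward hf c).1 y = 1 := by
  rw [germ_eq_value]
  exact Germ.coe_eq.symm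

theorem pushforward_apply_of_isIndicatorAt {c : Cc 𝕜 B X} {x : X} (h : IsIndicatorAt f c.1 x) :
    (pushforward hf c).1 (f x) = 1 := by
  change ∑ᶠ x' : {x' // f x' = f x}, germPush hf.isLocalHomeomorph x'.2 (c.1 x'.1) = 1
  rw [finsum_eq_single _ (⟨x, rfl⟩ : {x' // f x' = f x}), h.1, germPush_one]
  intro x' hx'
  rw [h.2 x'.1 x'.2 fun e => hx' (Subtype.ext e), germPush_zero]

theorem normalizedAt_of_isIndicatorAt {c : Cc 𝕜 B X} {x : X} (h : IsIndicatorAt f c.1 x) :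
    NormalizedAt (sheafCoalgebra 𝕜 hf) c (f x) :=
  (normalizedAt_iff hf c (f x)).2 (pushforward_apply_of_isIndicatorAt hf h)

/-- The heart of the proof: on the base, the germs of `c` over `y` turn out to be orthogonal
idempotents with sum one, hence all zero but one. Only relations over the single point `y` are
assumed, so that the lemma also serves grouplike classes, with `c' = c`. -/
theorem exists_isIndicatorAt {c c' : Cc 𝕜 B X} {y : M}
    (h1 : ∀ (x : X) (h : f x = y), germPush hf.isLocalHomeomorph h (c.1 x) *
      germPush hf.isLocalHomeomorph h (c'.1 x) = germPush hf.isLocalHomeomorph h (c.1 x))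
    (h2 : ∀ (x x' : X) (h : f x = y) (h' : f x' = y), x ≠ x' →
      germPush hf.isLocalHomeomorph h (c.1 x) * germPush hf.isLocalHomeomorph h' (c'.1 x') = 0)
    (hn : NormalizedAt (sheafCoalgebra 𝕜 hf) c y) :
    ∃ x, f x = y ∧ IsIndicatorAt f c.1 x ∧ IsIndicatorAt f c'.1 x := by
  have hs : ∑ᶠ x : {x // f x = y}, germPush hf.isLocalHomeomorph x.2 (c.1 x.1) = 1 :=
    (normalizedAt_iff hf c y).1 hn
  have hcc : ∀ (x : X) (h : f x = y), germPush hf.isLocalHomeomorph h (c'.1 x) =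
      germPush hf.isLocalHomeomorph h (c.1 x) := by
    intro x h
    -- The normalization `∑ c = 1` is multiplied by the germ of `c'` at `x`; orthogonality leaves
    -- one summand, which is the germ of `c` at `x`.
    have e := finsum_mul' (fun x : {x // f x = y} => germPush hf.isLocalHomeomorph x.2 (c.1 x.1))
      (germPush hf.isLocalHomeomorph h (c'.1 x)) (hasFiniteSupport _ c.2 y)
    rw [hs, one_mul] at e
    refine (e.trans (finsum_eq_single _ (⟨x, h⟩ : {x // f x = y}) fun x' hx' => ?_)).trans (h1 x h)
    exact h2 x'.1 x x'.2 h fun e => hx' (Subtype.ext e)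
  have hc : ∀ x, f x = y → c'.1 x = c.1 x := fun x h =>
    germPush_injective hf.isLocalHomeomorph h (hcc x h)
  obtain ⟨⟨x, hx⟩, hx0⟩ : ∃ x : {x // f x = y}, germPush hf.isLocalHomeomorph x.2 (c.1 x.1) ≠ 0 := by
    by_contra! h
    rw [finsum_congr h, finsum_zero] at hs
    exact germ_zero_ne_one y hs
  have hx1 : c.1 x = 1 := by
    refine (germ_eq_zero_or_one hf c x ?_).resolve_left fun h => hx0 (by rw [h, germPush_zero])
    refine germPush_injective hf.isLocalHomeomorph hx ?_
    have e := h1 x hx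
    rwa [hcc x hx, ← germPush_mul] at e
  have hx2 : ∀ x', f x' = f x → x' ≠ x → c'.1 x' = 0 := by
    intro x' hx' hne
    have := h2 x x' hx (hx'.trans hx) hne.symm
    rwa [hx1, germPush_one, one_mul, germPush_eq_zero] at this
  refine ⟨x, hx, ⟨hx1, fun x' hx' hne => ?_⟩, (hc x hx).trans hx1, hx2⟩
  rw [← hc x' (hx'.trans hx), hx2 x' hx' hne]

theorem exists_isIndicatorAt_of_diagRel {c c' : Cc 𝕜 B X} (h : DiagRel hf c c c') {y : M}
    (hn : NormalizedAt (sheafCoalgebra 𝕜 hf) c y) :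
    ∃ x, f x = y ∧ IsIndicatorAt f c.1 x ∧ IsIndicatorAt f c'.1 x :=
  exists_isIndicatorAt hf (fun x hx => by rw [← germPush_mul, ← h.1]) (h.2 y) hn

/-- The evaluation of a class in the localization at `y` at a point of the fibre. -/
noncomputable def stalkEval {x : X} {y : M} (h : f x = y) :
    Stalk (C := Cc 𝕜 B X) (sheafAct hf) y →ₗ[𝕜] Germ (𝓝 y) 𝕜 :=
  (stalkKer (C := Cc 𝕜 B X) (sheafAct hf) y).liftQ
    { toFun := fun u => germPush hf.isLocalHomeomorph h (u.1 x)
      map_add' := fun u v => germPush_add _ _ _ _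
      map_smul' := fun r u => germPush_smul _ _ _ _ } <| by
    intro u hu
    have := (mem_stalkKer_iff hf u y).1 hu x h
    change germPush hf.isLocalHomeomorph h (u.1 x) = 0
    rw [this, germPush_zero]

theorem stalkEval_stalkAct {x : X} {y : M} (h : f x = y) (p : BaseAlg 𝕜 B M)
    (ζ : Stalk (C := Cc 𝕜 B X) (sheafAct hf) y) :
    stalkEval hf h (stalkAct (C := Cc 𝕜 B X) (sheafAct hf) y p ζ) =
      (p.1 : Germ (𝓝 y) 𝕜) * stalkEval hf h ζ := by
  obtain ⟨u, rfl⟩ := (stalkKer (C := Cc 𝕜 B X) (sheafAct hf) y).mkQ_surjective ζ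
  change germPush hf.isLocalHomeomorph h (((p.1 ∘ f : X → 𝕜) : Germ (𝓝 x) 𝕜) * u.1 x) =
    _ * germPush hf.isLocalHomeomorph h (u.1 x)
  rw [germPush_mul, germPush_comp]

/-- The evaluation of `C_y ⊗ C_y` at a pair of points of the fibre over `y`. -/
noncomputable def stalkEval₂ {x x' : X} {y : M} (h : f x = y) (h' : f x' = y) :
    TensorOver (C := Stalk (C := Cc 𝕜 B X) (sheafAct hf) y)
      (D := Stalk (C := Cc 𝕜 B X) (sheafAct hf) y)
      (stalkAct (C := Cc 𝕜 B X) (sheafAct hf) y) (stalkAct (C := Cc 𝕜 B X) (sheafAct hf) y) →ₗ[𝕜]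
      Germ (𝓝 y) 𝕜 :=
  TensorOver.lift _ _
    (LinearMap.mk₂ 𝕜 (fun ζ ξ => stalkEval hf h ζ * stalkEval hf h' ξ)
      (fun a b c => by rw [map_add, add_mul]) (fun r a b => by rw [map_smul, germ_smul_mul])
      (fun a b c => by rw [map_add, mul_add]) (fun r a b => by rw [map_smul, germ_mul_smul]))
    (fun p ζ ξ => by
      rw [LinearMap.mk₂_apply, LinearMap.mk₂_apply, stalkEval_stalkAct, stalkEval_stalkAct]
      ring)

/-- Equations in `C_y ⊗ C_y` are tested by evaluation at pairs of points of the fibre, which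
suffices for extracting relations between germs without knowing injectivity on this tensor product.
-/
theorem stalkEval₂_tensorToStalk {x x' : X} {y : M} (h : f x = y) (h' : f x' = y)
    (w : TensorOver (C := Cc 𝕜 B X) (D := Cc 𝕜 B X) (sheafAct (𝕜 := 𝕜) hf) (sheafAct (𝕜 := 𝕜) hf)) :
    stalkEval₂ hf h h' (tensorToStalk (C := Cc 𝕜 B X) (sheafAct hf) y w) =
      germPush (isLocalHomeomorph_comp_fst hf hf) (y := ⟨x, x', h.trans h'.symm⟩) h
        ((omegaBar hf hf w).1 ⟨x, x', h.trans h'.symm⟩) := by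
  induction w using tensorOver_induction with
  | h0 =>
    rw [map_zero, map_zero, map_zero]
    exact (germPush_zero (isLocalHomeomorph_comp_fst hf hf) (y := ⟨x, x', h.trans h'.symm⟩) h).symm
  | hadd w w' hw hw' =>
    have e := (omegaBar (𝕜 := 𝕜) hf hf).map_add w w'
    have e' := (tensorToStalk (C := Cc 𝕜 B X) (sheafAct hf) y).map_add w w'
    rw [e, e', LinearMap.map_add]
    exact (congrArg₂ (· + ·) hw hw').trans (germPush_add (isLocalHomeomorph_comp_fst hf hf)
      (y := ⟨x, x', h.trans h'.symm⟩) h _ _).symm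
  | htmul u v =>
    exact (germPush_omegaSection hf hf ⟨x, x', h.trans h'.symm⟩ h h').symm

/-- Evaluation at pairs of points turns `Δ_y(ζ) = ζ ⊗ ζ` into the hypotheses of
`exists_isIndicatorAt` with `c' = c`. -/
theorem exists_isIndicatorAt_of_grouplike {c : Cc 𝕜 B X} {y : M}
    (h : tensorToStalk (C := Cc 𝕜 B X) (sheafAct hf) y ((sheafCoalgebra 𝕜 hf).comul c) =
      TensorOver.tmul _ _ (toStalk (C := Cc 𝕜 B X) (sheafAct hf) y c)
        (toStalk (C := Cc 𝕜 B X) (sheafAct hf) y c))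
    (hn : NormalizedAt (sheafCoalgebra 𝕜 hf) c y) :
    ∃ x, f x = y ∧ IsIndicatorAt f c.1 x := by
  have key : ∀ (x x' : X) (hx : f x = y) (hx' : f x' = y),
      germPush hf.isLocalHomeomorph hx (c.1 x) * germPush hf.isLocalHomeomorph hx' (c.1 x') =
        germPush (isLocalHomeomorph_comp_fst hf hf) (y := ⟨x, x', hx.trans hx'.symm⟩) hx
        ((pushforward (FibreProd.isLocalDiffeomorph_diag hf) c).1 ⟨x, x', hx.trans hx'.symm⟩) := by
    intro x x' hx hx'
    rw [← omegaBar_comul]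
    exact (congrArg (stalkEval₂ hf hx hx') h).symm.trans (stalkEval₂_tensorToStalk hf hx hx' _)
  obtain ⟨x, hx, h1, -⟩ := exists_isIndicatorAt hf (c := c) (c' := c) (y := y)
    (fun x hx => (key x x hx hx).trans (germPush_pushforward_diag hf c x hx))
    (fun x x' hx hx' hne => by
      rw [key, pushforward_diag_of_ne hf c ⟨x, x', hx.trans hx'.symm⟩ hne]
      exact germPush_zero (isLocalHomeomorph_comp_fst hf hf)
        (y := ⟨x, x', hx.trans hx'.symm⟩) hx) hn
  exact ⟨x, hx, h1⟩

theorem classAt_eq_iff (c d : Cc 𝕜 B X) (y z : M) :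
    classAt (sheafCoalgebra 𝕜 hf) c y = classAt (sheafCoalgebra 𝕜 hf) d z ↔
      y = z ∧ ∀ x, f x = y → c.1 x = d.1 x := by
  constructor
  · intro h
    obtain rfl : y = z := congrArg Sigma.fst h
    exact ⟨rfl, (toStalk_eq_iff hf c d y).1 (eq_of_heq (Sigma.mk.inj h).2)⟩
  · rintro ⟨rfl, h⟩
    exact congrArg (Sigma.mk y) ((toStalk_eq_iff hf c d y).2 h)

theorem eq_on_fibre_of_isIndicatorAt {u v : ∀ x : X, Germ (𝓝 x) 𝕜} {x : X}
    (hu : IsIndicatorAt f u x) (hv : IsIndicatorAt f v x) : ∀ x', f x' = f x → u x' = v x' := by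
  intro x' hx'
  by_cases h : x' = x
  · subst h; rw [hu.1, hv.1]
  · rw [hu.2 x' hx' h, hv.2 x' hx' h]

theorem IsIndicatorAt.congr {u v : ∀ x : X, Germ (𝓝 x) 𝕜} {x : X}
    (hu : IsIndicatorAt f u x) (h : ∀ x', f x' = f x → u x' = v x') : IsIndicatorAt f v x :=
  ⟨(h x rfl).symm.trans hu.1, fun x' hx' hne => (h x' hx').symm.trans (hu.2 x' hx' hne)⟩

theorem IsIndicatorAt.unique {u : ∀ x : X, Germ (𝓝 x) 𝕜} {x x' : X}
    (hu : IsIndicatorAt f u x) (hu' : IsIndicatorAt f u x') (h : f x = f x') : x = x' := by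
  by_contra hne
  exact germ_zero_ne_one x ((hu'.2 x h hne).symm.trans hu.1)

include hf in
-- If `c` is an indicator at `x`, it agrees with `E.elt x` on the fibre through `x`, hence on all
-- nearby fibres, and `E.elt x` is an indicator at every point near `x`.
theorem isOpen_isIndicatorAt (c : Cc 𝕜 B X) : IsOpen {x | IsIndicatorAt f c.1 x} := by
  rw [isOpen_iff_eventually]
  intro x hx
  obtain ⟨E⟩ := nonempty_localUnits (𝕜 := 𝕜) hf
  have h := eventually_eq_zero_of_fibre hf (E.elt x - c) (y := f x) fun x' hx' => by
    rw [Submodule.coe_sub, Pi.sub_apply, sub_eq_zero,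
      eq_on_fibre_of_isIndicatorAt (E.isIndicatorAt_elt x) hx x' hx']
  have hc := hf.isLocalHomeomorph.continuous
  filter_upwards [(E.isOpen_nhd x).mem_nhds (E.mem_nhd x), hc.continuousAt.eventually h,
    hc.continuousAt.eventually (eventually_eventually_nhds.2 (E.fn_eq_one x))] with x' h1 h2 h3
  refine (isIndicatorAt_extZero (E.injOn x) hc h1 h3).congr fun x'' hx'' => ?_
  exact sub_eq_zero.1 (h2 x'' hx'')

theorem lift_mem_weaklyGrouplike {U : Set X} (hU : IsOpen U) (hinj : InjOn f U)
    {χ : BaseAlg 𝕜 B M} (hχ : tsupport χ.1 ⊆ f '' U) :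
    (⟨_, lift_mem hf hU hinj χ hχ⟩ : Cc 𝕜 B X) ∈ weaklyGrouplike (sheafCoalgebra 𝕜 hf) := by
  obtain ⟨χ', h, hχ'⟩ := exists_baseAlg_eq_one_on_subset (𝕜 := 𝕜) (B := B) χ.2.2
    (hf.isLocalHomeomorph.isOpenMap _ hU) hχ
  exact ⟨⟨_, lift_mem hf hU hinj χ' hχ'⟩, (comul_eq_tmul_iff hf _ _ _).2
    (diagRel_lift hf hU hinj hχ hχ' fun y hy => (h y hy).self_of_nhds)⟩

/-- `c` and `c'` are indicators of the same point over `y`, so their classes coincide and `c ⊗ c'`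
becomes `ζ ⊗ ζ`. -/
theorem toStalk_mem_grouplike {c : Cc 𝕜 B X} (hc : c ∈ weaklyGrouplike (sheafCoalgebra 𝕜 hf))
    {y : M} (hn : NormalizedAt (sheafCoalgebra 𝕜 hf) c y) :
    toStalk (sheafCoalgebra 𝕜 hf).act y c ∈ grouplike (sheafCoalgebra 𝕜 hf) y := by
  obtain ⟨c', hc'⟩ := hc
  refine ⟨c, rfl, ?_, hn⟩
  obtain ⟨x, rfl, h1, h2⟩ := exists_isIndicatorAt_of_diagRel hf
    ((comul_eq_tmul_iff hf _ _ _).1 hc') hn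
  have e : toStalk (sheafCoalgebra 𝕜 hf).act (f x) c' =
      toStalk (sheafCoalgebra 𝕜 hf).act (f x) c :=
    (toStalk_eq_iff hf c' c (f x)).2 (eq_on_fibre_of_isIndicatorAt h2 h1)
  rw [hc']
  change TensorOver.tmul _ _ (toStalk (sheafCoalgebra 𝕜 hf).act (f x) c)
    (toStalk (sheafCoalgebra 𝕜 hf).act (f x) c') = _
  rw [e]

theorem LocalUnits.elt_mem_weaklyGrouplike {hf : IsLocalDiffeomorph 𝓘(ℝ, B) 𝓘(ℝ, B) ∞ f}
    (E : LocalUnits 𝕜 hf) (x : X) : E.elt x ∈ weaklyGrouplike (sheafCoalgebra 𝕜 hf) :=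
  lift_mem_weaklyGrouplike hf (E.isOpen_nhd x) (E.injOn x) (E.tsupport_fn x)

/-- The point of the spectral sheaf of `C_c^∞(X)` that corresponds to a point of `X`. -/
noncomputable def espPoint (𝕜 : Type*) [RCLike 𝕜] (hf : IsLocalDiffeomorph 𝓘(ℝ, B) 𝓘(ℝ, B) ∞ f)
    (x : X) : Esp (sheafCoalgebra 𝕜 hf) :=
  ⟨classAt (sheafCoalgebra 𝕜 hf) ((nonempty_localUnits (𝕜 := 𝕜) hf).some.elt x) (f x),
    toStalk_mem_grouplike hf (LocalUnits.elt_mem_weaklyGrouplike _ x)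
      (normalizedAt_of_isIndicatorAt hf (LocalUnits.isIndicatorAt_elt _ x))⟩

/-- The dictionary used from here on: a point of the spectrum is represented by exactly those `c`
that are indicators of the corresponding point. In particular the choice of local units in
`espPoint` does not matter. -/
theorem espPoint_eq_classAt_iff (c : Cc 𝕜 B X) (x : X) (y : M) :
    (espPoint 𝕜 hf x).1 = classAt (sheafCoalgebra 𝕜 hf) c y ↔
      f x = y ∧ IsIndicatorAt f c.1 x := by
  refine (classAt_eq_iff hf _ c (f x) y).trans (and_congr_right fun _ => ⟨fun h => ?_, fun h => ?_⟩)
  · exact (LocalUnits.isIndicatorAt_elt _ x).congr h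
  · exact eq_on_fibre_of_isIndicatorAt (LocalUnits.isIndicatorAt_elt _ x) h

theorem espPoint_injective : Function.Injective (espPoint 𝕜 hf) := by
  intro x x' h
  have h1 := (espPoint_eq_classAt_iff hf _ x _).1 (congrArg Subtype.val h)
  exact h1.2.unique (LocalUnits.isIndicatorAt_elt _ x') h1.1

theorem espPoint_surjective : Function.Surjective (espPoint 𝕜 hf) := by
  rintro ⟨⟨y, ζ⟩, c, hζ, h, hn⟩
  obtain rfl : toStalk (sheafCoalgebra 𝕜 hf).act y c = ζ := hζ
  obtain ⟨x, hx, hc⟩ := exists_isIndicatorAt_of_grouplike hf h hn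
  exact ⟨x, Subtype.ext ((espPoint_eq_classAt_iff hf c x y).2 ⟨hx, hc⟩)⟩

/-- The preimage of `c_W` is the part over `W` of the open set where `c` is an indicator. -/
theorem continuous_espPoint : Continuous (espPoint 𝕜 hf) := by
  refine continuous_generateFrom_iff.2 ?_
  rintro _ ⟨c, W, -, hW, -, rfl⟩
  have : espPoint 𝕜 hf ⁻¹' basicSet (sheafCoalgebra 𝕜 hf) c W =
      f ⁻¹' W ∩ {x | IsIndicatorAt f c.1 x} := by
    ext x
    constructor
    · rintro ⟨y, hy, h⟩
      obtain ⟨rfl, h'⟩ := (espPoint_eq_classAt_iff hf c x y).1 h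
      exact ⟨hy, h'⟩
    · rintro ⟨hy, h⟩
      exact ⟨f x, hy, (espPoint_eq_classAt_iff hf c x _).2 ⟨rfl, h⟩⟩
  rw [this]
  exact (hW.preimage hf.isLocalHomeomorph.continuous).inter (isOpen_isIndicatorAt hf c)

theorem isOpenMap_espPoint : IsOpenMap (espPoint 𝕜 hf) := by
  intro V hV
  rw [isOpen_iff_mem_nhds]
  rintro _ ⟨x, hx, rfl⟩
  obtain ⟨E⟩ := nonempty_localUnits (𝕜 := 𝕜) hf
  let c := E.elt x
  -- Over `f '' N` the class of `c` at a point is the point of the spectrum given by an element of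
  -- `N`, so this basic set lies in the image of `V`.
  let N : Set X := V ∩ {x | IsIndicatorAt f c.1 x}
  have hN : IsOpen N := hV.inter (isOpen_isIndicatorAt hf c)
  have hW : IsOpen (f '' N) := hf.isLocalHomeomorph.isOpenMap _ hN
  have hb : IsOpen (basicSet (sheafCoalgebra 𝕜 hf) c (f '' N)) := by
    refine TopologicalSpace.isOpen_generateFrom_of_mem
      ⟨c, f '' N, E.elt_mem_weaklyGrouplike x, hW, ?_, rfl⟩
    rintro _ ⟨x', hx', rfl⟩
    exact normalizedAt_of_isIndicatorAt hf hx'.2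
  refine Filter.mem_of_superset (hb.mem_nhds ⟨f x, ⟨x, ⟨hx, E.isIndicatorAt_elt x⟩, rfl⟩,
    (espPoint_eq_classAt_iff hf c x _).2 ⟨rfl, E.isIndicatorAt_elt x⟩⟩) ?_
  rintro p ⟨_, ⟨x', hx', rfl⟩, hp⟩
  exact ⟨x', hx'.1, Subtype.ext (((espPoint_eq_classAt_iff hf c x' _).2 ⟨rfl, hx'.2⟩).trans hp.symm)⟩

/-- The spectral sheaf of `C_c^∞(X)` is homeomorphic to `X`. -/
noncomputable def espHomeomorph (𝕜 : Type*) [RCLike 𝕜]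
    (hf : IsLocalDiffeomorph 𝓘(ℝ, B) 𝓘(ℝ, B) ∞ f) : X ≃ₜ Esp (sheafCoalgebra 𝕜 hf) :=
  (Equiv.ofBijective _ ⟨espPoint_injective hf, espPoint_surjective hf⟩).toHomeomorphOfContinuousOpen
    (continuous_espPoint hf) (isOpenMap_espPoint hf)

end SheafSpectrum

/-! ### Values of `Ω(u ⊗ v)` where a factor is zero or both are one. -/

section OmegaSection

variable {𝕜 : Type*} [RCLike 𝕜]
variable {B : Type*} [NormedAddCommGroup B] [NormedSpace ℝ B]
variable {X Y M : Type*} [TopologicalSpace X] [TopologicalSpace Y] [TopologicalSpace M]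
  [ChartedSpace B X] [ChartedSpace B Y] [ChartedSpace B M]
variable {f : X → M} (hf : IsLocalDiffeomorph 𝓘(ℝ, B) 𝓘(ℝ, B) ∞ f)
variable {g : Y → M} (hg : IsLocalDiffeomorph 𝓘(ℝ, B) 𝓘(ℝ, B) ∞ g)
variable {u : ∀ x : X, Germ (𝓝 x) 𝕜} {v : ∀ y : Y, Germ (𝓝 y) 𝕜} (q : FibreProd hf hg)

theorem omegaSection_eq_zero_left (h : u q.fst = 0) : omegaSection hf hg u v q = 0 := by
  rw [omegaSection, h]
  exact zero_mul _

theorem omegaSection_eq_zero_right (h : v q.snd = 0) : omegaSection hf hg u v q = 0 := by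
  rw [omegaSection, h]
  exact mul_zero _

theorem omegaSection_eq_one (h : u q.fst = 1) (h' : v q.snd = 1) :
    omegaSection hf hg u v q = 1 := by
  rw [omegaSection, h, h']
  exact mul_one _

end OmegaSection

/-! ### Indicators of arrows under the Hopf algebroid operations. -/

section GroupoidAlgebra

namespace IsEtaleLieGroupoid

variable {B : Type*} [NormedAddCommGroup B] [NormedSpace ℝ B]
variable {M : Type*} [TopologicalSpace M] [ChartedSpace B M]
variable {X : Type*} [TopologicalSpace X] [ChartedSpace B X]
variable {Γ : GroupoidOps M X} (hΓ : IsEtaleLieGroupoid B Γ)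

theorem mul_congr {Γ : GroupoidOps M X} {g g' h h' : X} (e : Γ.src g = Γ.tgt h)
    (e' : Γ.src g' = Γ.tgt h')
    (hg : g = g') (hh : h = h') : Γ.mul g h e = Γ.mul g' h' e' := by
  subst hg hh; rfl

include hΓ

theorem inv_mul_cancel_left (g h : X) (e : Γ.src g = Γ.tgt h) :
    Γ.mul (Γ.inv g) (Γ.mul g h e) ((hΓ.src_inv g).trans (hΓ.tgt_mul g h e).symm) = h := by
  rw [← hΓ.mul_assoc (Γ.inv g) g h (hΓ.src_inv g) e]
  refine (mul_congr _ ((hΓ.src_unit _)) ?_ rfl).trans (hΓ.unit_mul h)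
  rw [hΓ.inv_mul, e]

theorem mul_left_cancel {g h h' : X} (e : Γ.src g = Γ.tgt h) (e' : Γ.src g = Γ.tgt h')
    (hm : Γ.mul g h e = Γ.mul g h' e') : h = h' := by
  rw [← hΓ.inv_mul_cancel_left g h e, ← hΓ.inv_mul_cancel_left g h' e']
  exact mul_congr _ _ rfl hm

theorem inv_inv (g : X) : Γ.inv (Γ.inv g) = g := by
  refine hΓ.mul_left_cancel (g := Γ.inv g) (hΓ.tgt_inv _).symm (hΓ.src_inv g) ?_
  rw [hΓ.mul_inv, hΓ.inv_mul, hΓ.tgt_inv]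

theorem inv_injective : Function.Injective Γ.inv := fun g h e => by
  rw [← hΓ.inv_inv g, e, hΓ.inv_inv]

theorem unit_injective : Function.Injective Γ.unit := fun x y e => by
  rw [← hΓ.tgt_unit x, e, hΓ.tgt_unit]

end IsEtaleLieGroupoid

variable {𝕜 : Type*} [RCLike 𝕜]
variable {B : Type*} [NormedAddCommGroup B] [NormedSpace ℝ B] [FiniteDimensional ℝ B]
variable {M : Type*} [TopologicalSpace M] [ChartedSpace B M] [IsManifold 𝓘(ℝ, B) ∞ M] [T2Space M]
variable {G : EtaleLieGroupoid B M}

/-- The coalgebra part of `hopf 𝕜 G` is by definition that of the sheaf `tgt`, so the results on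
sheaves apply verbatim. -/
theorem hopf_comul_eq_tmul_iff (w u v : Cc 𝕜 B G.Arr) :
    (hopf 𝕜 G).comul w = TensorOver.tmul (hopf 𝕜 G).act (hopf 𝕜 G).act u v ↔
      DiagRel G.isEtale.tgt_loc w u v :=
  comul_eq_tmul_iff G.isEtale.tgt_loc w u v

theorem normalizedAt_hopf_of_isIndicatorAt {c : Cc 𝕜 B G.Arr} {g : G.Arr}
    (h : IsIndicatorAt G.ops.tgt c.1 g) :
    NormalizedAt (hopf 𝕜 G).toCoalgebraOps c (G.ops.tgt g) :=
  normalizedAt_of_isIndicatorAt G.isEtale.tgt_loc h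

theorem exists_isIndicatorAt_of_invariant {a : Cc 𝕜 B G.Arr}
    (ha : a ∈ invariantWeaklyGrouplike (hopf 𝕜 G)) {y : M}
    (hn : NormalizedAt (hopf 𝕜 G).toCoalgebraOps a y) :
    ∃ g, G.ops.tgt g = y ∧ IsIndicatorAt G.ops.tgt a.1 g := by
  obtain ⟨a', h, -⟩ := ha
  obtain ⟨g, hg, h1, -⟩ := exists_isIndicatorAt_of_diagRel G.isEtale.tgt_loc
    ((hopf_comul_eq_tmul_iff _ _ _).1 h) hn
  exact ⟨g, hg, h1⟩

theorem antipode_apply (u : Cc 𝕜 B G.Arr) {g k : G.Arr} (h : G.ops.inv g = k) :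
    ((hopf 𝕜 G).antipode u).1 k = germPush G.isEtale.inv_loc.isLocalHomeomorph h (u.1 g) := by
  refine finsum_eq_single _ (⟨g, h⟩ : {g' // G.ops.inv g' = k}) fun g' hg' => ?_
  exact (hg' (Subtype.ext (G.isEtale.inv_injective (g'.2.trans h.symm)))).elim

/-- The antipode of an `S`-invariant weakly grouplike element represents the inverse arrow. -/
theorem isIndicatorAt_antipode {a : Cc 𝕜 B G.Arr}
    (ha : a ∈ invariantWeaklyGrouplike (hopf 𝕜 G)) {g : G.Arr}
    (hg : IsIndicatorAt G.ops.tgt a.1 g) :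
    IsIndicatorAt G.ops.tgt ((hopf 𝕜 G).antipode a).1 (G.ops.inv g) := by
  obtain ⟨a', h, h'⟩ := ha
  obtain ⟨g', hg', h1, h2⟩ := exists_isIndicatorAt_of_diagRel G.isEtale.tgt_loc
    ((hopf_comul_eq_tmul_iff _ _ _).1 h) (normalizedAt_hopf_of_isIndicatorAt hg)
  obtain rfl : g' = g := h1.unique hg hg'
  refine ⟨by rw [antipode_apply a rfl, hg.1, germPush_one], fun k hk hne => ?_⟩
  -- `S(a')` has germ one at the inverse arrow, so orthogonality of `S(a')` and `S(a)` forces `S(a)`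
  -- to vanish at every other arrow with the same target.
  have := ((hopf_comul_eq_tmul_iff _ _ _).1 h').2 _ (G.ops.inv g') k rfl hk hne.symm
  rwa [antipode_apply a' rfl, h2.1, germPush_one, germPush_one, one_mul, germPush_eq_zero] at this

/-- Injectivity of the target on `U` gives the condition on `a`. Inversion exchanges source and
target, so injectivity of the source gives the condition on `S(a)`. -/
theorem liftElt_mem_invariantWeaklyGrouplike {U : Set G.Arr} (hU : IsOpen U)
    (hinj : InjOn G.ops.tgt U) (hsrc : InjOn G.ops.src U) {χ : BaseAlg 𝕜 B M}
    (hχ : tsupport χ.1 ⊆ G.ops.tgt '' U) :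
    liftElt G hU hinj χ hχ ∈ invariantWeaklyGrouplike (hopf 𝕜 G) := by
  obtain ⟨χ', h, hχ'⟩ := exists_baseAlg_eq_one_on_subset (𝕜 := 𝕜) (B := B) χ.2.2
    (G.isEtale.tgt_loc.isLocalHomeomorph.isOpenMap _ hU) hχ
  have hd : DiagRel G.isEtale.tgt_loc (liftElt G hU hinj χ hχ) (liftElt G hU hinj χ hχ)
      (liftElt G hU hinj χ' hχ') :=
    diagRel_lift G.isEtale.tgt_loc hU hinj hχ hχ' fun y hy => (h y hy).self_of_nhds
  refine ⟨liftElt G hU hinj χ' hχ', (hopf_comul_eq_tmul_iff _ _ _).2 hd,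
    (hopf_comul_eq_tmul_iff _ _ _).2 ⟨fun k => ?_, fun y k k' hk hk' hne => ?_⟩⟩
  · rw [antipode_apply _ (G.isEtale.inv_inv k), antipode_apply _ (G.isEtale.inv_inv k),
      ← germPush_mul, mul_comm, ← hd.1]
  · rw [antipode_apply _ (G.isEtale.inv_inv k), antipode_apply _ (G.isEtale.inv_inv k')]
    change germPush _ _ (germPush _ _ (extZero U (χ'.1 ∘ G.ops.tgt) _)) *
      germPush _ _ (germPush _ _ (extZero U (χ.1 ∘ G.ops.tgt) _)) = 0
    by_cases h1 : G.ops.inv k ∈ U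
    · have h2 : G.ops.inv k' ∉ U := fun h2 => hne <| G.isEtale.inv_injective <| hsrc h1 h2 <| by
        rw [G.isEtale.src_inv, G.isEtale.src_inv, hk, hk']
      rw [extZero_of_notMem _ h2, germPush_zero, germPush_zero, mul_zero]
    · rw [extZero_of_notMem _ h1, germPush_zero, germPush_zero, zero_mul]

theorem exists_invariant_isIndicatorAt (𝕜 : Type*) [RCLike 𝕜] (g : G.Arr) :
    ∃ a ∈ invariantWeaklyGrouplike (hopf 𝕜 G), IsIndicatorAt G.ops.tgt a.1 g := by
  obtain ⟨V, hV, hgV, hinj⟩ := exists_injOn G.isEtale.tgt_loc.isLocalHomeomorph g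
  obtain ⟨V', hV', hgV', hinj'⟩ := exists_injOn G.isEtale.src_loc.isLocalHomeomorph g
  have hU := hV.inter hV'
  obtain ⟨χ, h1, hχ⟩ := exists_baseAlg_bump (𝕜 := 𝕜) (B := B)
    ((G.isEtale.tgt_loc.isLocalHomeomorph.isOpenMap _ hU).mem_nhds
      (mem_image_of_mem G.ops.tgt ⟨hgV, hgV'⟩))
  exact ⟨_, liftElt_mem_invariantWeaklyGrouplike hU (hinj _ inter_subset_left)
    (hinj' _ inter_subset_right) hχ, isIndicatorAt_extZero (hinj _ inter_subset_left)
    G.isEtale.tgt_loc.isLocalHomeomorph.continuous ⟨hgV, hgV'⟩ h1⟩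

theorem isIndicatorAt_incl {y : M} {p : BaseAlg 𝕜 B M} (hp : ∀ᶠ z in 𝓝 y, p.1 z = 1) :
    IsIndicatorAt G.ops.tgt ((hopf 𝕜 G).incl p).1 (G.ops.unit y) := by
  constructor
  · have : ((hopf 𝕜 G).incl p).1 (G.ops.unit y) =
        germPush G.isEtale.unit_loc.isLocalHomeomorph rfl ((ofBase p).1 y) := by
      refine finsum_eq_single _ (⟨y, rfl⟩ : {z // G.ops.unit z = G.ops.unit y}) fun z hz => ?_
      exact (hz (Subtype.ext (G.isEtale.unit_injective z.2))).elim
    have h1 : (ofBase p).1 y = 1 := (extZero_of_mem _ (mem_univ y)).trans (Germ.coe_eq.2 hp)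
    rw [this, h1, germPush_one]
  · intro k hk hne
    rw [G.isEtale.tgt_unit] at hk
    have : IsEmpty {z // G.ops.unit z = k} := by
      refine ⟨fun ⟨z, hz⟩ => hne ?_⟩
      rw [← hz, G.isEtale.tgt_unit] at hk
      rw [← hz, hk]
    exact finsum_of_isEmpty _

/-- In the convolution over the target of `g`, a pair `(g', h')` contributes only if `g' = g`, by
the property of `b`; then `h'` has the same target as `h`, so `h' = h` by the property of `a`. -/
theorem isIndicatorAt_mul {b a : Cc 𝕜 B G.Arr} {g h : G.Arr} (e : G.ops.src g = G.ops.tgt h)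
    (hb : IsIndicatorAt G.ops.tgt b.1 g) (ha : IsIndicatorAt G.ops.tgt a.1 h) :
    IsIndicatorAt G.ops.tgt ((hopf 𝕜 G).mul b a).1 (G.ops.mul g h e) := by
  have key : ∀ q : FibreProd G.isEtale.src_loc G.isEtale.tgt_loc,
      G.ops.tgt q.fst = G.ops.tgt g → q ≠ ⟨g, h, e⟩ →
      omegaSection G.isEtale.src_loc G.isEtale.tgt_loc b.1 a.1 q = 0 := by
    rintro ⟨g', h', e'⟩ hq hne
    by_cases hg : g' = g
    · subst hg
      have hh : h' ≠ h := fun hh => hne (FibreProd.ext rfl hh)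
      exact omegaSection_eq_zero_right _ _ _ (ha.2 h' (e'.symm.trans e) hh)
    · exact omegaSection_eq_zero_left _ _ _ (hb.2 g' hq hg)
  have hloc := G.isEtale.mul_loc.isLocalHomeomorph
  constructor
  · have : ((hopf 𝕜 G).mul b a).1 (G.ops.mul g h e) =
        germPush hloc (y := ⟨g, h, e⟩) rfl
          (omegaSection G.isEtale.src_loc G.isEtale.tgt_loc b.1 a.1 ⟨g, h, e⟩) := by
      refine finsum_eq_single _ (⟨⟨g, h, e⟩, rfl⟩ :
        {q : FibreProd G.isEtale.src_loc G.isEtale.tgt_loc //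
          G.ops.mul q.fst q.snd q.comm = G.ops.mul g h e}) fun q hq => ?_
      have h0 := key q.1 (by rw [← G.isEtale.tgt_mul _ _ q.1.comm, q.2, G.isEtale.tgt_mul])
        fun h => hq (Subtype.ext h)
      exact (congrArg _ h0).trans (germPush_zero hloc q.2)
    rw [this]
    have h1 : omegaSection G.isEtale.src_loc G.isEtale.tgt_loc b.1 a.1 ⟨g, h, e⟩ = 1 :=
      omegaSection_eq_one _ _ _ hb.1 ha.1
    rw [h1]
    exact germPush_one hloc (x := ⟨g, h, e⟩) rfl
  · intro k hk hne
    refine (finsum_congr fun q => ?_).trans finsum_zero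
    have hq2 : G.ops.mul q.1.fst q.1.snd q.1.comm = k := q.2
    have h0 := key q.1 (by
      rw [← G.isEtale.tgt_mul _ _ q.1.comm, hq2, hk, G.isEtale.tgt_mul])
      (by rintro hq; exact hne (q.2.symm.trans (by rw [hq])))
    exact (congrArg _ h0).trans (germPush_zero hloc q.2)

theorem isIndicatorAt_pushforward {G H : EtaleLieGroupoid B M} {φ : G.Arr → H.Arr}
    (hφ : IsGroupoidMorphism B G.ops H.ops φ) {c : Cc 𝕜 B G.Arr} {g : G.Arr}
    (hc : IsIndicatorAt G.ops.tgt c.1 g) :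
    IsIndicatorAt H.ops.tgt (pushforward hφ.isLocalDiffeomorph c).1 (φ g) := by
  constructor
  · have : (pushforward hφ.isLocalDiffeomorph c).1 (φ g) =
        germPush hφ.isLocalDiffeomorph.isLocalHomeomorph rfl (c.1 g) := by
      refine finsum_eq_single _ (⟨g, rfl⟩ : {g' // φ g' = φ g}) fun g' hg' => ?_
      rw [hc.2 g'.1 (by rw [← hφ.tgt_eq, g'.2, hφ.tgt_eq]) fun h => hg' (Subtype.ext h),
        germPush_zero]
    rw [this, hc.1, germPush_one]
  · intro k hk hne
    refine (finsum_congr fun g' => ?_).trans finsum_zero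
    rw [hc.2 g'.1 (by rw [← hφ.tgt_eq, g'.2, hk, hφ.tgt_eq])
      (by rintro h; exact hne (by rw [← g'.2, h])), germPush_zero]

end GroupoidAlgebra

/-! ### Partial diffeomorphisms of `M` and extension by zero. -/

section Transition

variable {𝕜 : Type*} [RCLike 𝕜]
variable {B : Type*} [NormedAddCommGroup B] [NormedSpace ℝ B]
variable {X M : Type*} [TopologicalSpace X] [ChartedSpace B X] [TopologicalSpace M]
  [ChartedSpace B M]

/-- An open subset on which two local diffeomorphisms `f` and `s` are injective induces a partial
diffeomorphism between its images. -/
theorem exists_openPartialHomeomorph {f s : X → M}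
    (hf : IsLocalDiffeomorph 𝓘(ℝ, B) 𝓘(ℝ, B) ∞ f) (hs : IsLocalDiffeomorph 𝓘(ℝ, B) 𝓘(ℝ, B) ∞ s)
    {O : Set X} (hO : IsOpen O) (hfi : InjOn f O) (hsi : InjOn s O) :
    ∃ τ : OpenPartialHomeomorph M M, τ.source = s '' O ∧ τ.target = f '' O ∧
      (∀ x ∈ O, τ (s x) = f x) ∧ (∀ x ∈ O, τ.symm (f x) = s x) ∧
      ContMDiffOn 𝓘(ℝ, B) 𝓘(ℝ, B) ∞ τ τ.source ∧
      ContMDiffOn 𝓘(ℝ, B) 𝓘(ℝ, B) ∞ τ.symm τ.target := by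
  obtain hE | hE := isEmpty_or_nonempty X
  · refine ⟨OpenPartialHomeomorph.ofSet ∅ isOpen_empty, ?_, ?_, fun x => (hE.false x).elim,
      fun x => (hE.false x).elim, fun x hx => hx.elim, fun x hx => hx.elim⟩ <;>
    simp [O.eq_empty_of_isEmpty]
  have key : ∀ {f s : X → M} (_ : IsLocalDiffeomorph 𝓘(ℝ, B) 𝓘(ℝ, B) ∞ f)
      (_ : IsLocalDiffeomorph 𝓘(ℝ, B) 𝓘(ℝ, B) ∞ s) (_ : InjOn s O),
      ContMDiffOn 𝓘(ℝ, B) 𝓘(ℝ, B) ∞ (f ∘ Function.invFunOn s O) (s '' O) := by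
    rintro f s hf hs hsi _ ⟨x, hx, rfl⟩
    exact ((hf.contMDiff _).comp _ (contMDiffAt_leftInv hs hO
      (fun y hy => hsi.leftInvOn_invFunOn hy) hx)).contMDiffWithinAt
  have e1 : ∀ x ∈ O, Function.invFunOn s O (s x) = x := fun x hx => hsi.leftInvOn_invFunOn hx
  have e2 : ∀ x ∈ O, Function.invFunOn f O (f x) = x := fun x hx => hfi.leftInvOn_invFunOn hx
  refine ⟨{ toFun := f ∘ Function.invFunOn s O
            invFun := s ∘ Function.invFunOn f O
            source := s '' O
            target := f '' O
            map_source' := ?_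
            map_target' := ?_
            left_inv' := ?_
            right_inv' := ?_
            open_source := hs.isLocalHomeomorph.isOpenMap _ hO
            open_target := hf.isLocalHomeomorph.isOpenMap _ hO
            continuousOn_toFun := (key hf hs hsi).continuousOn
            continuousOn_invFun := (key hs hf hfi).continuousOn }, rfl, rfl, ?_, ?_,
            key hf hs hsi, key hs hf hfi⟩
  · rintro _ ⟨x, hx, rfl⟩
    exact ⟨x, hx, by rw [Function.comp_apply, e1 x hx]⟩
  · rintro _ ⟨x, hx, rfl⟩
    exact ⟨x, hx, by rw [Function.comp_apply, e2 x hx]⟩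
  · rintro _ ⟨x, hx, rfl⟩
    rw [Function.comp_apply, Function.comp_apply, e1 x hx, e2 x hx]
  · rintro _ ⟨x, hx, rfl⟩
    rw [Function.comp_apply, Function.comp_apply, e2 x hx, e1 x hx]
  · intro x hx
    change f (Function.invFunOn s O (s x)) = f x
    rw [e1 x hx]
  · intro x hx
    change s (Function.invFunOn f O (f x)) = s x
    rw [e2 x hx]

/-- Extension by zero of a function with compact support on an open subset. -/
theorem exists_baseAlg_of_contMDiffOn [T2Space M] {V K : Set M} {a : M → 𝕜} (hV : IsOpen V)
    (hK : IsCompact K) (hKV : K ⊆ V) (ha : ContMDiffOn 𝓘(ℝ, B) 𝓘(ℝ, 𝕜) ∞ a V)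
    (h0 : ∀ x ∈ V, x ∉ K → a x = 0) :
    ∃ p : BaseAlg 𝕜 B M, EqOn p.1 a V ∧ tsupport p.1 ⊆ K := by
  have hE : extZero V a ∈ Cc 𝕜 B M := extZero_mem hV inferInstance ⟨ha, K, hKV, hK, h0⟩
  have hin : EqOn (toBase ⟨_, hE⟩).1 a V := fun x hx => by
    change (extZero V a x).value = a x
    rw [extZero_of_mem _ hx]; rfl
  refine ⟨toBase ⟨_, hE⟩, hin, closure_minimal (fun x hx => ?_) hK.isClosed⟩
  by_contra hxK
  refine hx ?_
  by_cases hxV : x ∈ V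
  · rw [hin hxV, h0 x hxV hxK]
  · change (extZero V a x).value = 0
    rw [extZero_of_notMem _ hxV]; rfl

end Transition

/-! ### The partial diffeomorphism `τ` of an invariant element. -/

section Tau

variable {𝕜 : Type*} [RCLike 𝕜]
variable {B : Type*} [NormedAddCommGroup B] [NormedSpace ℝ B] [FiniteDimensional ℝ B]
variable {M : Type*} [TopologicalSpace M] [ChartedSpace B M] [IsManifold 𝓘(ℝ, B) ∞ M] [T2Space M]
variable {G : EtaleLieGroupoid B M} {a : Cc 𝕜 B G.Arr}
  (ha : a ∈ invariantWeaklyGrouplike (hopf 𝕜 G))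

theorem antipode_act_apply (f : BaseAlg 𝕜 B M) (a : Cc 𝕜 B G.Arr) {g k : G.Arr}
    (h : G.ops.inv g = k) :
    ((hopf 𝕜 G).antipode ((hopf 𝕜 G).act f a)).1 k =
      germPush G.isEtale.inv_loc.isLocalHomeomorph h
        (((f.1 ∘ G.ops.tgt : G.Arr → 𝕜) : Germ (𝓝 g) 𝕜) * a.1 g) :=
  antipode_apply _ h

theorem opT_apply (f : BaseAlg 𝕜 B M) (a : Cc 𝕜 B G.Arr) (x : M) :
    (opT (hopf 𝕜 G) a f).1 x = (∑ᶠ k : {k // G.ops.tgt k = x},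
      germPush G.isEtale.tgt_loc.isLocalHomeomorph k.2
        (((hopf 𝕜 G).antipode ((hopf 𝕜 G).act f a)).1 k.1)).value := rfl

include ha in
-- Over the source of `g`, `S(a)` is the indicator of the inverse arrow. Hence `S(fa)` has only that
-- germ there, and its value is the value of `f` at the target of `g`.
theorem opT_apply_src {g : G.Arr} (hg : IsIndicatorAt G.ops.tgt a.1 g) (f : BaseAlg 𝕜 B M) :
    (opT (hopf 𝕜 G) a f).1 (G.ops.src g) = f.1 (G.ops.tgt g) := by
  rw [opT_apply, finsum_eq_single _ (⟨G.ops.inv g, G.isEtale.tgt_inv g⟩ :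
    {k // G.ops.tgt k = G.ops.src g}), germPush_value, antipode_act_apply f a rfl, germPush_value,
    hg.1, mul_one]
  · rfl
  · rintro ⟨k, hk⟩ hne
    have h := (isIndicatorAt_antipode ha hg).2 k (hk.trans (G.isEtale.tgt_inv g).symm)
      fun h => hne (Subtype.ext h)
    rw [antipode_apply a (G.isEtale.inv_inv k), germPush_eq_zero] at h
    rw [antipode_act_apply f a (G.isEtale.inv_inv k), h, mul_zero, germPush_zero, germPush_zero]

include ha in
-- For `k` over `x`, the germ of `f a` at the inverse of `k` vanishes: over `W`, `a` is the
-- indicator of another arrow, and outside `W` the germ of `f` is zero.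
theorem opT_apply_eq_zero {W : Set M}
    (hW : ∀ y ∈ W, NormalizedAt (hopf 𝕜 G).toCoalgebraOps a y) {f : BaseAlg 𝕜 B M}
    (hf : tsupport f.1 ⊆ W) {x : M}
    (hx : ∀ g, G.ops.tgt g ∈ W → IsIndicatorAt G.ops.tgt a.1 g → G.ops.src g ≠ x) :
    (opT (hopf 𝕜 G) a f).1 x = 0 := by
  rw [opT_apply, finsum_congr (g := fun _ => 0), finsum_zero]
  · rfl
  rintro ⟨k, hk⟩
  rw [antipode_act_apply f a (G.isEtale.inv_inv k)]
  by_cases h : G.ops.tgt (G.ops.inv k) ∈ W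
  · obtain ⟨g, hg, hag⟩ := exists_isIndicatorAt_of_invariant ha (hW _ h)
    have hne : G.ops.inv k ≠ g := by
      rintro rfl
      exact hx _ h hag (by rw [G.isEtale.src_inv, hk])
    rw [hag.2 _ hg.symm hne, mul_zero, germPush_zero, germPush_zero]
  · rw [germ_comp_eq_zero G.isEtale.tgt_loc.isLocalHomeomorph.continuous
      (notMem_tsupport_iff_eventuallyEq.1 fun h' => h (hf h')), zero_mul, germPush_zero,
      germPush_zero]

include ha in
-- Let `O` be the set of arrows over `W` at which `a` is an indicator. It is open, target and source
-- are injective on it, and its target image is `W`; `τ` is the target composed with the inverse of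
-- the source on `O`.
theorem exists_isTau {W : Set M} (hWo : IsOpen W)
    (hW : ∀ y ∈ W, NormalizedAt (hopf 𝕜 G).toCoalgebraOps a y) : ∃ τ, IsTau (hopf 𝕜 G) a W τ := by
  let O : Set G.Arr := G.ops.tgt ⁻¹' W ∩ {g | IsIndicatorAt G.ops.tgt a.1 g}
  have hO : IsOpen O := (hWo.preimage G.isEtale.tgt_loc.isLocalHomeomorph.continuous).inter
    (isOpen_isIndicatorAt G.isEtale.tgt_loc a)
  have hti : InjOn G.ops.tgt O := fun g hg h hh e => hg.2.unique hh.2 e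
  -- Two arrows of `O` with equal source have inverses with equal target, and `S(a)` is an indicator
  -- at both.
  have hsi : InjOn G.ops.src O := fun g hg h hh e => G.isEtale.inv_injective <|
    (isIndicatorAt_antipode ha hg.2).unique (isIndicatorAt_antipode ha hh.2) <| by
      rw [G.isEtale.tgt_inv, G.isEtale.tgt_inv, e]
  have hOW : G.ops.tgt '' O = W := by
    ext y
    constructor
    · rintro ⟨g, hg, rfl⟩; exact hg.1
    · intro hy
      obtain ⟨g, rfl, h⟩ := exists_isIndicatorAt_of_invariant ha (hW y hy)
      exact ⟨g, ⟨hy, h⟩, rfl⟩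
  obtain ⟨τ, hs, ht, h1, h2, h3, h4⟩ :=
    exists_openPartialHomeomorph G.isEtale.tgt_loc G.isEtale.src_loc hO hti hsi
  have hout : ∀ f : BaseAlg 𝕜 B M, tsupport f.1 ⊆ W → ∀ x ∉ τ.source,
      (opT (hopf 𝕜 G) a f).1 x = 0 := by
    intro f hf x hx
    refine opT_apply_eq_zero ha hW hf fun g hg hag e => hx ?_
    rw [hs]
    exact ⟨g, ⟨hg, hag⟩, e⟩
  have hin : ∀ f : BaseAlg 𝕜 B M, ∀ x ∈ τ.source, (opT (hopf 𝕜 G) a f).1 x = f.1 (τ x) := by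
    intro f x hx
    rw [hs] at hx
    obtain ⟨g, hg, rfl⟩ := hx
    rw [h1 g hg, opT_apply_src ha hg.2]
  have htW : τ.target = W := ht.trans hOW
  refine ⟨τ, htW, h3, h4, ?_, fun f _ x hx => hin f x hx⟩
  ext q
  constructor
  · rintro ⟨f, hf, rfl⟩
    have hf' : tsupport f.1 ⊆ τ.target := hf.trans htW.symm.subset
    have hK : IsCompact (τ.symm '' tsupport f.1) :=
      f.2.2.isCompact.image_of_continuousOn (τ.continuousOn_symm.mono hf')
    have hKs : τ.symm '' tsupport f.1 ⊆ τ.source := by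
      rintro _ ⟨y, hy, rfl⟩
      exact τ.map_target (hf' hy)
    refine (closure_minimal ?_ hK.isClosed).trans hKs
    intro x hx
    by_cases hxs : x ∈ τ.source
    · rw [Function.mem_support, hin f x hxs] at hx
      exact ⟨τ x, subset_closure hx, τ.left_inv hxs⟩
    · exact (hx (hout f hf x hxs)).elim
  · intro hq
    have hq' : tsupport q.1 ⊆ τ.source := hq
    -- The preimage of `q` under the operator is `q ∘ τ⁻¹`, extended by zero.
    obtain ⟨p, hp, hpK⟩ := exists_baseAlg_of_contMDiffOn (𝕜 := 𝕜) (B := B) (V := τ.target)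
      (K := τ '' tsupport q.1) (a := q.1 ∘ τ.symm) τ.open_target
      (q.2.2.isCompact.image_of_continuousOn (τ.continuousOn.mono hq'))
      (by rintro _ ⟨x, hx, rfl⟩; exact τ.map_source (hq' hx))
      (q.2.1.comp_contMDiffOn h4) (by
        intro y hy hyK
        by_contra h
        exact hyK ⟨τ.symm y, subset_closure h, τ.right_inv hy⟩)
    have hpW : tsupport p.1 ⊆ W := by
      refine hpK.trans ?_
      rintro _ ⟨x, hx, rfl⟩
      rw [← htW]
      exact τ.map_source (hq' hx)
    refine ⟨p, hpW, Subtype.ext (funext fun x => ?_)⟩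
    by_cases hxs : x ∈ τ.source
    · rw [hin p x hxs, hp (τ.map_source hxs), Function.comp_apply, τ.left_inv hxs]
    · rw [hout p hpW x hxs, image_eq_zero_of_notMem_tsupport fun h => hxs (hq' h)]

include ha in
-- The properties in `IsTau` determine `τ`, since bump functions separate the points of `M`; thus
-- every admissible `τ` gives the source of the arrow.
theorem isTau_symm_apply {W : Set M} (hWo : IsOpen W)
    (hW : ∀ y ∈ W, NormalizedAt (hopf 𝕜 G).toCoalgebraOps a y) {τ : OpenPartialHomeomorph M M}
    (hτ : IsTau (hopf 𝕜 G) a W τ) {g : G.Arr} (hgW : G.ops.tgt g ∈ W)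
    (hg : IsIndicatorAt G.ops.tgt a.1 g) : τ.symm (G.ops.tgt g) = G.ops.src g := by
  have hy : G.ops.tgt g ∈ τ.target := hτ.target_eq.symm ▸ hgW
  set x := τ.symm (G.ops.tgt g) with hx
  have hxs : x ∈ τ.source := τ.map_target hy
  have hτx : τ x = G.ops.tgt g := τ.right_inv hy
  -- Otherwise the operator would send every function supported in `W` to a function vanishing at
  -- `x`, against a bump function at the target of `g`.
  have hmem : ∃ g', G.ops.tgt g' ∈ W ∧ IsIndicatorAt G.ops.tgt a.1 g' ∧ G.ops.src g' = x := by
    by_contra! h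
    obtain ⟨f, hf1, hfW⟩ := exists_baseAlg_bump (𝕜 := 𝕜) (B := B) (hWo.mem_nhds hgW)
    have h1 := hτ.apply_eq f hfW x hxs
    rw [hτx, hf1.self_of_nhds, opT_apply_eq_zero ha hW hfW h] at h1
    exact zero_ne_one h1
  obtain ⟨g', hg'W, hg', hsx⟩ := hmem
  -- Otherwise a bump function at one target, supported away from the other, would take the value
  -- one at both.
  have htt : G.ops.tgt g = G.ops.tgt g' := by
    by_contra hne
    obtain ⟨f, hf1, hfW⟩ := exists_baseAlg_bump (𝕜 := 𝕜) (B := B)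
      ((hWo.inter isOpen_compl_singleton).mem_nhds (show G.ops.tgt g ∈ W ∩ {G.ops.tgt g'}ᶜ from
        ⟨hgW, hne⟩))
    have h1 := hτ.apply_eq f (hfW.trans inter_subset_left) x hxs
    rw [hτx, hf1.self_of_nhds, ← hsx, opT_apply_src ha hg'] at h1
    have h2 : G.ops.tgt g' ∈ tsupport f.1 := subset_closure (by
      rw [Function.mem_support, h1]; exact one_ne_zero)
    exact (hfW h2).2 rfl
  rw [← hsx, hg.unique hg' htt]

end Tau

/-! ### The groupoid structure transported to the spectrum. -/

section Spectrum

variable (𝕜 : Type*) [RCLike 𝕜]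
variable {B : Type*} [NormedAddCommGroup B] [NormedSpace ℝ B] [FiniteDimensional ℝ B]
variable {M : Type*} [TopologicalSpace M] [ChartedSpace B M] [IsManifold 𝓘(ℝ, B) ∞ M] [T2Space M]
variable (G : EtaleLieGroupoid B M)

theorem espPoint_mem_arrows (g : G.Arr) : espPoint 𝕜 G.isEtale.tgt_loc g ∈ arrows (hopf 𝕜 G) := by
  obtain ⟨a, ha, hag⟩ := exists_invariant_isIndicatorAt 𝕜 g
  exact ⟨a, ha, normalizedAt_hopf_of_isIndicatorAt hag,
    (espPoint_eq_classAt_iff G.isEtale.tgt_loc a g _).2 ⟨rfl, hag⟩⟩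

/-- The homeomorphism from `G` to the spectral étale groupoid of `C_c^∞(G)`. -/
noncomputable def gspHomeomorph : G.Arr ≃ₜ Gsp (hopf 𝕜 G) where
  toFun g := ⟨espPoint 𝕜 G.isEtale.tgt_loc g, espPoint_mem_arrows 𝕜 G g⟩
  invFun ζ := (espHomeomorph 𝕜 G.isEtale.tgt_loc).symm ζ.1
  left_inv g := (espHomeomorph 𝕜 G.isEtale.tgt_loc).symm_apply_apply g
  right_inv ζ := Subtype.ext ((espHomeomorph 𝕜 G.isEtale.tgt_loc).apply_symm_apply ζ.1)
  continuous_toFun := (continuous_espPoint G.isEtale.tgt_loc).subtype_mk _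
  continuous_invFun := (espHomeomorph 𝕜 G.isEtale.tgt_loc).symm.continuous.comp
    continuous_subtype_val

variable {G}

theorem gspHomeomorph_eq_classAt_iff (g : G.Arr) (c : Cc 𝕜 B G.Arr) (y : M) :
    (gspHomeomorph 𝕜 G g).1.1 = classAt (hopf 𝕜 G).toCoalgebraOps c y ↔
      G.ops.tgt g = y ∧ IsIndicatorAt G.ops.tgt c.1 g :=
  espPoint_eq_classAt_iff G.isEtale.tgt_loc c g y

theorem eq_classAt_iff (ζ : Gsp (hopf 𝕜 G)) (c : Cc 𝕜 B G.Arr) (y : M) :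
    ζ.1.1 = classAt (hopf 𝕜 G).toCoalgebraOps c y ↔
      G.ops.tgt ((gspHomeomorph 𝕜 G).symm ζ) = y ∧
        IsIndicatorAt G.ops.tgt c.1 ((gspHomeomorph 𝕜 G).symm ζ) := by
  rw [← gspHomeomorph_eq_classAt_iff, Homeomorph.apply_symm_apply]

theorem tgt_gspHomeomorph_symm (ζ : Gsp (hopf 𝕜 G)) :
    G.ops.tgt ((gspHomeomorph 𝕜 G).symm ζ) = ζ.proj := by
  obtain ⟨g, rfl⟩ := (gspHomeomorph 𝕜 G).surjective ζ
  rw [Homeomorph.symm_apply_apply]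
  rfl

variable (G)

/-- The groupoid structure of the spectral étale groupoid of `C_c^∞(G)`. -/
noncomputable def spectralOps : GroupoidOps M (Gsp (hopf 𝕜 G)) where
  src ζ := G.ops.src ((gspHomeomorph 𝕜 G).symm ζ)
  tgt ζ := G.ops.tgt ((gspHomeomorph 𝕜 G).symm ζ)
  unit y := gspHomeomorph 𝕜 G (G.ops.unit y)
  inv ζ := gspHomeomorph 𝕜 G (G.ops.inv ((gspHomeomorph 𝕜 G).symm ζ))
  mul ζ ξ h := gspHomeomorph 𝕜 G
    (G.ops.mul ((gspHomeomorph 𝕜 G).symm ζ) ((gspHomeomorph 𝕜 G).symm ξ) h)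

/-- By `eq_classAt_iff` the representatives of an arrow are the indicators of the corresponding
arrow of `G`, so the formulas hold for all representatives and reduce to the statements on
indicators. -/
theorem isSpectralGroupoid_spectralOps :
    IsSpectralGroupoid (hopf 𝕜 G) (spectralOps 𝕜 G) where
  tgt_eq ζ := tgt_gspHomeomorph_symm 𝕜 ζ
  src_eq a ha W hWo hW := by
    refine ⟨exists_isTau ha hWo hW, fun τ hτ ζ y hy hζ => ?_⟩
    obtain ⟨rfl, hg⟩ := (eq_classAt_iff 𝕜 ζ a y).1 hζ
    exact (isTau_symm_apply ha hWo hW hτ hy hg).symm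
  unit_eq y f hf := (gspHomeomorph_eq_classAt_iff 𝕜 _ _ _).2
    ⟨G.isEtale.tgt_unit y, isIndicatorAt_incl hf⟩
  inv_eq ζ a ha y _ hζ := (gspHomeomorph_eq_classAt_iff 𝕜 _ _ _).2
    ⟨G.isEtale.tgt_inv _, isIndicatorAt_antipode ha ((eq_classAt_iff 𝕜 ζ a y).1 hζ).2⟩
  mul_eq ζ ξ h b _ z _ hζ a _ y _ hξ := by
    obtain ⟨hz, hb⟩ := (eq_classAt_iff 𝕜 ζ b z).1 hζ
    obtain ⟨-, ha⟩ := (eq_classAt_iff 𝕜 ξ a y).1 hξ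
    exact (gspHomeomorph_eq_classAt_iff 𝕜 _ _ _).2
      ⟨(G.isEtale.tgt_mul _ _ h).trans hz, isIndicatorAt_mul h hb ha⟩

end Spectrum

/-! ### Uniqueness of the groupoid structure. -/

section Uniqueness

variable {𝕜 : Type*} [RCLike 𝕜]
variable {B : Type*} [NormedAddCommGroup B] [NormedSpace ℝ B] [FiniteDimensional ℝ B]
variable {M : Type*} [TopologicalSpace M] [ChartedSpace B M] [IsManifold 𝓘(ℝ, B) ∞ M] [T2Space M]
variable {A : Type*} [AddCommGroup A] [Module 𝕜 A] {𝒜 : HopfAlgebroidOps 𝕜 B M A}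

/-- The formulas determine the groupoid structure of a spectral étale groupoid. -/
theorem IsSpectralGroupoid.unique {Γ Γ' : GroupoidOps M (Gsp 𝒜)} (h : IsSpectralGroupoid 𝒜 Γ)
    (h' : IsSpectralGroupoid 𝒜 Γ') : Γ = Γ' := by
  have htgt : Γ.tgt = Γ'.tgt := funext fun ζ => (h.tgt_eq ζ).trans (h'.tgt_eq ζ).symm
  have hsrc : Γ.src = Γ'.src := by
    funext ζ
    obtain ⟨a, ha, hn, hζ⟩ := ζ.2
    -- Being normalized is an open condition on the point, which supplies the open set `W` required
    -- by `src_eq`.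
    obtain ⟨W, hW, hWo, hyW⟩ := eventually_nhds_iff.1 (eventually_eventually_nhds.2 hn)
    obtain ⟨⟨τ, hτ⟩, hs⟩ := h.src_eq a ha W hWo hW
    rw [hs τ hτ ζ _ hyW hζ, (h'.src_eq a ha W hWo hW).2 τ hτ ζ _ hyW hζ]
  have hunit : Γ.unit = Γ'.unit := by
    funext y
    obtain ⟨f, hf⟩ := exists_baseAlg_eq_one (𝕜 := 𝕜) (B := B) y
    exact Subtype.ext (Subtype.ext ((h.unit_eq y f hf).trans (h'.unit_eq y f hf).symm))
  have hinv : Γ.inv = Γ'.inv := by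
    funext ζ
    obtain ⟨a, ha, hn, hζ⟩ := ζ.2
    refine Subtype.ext (Subtype.ext ?_)
    rw [h.inv_eq ζ a ha _ hn hζ, h'.inv_eq ζ a ha _ hn hζ, hsrc]
  -- The composability proofs `e` and `e'` refer to different structures until sources and targets
  -- are identified.
  have hmul : ∀ ζ ξ e e', Γ.mul ζ ξ e = Γ'.mul ζ ξ e' := by
    intro ζ ξ e e'
    obtain ⟨b, hb, hbn, hζ⟩ := ζ.2
    obtain ⟨a, ha, han, hξ⟩ := ξ.2
    refine Subtype.ext (Subtype.ext ?_)
    rw [h.mul_eq ζ ξ e b hb _ hbn hζ a ha _ han hξ, h'.mul_eq ζ ξ e' b hb _ hbn hζ a ha _ han hξ]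
  obtain ⟨src, tgt, unit, inv, mul⟩ := Γ
  obtain ⟨src', tgt', unit', inv', mul'⟩ := Γ'
  subst htgt hsrc hunit hinv
  congr 1
  funext ζ ξ e
  exact hmul ζ ξ e e

end Uniqueness

/-! ### Smooth structure and naturality. -/

section Smooth

variable (𝕜 : Type*) [RCLike 𝕜]
variable {B : Type*} [NormedAddCommGroup B] [NormedSpace ℝ B] [FiniteDimensional ℝ B]
variable {M : Type*} [TopologicalSpace M] [ChartedSpace B M] [IsManifold 𝓘(ℝ, B) ∞ M] [T2Space M]
variable (G : EtaleLieGroupoid B M)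

theorem tgt_comp_gspHomeomorph_symm :
    G.ops.tgt ∘ (gspHomeomorph 𝕜 G).symm = Gsp.proj (hopf 𝕜 G) :=
  funext (tgt_gspHomeomorph_symm 𝕜)

theorem isLocalHomeomorph_gspProj : IsLocalHomeomorph (Gsp.proj (hopf 𝕜 G)) := by
  rw [← tgt_comp_gspHomeomorph_symm]
  exact G.isEtale.tgt_loc.isLocalHomeomorph.comp (gspHomeomorph 𝕜 G).symm.isLocalHomeomorph

noncomputable local instance : ChartedSpace B (Gsp (hopf 𝕜 G)) :=
  pullbackCharts (isLocalHomeomorph_gspProj 𝕜 G)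

theorem isLocalDiffeomorph_gspProj :
    IsLocalDiffeomorph 𝓘(ℝ, B) 𝓘(ℝ, B) ∞ (Gsp.proj (hopf 𝕜 G)) :=
  pullbackCharts_isLocalDiffeomorph (isLocalHomeomorph_gspProj 𝕜 G)

/-- The homeomorphism is compatible with the projections to `M`, and both projections are local
diffeomorphisms, so continuity is enough. -/
theorem isLocalDiffeomorph_gspHomeomorph :
    IsLocalDiffeomorph 𝓘(ℝ, B) 𝓘(ℝ, B) ∞ (gspHomeomorph 𝕜 G) :=
  isLocalDiffeomorph_of_comp (isLocalDiffeomorph_gspProj 𝕜 G) G.isEtale.tgt_loc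
    (gspHomeomorph 𝕜 G).continuous

theorem isLocalDiffeomorph_gspHomeomorph_symm :
    IsLocalDiffeomorph 𝓘(ℝ, B) 𝓘(ℝ, B) ∞ (gspHomeomorph 𝕜 G).symm :=
  isLocalDiffeomorph_of_comp G.isEtale.tgt_loc
    (by rw [tgt_comp_gspHomeomorph_symm]; exact isLocalDiffeomorph_gspProj 𝕜 G)
    (gspHomeomorph 𝕜 G).symm.continuous

theorem isEtaleLieGroupoid_spectralOps : IsEtaleLieGroupoid B (spectralOps 𝕜 G) := by
  have hsrc : IsLocalDiffeomorph 𝓘(ℝ, B) 𝓘(ℝ, B) ∞ (spectralOps 𝕜 G).src := fun ζ =>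
    (isLocalDiffeomorph_gspHomeomorph_symm 𝕜 G ζ).comp 𝓘(ℝ, B) M (G.isEtale.src_loc _)
  have htgt : IsLocalDiffeomorph 𝓘(ℝ, B) 𝓘(ℝ, B) ∞ (spectralOps 𝕜 G).tgt := fun ζ =>
    (isLocalDiffeomorph_gspHomeomorph_symm 𝕜 G ζ).comp 𝓘(ℝ, B) M (G.isEtale.tgt_loc _)
  have hs : ∀ g, (gspHomeomorph 𝕜 G).symm (gspHomeomorph 𝕜 G g) = g :=
    (gspHomeomorph 𝕜 G).symm_apply_apply
  have hD : ∀ ζ, gspHomeomorph 𝕜 G ((gspHomeomorph 𝕜 G).symm ζ) = ζ :=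
    (gspHomeomorph 𝕜 G).apply_symm_apply
  exact
  { isManifold := pullbackCharts_isManifold (isLocalHomeomorph_gspProj 𝕜 G)
    src_loc := hsrc
    tgt_loc := htgt
    unit_loc := fun y =>
      (G.isEtale.unit_loc y).comp 𝓘(ℝ, B) _ (isLocalDiffeomorph_gspHomeomorph 𝕜 G _)
    inv_loc := fun ζ => ((isLocalDiffeomorph_gspHomeomorph_symm 𝕜 G ζ).comp 𝓘(ℝ, B) _
      (G.isEtale.inv_loc _)).comp 𝓘(ℝ, B) _ (isLocalDiffeomorph_gspHomeomorph 𝕜 G _)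
    mul_loc := by
      -- The target of a product is the target of the first factor, so composed with the target the
      -- multiplication is a local diffeomorphism; only its continuity remains.
      refine isLocalDiffeomorph_of_comp htgt ?_ ?_
      · have : (spectralOps 𝕜 G).tgt ∘
            (fun p : FibreProd hsrc htgt => (spectralOps 𝕜 G).mul p.fst p.snd p.comm) =
            (spectralOps 𝕜 G).tgt ∘ FibreProd.fst := by
          funext p
          exact (congrArg G.ops.tgt (hs _)).trans (G.isEtale.tgt_mul _ _ p.comm)
        rw [this]
        exact fun p => (FibreProd.isLocalDiffeomorph_fst p).comp 𝓘(ℝ, B) M (htgt _)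
      · have hc : Continuous (fun p : FibreProd hsrc htgt =>
            (⟨(gspHomeomorph 𝕜 G).symm p.fst, (gspHomeomorph 𝕜 G).symm p.snd, p.comm⟩ :
              FibreProd G.isEtale.src_loc G.isEtale.tgt_loc)) :=
          FibreProd.isInducing_toProd.continuous_iff.2
            (((gspHomeomorph 𝕜 G).symm.continuous.comp FibreProd.continuous_fst).prodMk
              ((gspHomeomorph 𝕜 G).symm.continuous.comp FibreProd.continuous_snd))
        exact (gspHomeomorph 𝕜 G).continuous.comp
          (G.isEtale.mul_loc.isLocalHomeomorph.continuous.comp hc)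
    src_unit := fun y => (congrArg G.ops.src (hs _)).trans (G.isEtale.src_unit y)
    tgt_unit := fun y => (congrArg G.ops.tgt (hs _)).trans (G.isEtale.tgt_unit y)
    src_inv := fun ζ => (congrArg G.ops.src (hs _)).trans (G.isEtale.src_inv _)
    tgt_inv := fun ζ => (congrArg G.ops.tgt (hs _)).trans (G.isEtale.tgt_inv _)
    src_mul := fun ζ ξ e => (congrArg G.ops.src (hs _)).trans (G.isEtale.src_mul _ _ e)
    tgt_mul := fun ζ ξ e => (congrArg G.ops.tgt (hs _)).trans (G.isEtale.tgt_mul _ _ e)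
    mul_assoc := fun ζ ξ χ e e' => congrArg (gspHomeomorph 𝕜 G) <|
      ((IsEtaleLieGroupoid.mul_congr _ _ (hs _) rfl).trans (G.isEtale.mul_assoc _ _ _ e e')).trans
        (IsEtaleLieGroupoid.mul_congr _ _ rfl (hs _).symm)
    unit_mul := fun ζ => (congrArg (gspHomeomorph 𝕜 G)
      ((IsEtaleLieGroupoid.mul_congr _ _ (hs _) rfl).trans (G.isEtale.unit_mul _))).trans (hD ζ)
    mul_unit := fun ζ => (congrArg (gspHomeomorph 𝕜 G)
      ((IsEtaleLieGroupoid.mul_congr _ _ rfl (hs _)).trans (G.isEtale.mul_unit _))).trans (hD ζ)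
    inv_mul := fun ζ => congrArg (gspHomeomorph 𝕜 G)
      ((IsEtaleLieGroupoid.mul_congr _ _ (hs _) rfl).trans (G.isEtale.inv_mul _))
    mul_inv := fun ζ => congrArg (gspHomeomorph 𝕜 G)
      ((IsEtaleLieGroupoid.mul_congr _ _ rfl (hs _)).trans (G.isEtale.mul_inv _)) }

theorem isGroupoidMorphism_gspHomeomorph :
    IsGroupoidMorphism B G.ops (spectralOps 𝕜 G) (gspHomeomorph 𝕜 G) where
  smooth := (isLocalDiffeomorph_gspHomeomorph 𝕜 G).contMDiff
  src_eq g := congrArg G.ops.src ((gspHomeomorph 𝕜 G).symm_apply_apply g)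
  tgt_eq g := congrArg G.ops.tgt ((gspHomeomorph 𝕜 G).symm_apply_apply g)
  unit_eq _ := rfl
  mul_eq g h _ := congrArg (gspHomeomorph 𝕜 G) (IsEtaleLieGroupoid.mul_congr _ _
    ((gspHomeomorph 𝕜 G).symm_apply_apply g).symm ((gspHomeomorph 𝕜 G).symm_apply_apply h).symm)

theorem exists_diffeomorph_coe_eq_gspHomeomorph :
    ∃ D : G.Arr ≃ₘ^∞⟮𝓘(ℝ, B), 𝓘(ℝ, B)⟯ Gsp (hopf 𝕜 G), ⇑D = gspHomeomorph 𝕜 G :=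
  ⟨{ toEquiv := (gspHomeomorph 𝕜 G).toEquiv
     contMDiff_toFun := (isLocalDiffeomorph_gspHomeomorph 𝕜 G).contMDiff
     contMDiff_invFun := (isLocalDiffeomorph_gspHomeomorph_symm 𝕜 G).contMDiff }, rfl⟩

variable {G}

/-- The isomorphisms `G → G_sp(C_c^∞(G))` are natural in `G`. -/
theorem gspHomeomorph_natural {H : EtaleLieGroupoid B M} {φ : G.Arr → H.Arr}
    (hφ : IsGroupoidMorphism B G.ops H.ops φ) (g : G.Arr) :
    (gspHomeomorph 𝕜 H (φ g)).1.1 = spectralMap 𝕜 hφ (gspHomeomorph 𝕜 G g).1.1 := by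
  obtain ⟨a, -, ha⟩ := exists_invariant_isIndicatorAt 𝕜 g
  rw [(gspHomeomorph_eq_classAt_iff 𝕜 g a _).2 ⟨rfl, ha⟩]
  exact (gspHomeomorph_eq_classAt_iff 𝕜 (φ g) (pushforward hφ.isLocalDiffeomorph a) _).2
    ⟨hφ.tgt_eq g, isIndicatorAt_pushforward hφ ha⟩

end Smooth

end SpectralGroupoid

/-! ### The main theorem. -/

theorem theorem25 {𝕜 : Type u} [RCLike 𝕜]
    {B : Type v} [NormedAddCommGroup B] [NormedSpace ℝ B] [FiniteDimensional ℝ B]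
    {M : Type w} [TopologicalSpace M] [ChartedSpace B M] [IsManifold 𝓘(ℝ, B) ∞ M] [T2Space M] :
    -- the formulas of the spectral étale groupoid are well defined
    (∀ G : EtaleLieGroupoid.{v, w, x} B M,
      ∃! Γ : GroupoidOps M (Gsp (hopf 𝕜 G)), IsSpectralGroupoid (hopf 𝕜 G) Γ) ∧
    ∃ Φ : ∀ G : EtaleLieGroupoid.{v, w, x} B M, G.Arr → Gsp (hopf 𝕜 G),
      -- the formula for the maps `Φ G`
      (∀ (G : EtaleLieGroupoid.{v, w, x} B M) (g : G.Arr) (U : Set G.Arr) (hU : IsOpen U)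
        (hinj : InjOn G.ops.tgt U) (f : BaseAlg 𝕜 B M) (hf : tsupport f.1 ⊆ G.ops.tgt '' U),
        g ∈ U → (∀ᶠ y in 𝓝 (G.ops.tgt g), f.1 y = 1) →
        (Φ G g).1.1 = classAt (hopf 𝕜 G).toCoalgebraOps (liftElt G hU hinj f hf) (G.ops.tgt g)) ∧
      -- `Φ G` is an isomorphism of étale Lie groupoids over `M`
      (∀ (G : EtaleLieGroupoid.{v, w, x} B M) (Γ : GroupoidOps M (Gsp (hopf 𝕜 G))),
        IsSpectralGroupoid (hopf 𝕜 G) Γ →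
        ∃ h : IsLocalHomeomorph (Gsp.proj (hopf 𝕜 G)),
          letI : ChartedSpace B (Gsp (hopf 𝕜 G)) := pullbackCharts h
          IsEtaleLieGroupoid B Γ ∧ IsGroupoidMorphism B G.ops Γ (Φ G) ∧
            ∃ D : G.Arr ≃ₘ^∞⟮𝓘(ℝ, B), 𝓘(ℝ, B)⟯ Gsp (hopf 𝕜 G), ⇑D = Φ G) ∧
      -- `Φ G` is natural in `G`
      (∀ (G H : EtaleLieGroupoid.{v, w, x} B M) (φ : G.Arr → H.Arr)
        (hφ : IsGroupoidMorphism B G.ops H.ops φ) (g : G.Arr),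
        (Φ H (φ g)).1.1 = spectralMap 𝕜 hφ (Φ G g).1.1) ∧
      -- `G_sp(C_c^∞(G)) = E_sp(C_c^∞(G))`
      (∀ G : EtaleLieGroupoid.{v, w, x} B M, arrows (hopf 𝕜 G) = univ) := by
  have huniq : ∀ (G : EtaleLieGroupoid.{v, w, x} B M) (Γ : GroupoidOps M (Gsp (hopf 𝕜 G))),
      IsSpectralGroupoid (hopf 𝕜 G) Γ → Γ = spectralOps 𝕜 G :=
    fun G Γ h => h.unique (isSpectralGroupoid_spectralOps 𝕜 G)
  refine ⟨fun G => ⟨spectralOps 𝕜 G, isSpectralGroupoid_spectralOps 𝕜 G, huniq G⟩,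
    fun G => gspHomeomorph 𝕜 G, ?_, ?_, ?_, ?_⟩
  · intro G g U hU hinj f hf hg hf1
    exact (gspHomeomorph_eq_classAt_iff 𝕜 g _ _).2 ⟨rfl, isIndicatorAt_extZero hinj
      G.isEtale.tgt_loc.isLocalHomeomorph.continuous hg hf1⟩
  · intro G Γ h
    obtain rfl := huniq G Γ h
    exact ⟨isLocalHomeomorph_gspProj 𝕜 G, isEtaleLieGroupoid_spectralOps 𝕜 G,
      isGroupoidMorphism_gspHomeomorph 𝕜 G, exists_diffeomorph_coe_eq_gspHomeomorph 𝕜 G⟩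
  · intro G H φ hφ g
    exact gspHomeomorph_natural 𝕜 hφ g
  · intro G
    -- Every point of the spectral sheaf comes from an arrow of `G`, and a small bisection through
    -- it supplies an `S`-invariant representative.
    refine eq_univ_of_forall fun p => ?_
    obtain ⟨g, rfl⟩ := espPoint_surjective (𝕜 := 𝕜) G.isEtale.tgt_loc p
    exact espPoint_mem_arrows 𝕜 G g
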